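/- An \emph{étale groupoid} is a second countable locally compact Hausdorff topological groupoid whose range map is a local homeomorphism. For a local homeomorphism $\pi:X\to Y$ of locally compact Hausdorff spaces let $\pi_*:C_c(X,\mathbb Z)\to C_c(Y,\mathbb Z)$ be $\pi_*(f)(y)=\sum_{\pi(x)=y}f(x)$, where $C_c(X,\mathbb Z)$ is the group of compactly supported continuous functions with values in the discrete group $\mathbb Z$. For an étale groupoid $\mathcal G$ with source map $s$ and range map $r$, let $\mathcal G^{(0)}$ be its unit space and, for $n\ge1$, $\mathcal G^{(n)}=\{(g_1,\dots,g_n)\in\mathcal G^n: s(g_i)=r(g_{i+1})\}$. Let $d_0,\dots,d_n:\mathcal G^{(n)}\to\mathcal G^{(n-1)}$ be the face maps of the nerve: $d_0$ drops $g_1$, $d_n$ drops $g_n$, and $d_i$ multiplies $g_i$ and $g_{i+1}$ for $0<i<n$; for $n=1$, $d_0=s$ and $d_1=r$. Let $H_n(\mathcal G)$ be the $n$-th homology group of the chain complex $(C_c(\mathcal G^{(n)},\mathbb Z))_{n\ge0}$ with differential $\partial_n=\sum_{i=0}^n(-1)^i(d_i)_*$. It is a functor on the category of étale groupoids whose morphisms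 are the groupoid homomorphisms that are local homeomorphisms. \textbf{Theorem (Künneth).} Let $n\ge0$. For all étale groupoids $\mathcal G$ and $\mathcal H$ there is a short exact sequence, natural in $(\mathcal G,\mathcal H)$ with respect to these morphisms, $$0\longrightarrow\bigoplus_{i+j=n}H_i(\mathcal G)\otimes H_j(\mathcal H)\longrightarrow H_n(\mathcal G\times\mathcal H)\longrightarrow\bigoplus_{i+j=n-1}\operatorname{Tor}(H_i(\mathcal G),H_j(\mathcal H))\longrightarrow0,$$ where $i,j\ge0$, $\otimes=\otimes_{\mathbb Z}$ and $\operatorname{Tor}=\operatorname{Tor}_1^{\mathbb Z}$. For every $\mathcal G$ and $\mathcal H$ this sequence splits (the splitting is not claimed to be natural). -/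

import Mathlib

open CategoryTheory CategoryTheory.Limits MonoidalCategory Opposite Topology
open scoped CompactlySupported

section Pushforward

variable {X Y Z : Type} [TopologicalSpace X] [TopologicalSpace Y] [TopologicalSpace Z]

/-- The function `y ↦ ∑_{π x = y} f x`. -/
noncomputable def fiberSum (π : X → Y) (f : X → ℤ) (y : Y) : ℤ :=
  ∑ᶠ x ∈ π ⁻¹' {y}, f x

theorem finite_fiber_inter_tsupport [T2Space Y] {π : X → Y} (hπ : IsLocalHomeomorph π)
    (f : C_c(X, ℤ)) (y : Y) : (π ⁻¹' {y} ∩ tsupport f).Finite := by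
  have hc : IsCompact (π ⁻¹' {y} ∩ tsupport f) :=
    f.hasCompactSupport.isCompact.inter_left (isClosed_singleton.preimage hπ.continuous)
  have hsub : (π '' (π ⁻¹' {y} ∩ tsupport f)).Subsingleton := by
    rintro _ ⟨a, ha, rfl⟩ _ ⟨b, hb, rfl⟩
    exact (ha.1 : π a = y).trans (hb.1 : π b = y).symm
  have : Subsingleton (π '' (π ⁻¹' {y} ∩ tsupport f)) := hsub.coe_sort
  have : DiscreteTopology (π '' (π ⁻¹' {y} ∩ tsupport f)) := inferInstance
  have hd := (hπ.isLocalHomeomorphOn.mono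
    (Set.subset_univ (π ⁻¹' {y} ∩ tsupport f))).discreteTopology_of_image
  exact hc.finite hd.isDiscrete

theorem finite_fiber_inter_support [T2Space Y] {π : X → Y} (hπ : IsLocalHomeomorph π)
    (f : C_c(X, ℤ)) (y : Y) : (π ⁻¹' {y} ∩ Function.support f).Finite :=
  (finite_fiber_inter_tsupport hπ f y).subset
    (Set.inter_subset_inter_right _ (subset_tsupport f))

theorem isLocallyConstant_fiberSum [T2Space X] [T2Space Y] {π : X → Y}
    (hπ : IsLocalHomeomorph π) (f : C_c(X, ℤ)) : IsLocallyConstant (fiberSum π f) := by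
  classical
  rw [IsLocallyConstant.iff_eventually_eq]
  intro y₀
  have hfin := finite_fiber_inter_tsupport hπ f y₀
  obtain ⟨U, hU, hdisj⟩ := hfin.t2_separation
  set I := hfin.toFinset with hI
  have hmem : ∀ x ∈ I, π x = y₀ := fun x hx => ((hfin.mem_toFinset).1 hx).1
  choose e he heq using hπ
  have hcont : Continuous π := IsLocalHomeomorph.continuous fun x => ⟨e x, he x, heq x⟩
  set W : X → Set X := fun x => U x ∩ (e x).source with hW
  have hWo : ∀ x, IsOpen (W x) := fun x => (hU x).2.inter (e x).open_source
  set K := tsupport f \ ⋃ x ∈ I, W x with hK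
  have hKc : IsCompact K :=
    f.hasCompactSupport.isCompact.diff (isOpen_biUnion fun x _ => hWo x)
  have hy₀ : y₀ ∉ π '' K := by
    rintro ⟨x, ⟨hx1, hx2⟩, hx3⟩
    apply hx2
    refine Set.mem_biUnion (x := x) ?_ ⟨(hU x).1, he x⟩
    exact (hfin.mem_toFinset).2 ⟨hx3, hx1⟩
  have h1 : ∀ᶠ y in 𝓝 y₀, y ∉ π '' K :=
    (hKc.image hcont).isClosed.isOpen_compl.mem_nhds hy₀
  have h2 : ∀ᶠ y in 𝓝 y₀, ∀ x ∈ I, y ∈ (e x).target ∧ (e x).symm y ∈ W x ∧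
      f ((e x).symm y) = f x := by
    rw [Filter.eventually_all_finset]
    intro x hx
    have hxy : e x x = y₀ := by rw [← heq x]; exact hmem x hx
    have ht : y₀ ∈ (e x).target := hxy ▸ (e x).map_source (he x)
    have hs : (e x).symm y₀ = x := by rw [← hxy]; exact (e x).left_inv (he x)
    have hca : ContinuousAt (e x).symm y₀ := (e x).continuousAt_symm ht
    have h3 : ∀ᶠ y in 𝓝 y₀, y ∈ (e x).target := (e x).open_target.mem_nhds ht
    refine h3.and (Filter.Eventually.and ?_ ?_)
    · exact hca.eventually_mem ((hWo x).mem_nhds (by rw [hs]; exact ⟨(hU x).1, he x⟩))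
    · have : ContinuousAt (fun y => f ((e x).symm y)) y₀ :=
        (map_continuous f).continuousAt.comp hca
      have := this.eventually_mem (s := {f x}) (by
        simp only [hs]; exact (isOpen_discrete _).mem_nhds rfl)
      simpa using this
  have key : ∀ᶠ y in 𝓝 y₀, fiberSum π f y = ∑ x ∈ I, f x := by
    filter_upwards [h1, h2] with y hy1 hy2
    have hinj : Set.InjOn (fun x => (e x).symm y) I := by
      intro a ha b hb hab
      by_contra hne
      have := hdisj ((hfin.mem_toFinset).1 ha) ((hfin.mem_toFinset).1 hb) hne
      refine Set.disjoint_left.1 this (hy2 a ha).2.1.1 ?_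
      have hab' : (e a).symm y = (e b).symm y := hab
      rw [hab']
      exact (hy2 b hb).2.1.1
    have : fiberSum π f y = ∑ x ∈ I.image (fun x => (e x).symm y), f x := by
      unfold fiberSum
      apply finsum_mem_eq_sum_of_inter_support_eq
      ext x
      simp only [Set.mem_inter_iff, Set.mem_preimage, Set.mem_singleton_iff, Finset.coe_image,
        Set.mem_image, Finset.mem_coe, and_congr_left_iff]
      intro hx
      constructor
      · intro hxy
        have hxs : x ∈ tsupport f := subset_tsupport _ hx
        have : x ∈ ⋃ x ∈ I, W x := by
          by_contra hn
          exact hy1 ⟨x, ⟨hxs, hn⟩, hxy⟩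
        obtain ⟨z, hz, hxz⟩ := Set.mem_iUnion₂.1 this
        refine ⟨z, hz, ?_⟩
        rw [← hxy, heq z]
        exact (e z).left_inv hxz.2
      · rintro ⟨z, hz, rfl⟩
        rw [heq z]
        exact (e z).right_inv (hy2 z hz).1
    rw [this, Finset.sum_image hinj]
    exact Finset.sum_congr rfl fun x hx => (hy2 x hx).2.2
  have h0 := key.self_of_nhds
  filter_upwards [key] with y hy
  rw [hy, h0]

theorem hasCompactSupport_fiberSum [T2Space Y] {π : X → Y}
    (hπ : IsLocalHomeomorph π) (f : C_c(X, ℤ)) : HasCompactSupport (fiberSum π f) := by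
  refine HasCompactSupport.intro (f.hasCompactSupport.isCompact.image hπ.continuous) ?_
  intro y hy
  refine finsum_mem_eq_zero_of_forall_eq_zero fun x hx => ?_
  by_contra hne
  exact hy ⟨x, subset_tsupport _ hne, hx⟩

/-- The homomorphism `π_* : C_c(X, ℤ) → C_c(Y, ℤ)` induced by a local homeomorphism `π`,
`π_* f (y) = ∑_{π x = y} f x`. -/
noncomputable def pushforward [T2Space X] [T2Space Y] (π : X → Y) (hπ : IsLocalHomeomorph π) :
    C_c(X, ℤ) →ₗ[ℤ] C_c(Y, ℤ) where
  toFun f :=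
    { toFun := fiberSum π f
      continuous_toFun := (isLocallyConstant_fiberSum hπ f).continuous
      hasCompactSupport' := hasCompactSupport_fiberSum hπ f }
  map_add' f g := by
    ext y
    exact finsum_mem_add_distrib' (finite_fiber_inter_support hπ f y)
      (finite_fiber_inter_support hπ g y)
  map_smul' c f := by
    ext y
    exact ((AddMonoidHom.mulLeft c).map_finsum_mem' (finite_fiber_inter_support hπ f y)).symm

theorem pushforward_apply [T2Space X] [T2Space Y] (π : X → Y) (hπ : IsLocalHomeomorph π)
    (f : C_c(X, ℤ)) (y : Y) : pushforward π hπ f y = ∑ᶠ x ∈ π ⁻¹' {y}, f x := rfl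

theorem pushforward_id [T2Space X] (h : IsLocalHomeomorph (id : X → X)) :
    pushforward id h = LinearMap.id := by
  ext f y
  simp [pushforward_apply]

theorem pushforward_comp [T2Space X] [T2Space Y] [T2Space Z] {π : X → Y} {ρ : Y → Z}
    (hπ : IsLocalHomeomorph π) (hρ : IsLocalHomeomorph ρ) (h : IsLocalHomeomorph (ρ ∘ π)) :
    pushforward (ρ ∘ π) h = pushforward ρ hρ ∘ₗ pushforward π hπ := by
  classical
  ext f z
  have hF := finite_fiber_inter_support h f z
  set F := hF.toFinset with hFdef
  have memF : ∀ x, x ∈ F ↔ ρ (π x) = z ∧ f x ≠ 0 := fun x => by simp [hFdef]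
  have inner : ∀ y, ρ y = z → pushforward π hπ f y = ∑ x ∈ F with π x = y, f x := by
    intro y hy
    rw [pushforward_apply]
    apply finsum_mem_eq_sum_of_inter_support_eq
    ext x
    simp only [Set.mem_inter_iff, Set.mem_preimage, Set.mem_singleton_iff, Finset.coe_filter,
      Set.mem_ofPred_eq, memF, Function.mem_support]
    constructor
    · rintro ⟨rfl, hx⟩; exact ⟨⟨⟨hy, hx⟩, rfl⟩, hx⟩
    · rintro ⟨⟨_, hx'⟩, hx⟩; exact ⟨hx', hx⟩
  have outer : pushforward ρ hρ (pushforward π hπ f) z =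
      ∑ y ∈ F.image π, pushforward π hπ f y := by
    rw [pushforward_apply]
    apply finsum_mem_eq_sum_of_inter_support_eq
    ext y
    simp only [Set.mem_inter_iff, Set.mem_preimage, Set.mem_singleton_iff, Finset.coe_image,
      Set.mem_image, Finset.mem_coe, memF, Function.mem_support, and_congr_left_iff]
    intro hy
    constructor
    · intro hyz
      rw [inner y hyz] at hy
      obtain ⟨x, hx, _⟩ := Finset.exists_ne_zero_of_sum_ne_zero hy
      rw [Finset.mem_filter, memF] at hx
      exact ⟨x, hx.1, hx.2⟩
    · rintro ⟨x, ⟨hx, _⟩, rfl⟩; exact hx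
  have lhs : pushforward (ρ ∘ π) h f z = ∑ x ∈ F, f x := by
    rw [pushforward_apply]
    apply finsum_mem_eq_sum_of_inter_support_eq
    ext x
    simp only [Set.mem_inter_iff, Set.mem_preimage, Set.mem_singleton_iff, Finset.mem_coe, memF,
      Function.mem_support, Function.comp_apply]
    tauto
  rw [LinearMap.comp_apply, lhs, outer]
  rw [← Finset.sum_fiberwise_of_maps_to (g := π) (t := F.image π)
    (fun x hx => Finset.mem_image_of_mem _ hx)]
  refine Finset.sum_congr rfl fun y hy => (inner y ?_).symm
  obtain ⟨x, hx, rfl⟩ := Finset.mem_image.1 hy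
  exact ((memF x).1 hx).1

end Pushforward

/-- An étale groupoid: a second countable locally compact Hausdorff topological groupoid whose
range map is a local homeomorphism. An arrow `g` goes from `s g` to `r g`, and the product `g h` is
defined when `s g = r h`. The unit space is given as a separate type `Obj`, embedded into the space
`Arr` of arrows by `one`. -/
structure EtaleGroupoid where
  Obj : Type
  Arr : Type
  [topObj : TopologicalSpace Obj]
  [topArr : TopologicalSpace Arr]
  [t2Arr : T2Space Arr]
  [locallyCompactArr : LocallyCompactSpace Arr]
  [secondCountableArr : SecondCountableTopology Arr]
  r : Arr → Obj
  s : Arr → Obj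
  one : Obj → Arr
  inv : Arr → Arr
  mul : (g h : Arr) → s g = r h → Arr
  r_one : ∀ x, r (one x) = x
  s_one : ∀ x, s (one x) = x
  r_inv : ∀ g, r (inv g) = s g
  s_inv : ∀ g, s (inv g) = r g
  r_mul : ∀ g h (w : s g = r h), r (mul g h w) = r g
  s_mul : ∀ g h (w : s g = r h), s (mul g h w) = s h
  one_mul : ∀ g, mul (one (r g)) g (s_one _) = g
  mul_one : ∀ g, mul g (one (s g)) (r_one _).symm = g
  inv_mul : ∀ g, mul (inv g) g (s_inv g) = one (s g)
  mul_inv : ∀ g, mul g (inv g) (r_inv g).symm = one (r g)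
  mul_assoc : ∀ g h k (w : s g = r h) (w' : s h = r k),
    mul (mul g h w) k ((s_mul g h w).trans w') = mul g (mul h k w') (w.trans (r_mul h k w').symm)
  continuous_s : Continuous s
  continuous_one : Continuous one
  continuous_inv : Continuous inv
  continuous_mul : Continuous fun p : {p : Arr × Arr // s p.1 = r p.2} => mul p.1.1 p.1.2 p.2
  isLocalHomeomorph_r : IsLocalHomeomorph r

namespace EtaleGroupoid

attribute [instance] topObj topArr t2Arr locallyCompactArr secondCountableArr

section Basic

variable (G : EtaleGroupoid)

theorem continuous_r : Continuous G.r := G.isLocalHomeomorph_r.continuous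

theorem continuous_mul_of_continuous {Z : Type*} [TopologicalSpace Z] {f g : Z → G.Arr}
    (hf : Continuous f) (hg : Continuous g) (w : ∀ z, G.s (f z) = G.r (g z)) :
    Continuous fun z => G.mul (f z) (g z) (w z) :=
  G.continuous_mul.comp (f := fun z => ⟨(f z, g z), w z⟩)
    (Continuous.subtype_mk (hf.prodMk hg) _)

instance : T2Space G.Obj :=
  T2Space.of_injective_continuous (Function.LeftInverse.injective G.r_one) G.continuous_one

theorem inv_inv (g : G.Arr) : G.inv (G.inv g) = g := by
  have h1 := G.mul_assoc (G.inv (G.inv g)) (G.inv g) g (G.s_inv _) (G.s_inv _)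
  simp only [G.inv_mul] at h1
  have e1 : G.mul (G.one (G.s (G.inv g))) g ((G.s_one _).trans (G.s_inv g)) = g := by
    have : ∀ x (hx : x = G.r g), G.mul (G.one x) g ((G.s_one x).trans hx) = g := by
      rintro _ rfl; exact G.one_mul g
    exact this _ (G.s_inv g)
  have e2 : G.mul (G.inv (G.inv g)) (G.one (G.s g))
      (((G.s_inv _).trans (G.r_inv g)).trans (G.r_one _).symm) = G.inv (G.inv g) := by
    have : ∀ x (hx : G.s (G.inv (G.inv g)) = x), G.mul (G.inv (G.inv g)) (G.one x)
        (hx.trans (G.r_one x).symm) = G.inv (G.inv g) := by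
      rintro _ rfl; exact G.mul_one _
    exact this _ ((G.s_inv _).trans (G.r_inv g))
  exact e2.symm.trans (h1.symm.trans e1)

theorem isLocalHomeomorph_s : IsLocalHomeomorph G.s := by
  have hi : IsLocalHomeomorph G.inv :=
    (Homeomorph.mk (Function.Involutive.toPerm G.inv G.inv_inv)
      G.continuous_inv G.continuous_inv).isLocalHomeomorph
  have : G.s = G.r ∘ G.inv := funext fun g => (G.r_inv g).symm
  rw [this]
  exact G.isLocalHomeomorph_r.comp hi

/-- `G.Nerve n` is the space `G⁽ⁿ⁾` of composable strings of `n` arrows: functors from the poset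
`{0 < 1 < ⋯ < n}` to `G`, given by vertices `x₀, …, xₙ` and all the arrows `g i j` (`i ≤ j`) with
range `xᵢ` and source `xⱼ`. The string `(g₁, …, gₙ)` consists of the `gᵢ = g (i-1) i`, and `g i j`
is the product `gᵢ₊₁ ⋯ gⱼ`. -/
@[ext]
structure Nerve (n : ℕ) where
  vert : Fin (n + 1) → G.Obj
  arr : {p : Fin (n + 1) × Fin (n + 1) // p.1 ≤ p.2} → G.Arr
  r_arr : ∀ p, G.r (arr p) = vert p.1.1
  s_arr : ∀ p, G.s (arr p) = vert p.1.2
  arr_self : ∀ i, arr ⟨(i, i), le_rfl⟩ = G.one (vert i)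
  arr_mul : ∀ i j k (hij : i ≤ j) (hjk : j ≤ k),
    G.mul (arr ⟨(i, j), hij⟩) (arr ⟨(j, k), hjk⟩)
        ((s_arr ⟨(i, j), hij⟩).trans (r_arr ⟨(j, k), hjk⟩).symm) =
      arr ⟨(i, k), hij.trans hjk⟩

end Basic

namespace Nerve

variable {G : EtaleGroupoid} {n : ℕ}

/-- The topology of `G⁽ⁿ⁾` as a subspace of a product of copies of the unit space and of the space
of arrows. -/
instance : TopologicalSpace (G.Nerve n) :=
  TopologicalSpace.induced (fun x => (x.vert, x.arr)) inferInstance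

theorem isEmbedding : IsEmbedding (fun x : G.Nerve n => (x.vert, x.arr)) :=
  ⟨⟨rfl⟩, fun _ _ h => Nerve.ext (congrArg Prod.fst h) (congrArg Prod.snd h)⟩

instance : T2Space (G.Nerve n) := isEmbedding.t2Space

theorem continuous_vert (i : Fin (n + 1)) : Continuous fun x : G.Nerve n => x.vert i :=
  (continuous_apply i).comp (continuous_fst.comp isEmbedding.continuous)

theorem continuous_arr (p) : Continuous fun x : G.Nerve n => x.arr p :=
  (continuous_apply p).comp (continuous_snd.comp isEmbedding.continuous)

/-- The map `G⁽ⁿ⁾ → G⁽ᵐ⁾` induced by a monotone map `{0, …, m} → {0, …, n}`. For the map that omits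
`i` it is the face map `dᵢ`, and for the one that repeats `j` it is the degeneracy map `sⱼ`. -/
def pull {m : ℕ} (θ : Fin (m + 1) →o Fin (n + 1)) (x : G.Nerve n) : G.Nerve m where
  vert i := x.vert (θ i)
  arr p := x.arr ⟨(θ p.1.1, θ p.1.2), θ.monotone p.2⟩
  r_arr _ := x.r_arr _
  s_arr _ := x.s_arr _
  arr_self i := x.arr_self (θ i)
  arr_mul _ _ _ hij hjk := x.arr_mul _ _ _ (θ.monotone hij) (θ.monotone hjk)

theorem continuous_pull {m : ℕ} (θ : Fin (m + 1) →o Fin (n + 1)) :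
    Continuous (pull (G := G) θ) :=
  isEmbedding.continuous_iff.2 <| (continuous_pi fun i => continuous_vert (θ i)).prodMk
    (continuous_pi fun _ => continuous_arr _)

theorem arr_eq (x : G.Nerve n) (p : {p : Fin (n + 1) × Fin (n + 1) // p.1 ≤ p.2}) :
    x.arr p = G.mul (G.inv (x.arr ⟨(0, p.1.1), Fin.zero_le _⟩))
      (x.arr ⟨(0, p.1.2), Fin.zero_le _⟩)
      ((G.s_inv _).trans ((x.r_arr ⟨(0, p.1.1), Fin.zero_le _⟩).trans
        (x.r_arr ⟨(0, p.1.2), Fin.zero_le _⟩).symm)) := by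
  obtain ⟨⟨i, j⟩, hij⟩ := p
  have h := x.arr_mul 0 i j (Fin.zero_le _) hij
  simp only [← h]
  rw [← G.mul_assoc _ _ _ (G.s_inv _)
    ((x.s_arr ⟨(0, i), Fin.zero_le _⟩).trans (x.r_arr ⟨(i, j), hij⟩).symm)]
  simp only [G.inv_mul]
  have : ∀ y (hy : y = G.r (x.arr ⟨(i, j), hij⟩)),
      x.arr ⟨(i, j), hij⟩ = G.mul (G.one y) (x.arr ⟨(i, j), hij⟩) ((G.s_one y).trans hy) := by
    rintro _ rfl; exact (G.one_mul _).symm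
  exact this _ ((x.s_arr ⟨(0, i), Fin.zero_le _⟩).trans (x.r_arr ⟨(i, j), hij⟩).symm)

theorem ext_star {x y : G.Nerve n}
    (h : ∀ j, x.arr ⟨(0, j), Fin.zero_le _⟩ = y.arr ⟨(0, j), Fin.zero_le _⟩) : x = y := by
  refine Nerve.ext ?_ ?_
  · funext j
    rw [← x.s_arr ⟨(0, j), Fin.zero_le _⟩, h, y.s_arr]
  · funext p
    rw [x.arr_eq, y.arr_eq]
    simp only [h]

/-- The element of `G⁽ⁿ⁾` determined by arrows `h₀, …, hₙ` with a common range, with `g i j`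
equal to `hᵢ⁻¹ hⱼ`. -/
def ofStar (h : Fin (n + 1) → G.Arr) (hr : ∀ i j, G.r (h i) = G.r (h j)) : G.Nerve n where
  vert i := G.s (h i)
  arr p := G.mul (G.inv (h p.1.1)) (h p.1.2) ((G.s_inv _).trans (hr _ _))
  r_arr _ := (G.r_mul _ _ _).trans (G.r_inv _)
  s_arr _ := G.s_mul _ _ _
  arr_self i := G.inv_mul _
  arr_mul i j k _ _ := by
    have e : ∀ y (hy : y = G.r (h k)), G.mul (G.one y) (h k) ((G.s_one y).trans hy) = h k := by
      rintro _ rfl; exact G.one_mul _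
    have h1 := G.mul_assoc (h j) (G.inv (h j)) (h k) (G.r_inv _).symm ((G.s_inv _).trans (hr _ _))
    simp only [G.mul_inv] at h1
    rw [e _ (hr _ _)] at h1
    rw [G.mul_assoc _ _ _ ((G.s_inv _).trans (hr _ _)) ((G.r_inv _).symm.trans (G.r_mul _ _ _).symm)]
    simp only [← h1]

theorem isLocalHomeomorph_vert_zero : IsLocalHomeomorph fun x : G.Nerve n => x.vert 0 := by
  have hr := G.isLocalHomeomorph_r
  have hcont := continuous_vert (G := G) (n := n) 0
  choose e he heq using hr
  have hopen : IsOpenMap fun x : G.Nerve n => x.vert 0 := by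
    rw [isOpenMap_iff_nhds_le]
    intro x
    set a : Fin (n + 1) → G.Arr := fun j => x.arr ⟨(0, j), Fin.zero_le _⟩ with ha
    set V : Set G.Obj := ⋂ j, (e (a j)).target with hV
    have hVo : IsOpen V := isOpen_iInter_of_finite fun j => (e (a j)).open_target
    have hea : ∀ j, e (a j) (a j) = x.vert 0 := fun j => by
      rw [← heq (a j)]; exact x.r_arr _
    have hxV : x.vert 0 ∈ V := Set.mem_iInter.2 fun j => by
      rw [← hea j]; exact (e (a j)).map_source (he _)
    set h : V → Fin (n + 1) → G.Arr := fun y j =>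
      if j = 0 then G.one y.1 else (e (a j)).symm y.1 with hh
    have hrh : ∀ y j, G.r (h y j) = y.1 := by
      intro y j
      by_cases hj : j = 0
      · simp only [hh, hj, if_true, G.r_one]
      · simp only [hh, hj, if_false]
        rw [heq (a j)]
        exact (e (a j)).right_inv (Set.mem_iInter.1 y.2 j)
    have hch : ∀ j, Continuous fun y => h y j := by
      intro j
      by_cases hj : j = 0
      · simp only [hh, hj, if_true]
        exact G.continuous_one.comp continuous_subtype_val
      · simp only [hh, hj, if_false]
        exact ((e (a j)).continuousOn_symm.comp_continuous continuous_subtype_val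
          fun y => Set.mem_iInter.1 y.2 j)
    set σ : V → G.Nerve n := fun y => ofStar (h y) fun i j => (hrh y i).trans (hrh y j).symm with hσ
    have hσc : Continuous σ := by
      refine isEmbedding.continuous_iff.2 (Continuous.prodMk ?_ ?_)
      · exact continuous_pi fun i => G.continuous_s.comp (hch i)
      · refine continuous_pi fun p => ?_
        exact G.continuous_mul_of_continuous (G.continuous_inv.comp (hch p.1.1)) (hch p.1.2) _
    have hσv : ∀ y, (σ y).vert 0 = y.1 := fun y => by
      simp [hσ, ofStar, hh, G.s_one]
    have hσx : σ ⟨x.vert 0, hxV⟩ = x := by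
      have hhx : ∀ j, h ⟨x.vert 0, hxV⟩ j = a j := by
        intro j
        by_cases hj : j = 0
        · subst hj
          simp only [hh, if_true, ha]
          exact (x.arr_self 0).symm
        · simp only [hh, hj, if_false]
          rw [← hea j]
          exact (e (a j)).left_inv (he _)
      refine Nerve.ext ?_ ?_
      · funext i
        change G.s (h _ i) = _
        rw [hhx]
        exact x.s_arr _
      · funext p
        rw [x.arr_eq p]
        simp only [hσ, ofStar, hhx, ha]
    intro S hS
    have hS' : σ ⁻¹' ((fun x : G.Nerve n => x.vert 0) ⁻¹' S) ∈ 𝓝 (⟨x.vert 0, hxV⟩ : V) := by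
      apply hσc.continuousAt
      rw [hσx]
      exact hS
    have := (hVo.isOpenMap_subtype_val).image_mem_nhds hS'
    refine Filter.mem_of_superset this ?_
    rintro _ ⟨y, hy, rfl⟩
    have hy' : (σ y).vert 0 ∈ S := hy
    rwa [hσv] at hy'
  rw [isLocalHomeomorph_iff_isOpenEmbedding_restrict]
  intro x
  set U : Set (G.Nerve n) := ⋂ j, (fun y : G.Nerve n => y.arr ⟨(0, j), Fin.zero_le _⟩) ⁻¹'
    (e (x.arr ⟨(0, j), Fin.zero_le _⟩)).source with hU
  have hUo : IsOpen U := isOpen_iInter_of_finite fun j =>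
    (e _).open_source.preimage (continuous_arr _)
  refine ⟨U, hUo.mem_nhds (Set.mem_iInter.2 fun j => he _), ?_⟩
  refine .of_continuous_injective_isOpenMap (hcont.comp continuous_subtype_val) ?_
    (hopen.comp hUo.isOpenMap_subtype_val)
  rintro ⟨y, hy⟩ ⟨z, hz⟩ hyz
  have hyz' : y.vert 0 = z.vert 0 := hyz
  refine Subtype.ext (ext_star fun j => ?_)
  refine (e (x.arr ⟨(0, j), Fin.zero_le _⟩)).injOn (Set.mem_iInter.1 hy j) (Set.mem_iInter.1 hz j) ?_
  rw [← heq, y.r_arr, z.r_arr]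
  exact hyz'

theorem isLocalHomeomorph_vert (i : Fin (n + 1)) :
    IsLocalHomeomorph fun x : G.Nerve n => x.vert i := by
  have h1 : IsLocalHomeomorph fun x : G.Nerve n => x.arr ⟨(0, i), Fin.zero_le _⟩ := by
    refine IsLocalHomeomorph.of_comp ?_ G.isLocalHomeomorph_r (continuous_arr _)
    have : G.r ∘ (fun x : G.Nerve n => x.arr ⟨(0, i), Fin.zero_le _⟩) = fun x => x.vert 0 :=
      funext fun x => x.r_arr _
    rw [this]
    exact isLocalHomeomorph_vert_zero
  have : (fun x : G.Nerve n => x.vert i) =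
      G.s ∘ fun x : G.Nerve n => x.arr ⟨(0, i), Fin.zero_le _⟩ :=
    funext fun x => (x.s_arr ⟨(0, i), Fin.zero_le _⟩).symm
  rw [this]
  exact G.isLocalHomeomorph_s.comp h1

theorem isLocalHomeomorph_pull {m : ℕ} (θ : Fin (m + 1) →o Fin (n + 1)) :
    IsLocalHomeomorph (pull (G := G) θ) :=
  IsLocalHomeomorph.of_comp (isLocalHomeomorph_vert (θ 0)) (isLocalHomeomorph_vert 0)
    (continuous_pull θ)

end Nerve

/-- Morphisms of étale groupoids: groupoid homomorphisms that are local homeomorphisms. -/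
@[ext]
structure Hom (G H : EtaleGroupoid) where
  obj : G.Obj → H.Obj
  arr : G.Arr → H.Arr
  r_arr : ∀ g, H.r (arr g) = obj (G.r g)
  s_arr : ∀ g, H.s (arr g) = obj (G.s g)
  arr_one : ∀ x, arr (G.one x) = H.one (obj x)
  arr_mul : ∀ g h (w : G.s g = G.r h), arr (G.mul g h w) =
    H.mul (arr g) (arr h) ((s_arr g).trans ((congrArg obj w).trans (r_arr h).symm))
  isLocalHomeomorph_arr : IsLocalHomeomorph arr

instance : Category EtaleGroupoid where
  Hom := Hom
  id G :=
    { obj := id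
      arr := id
      r_arr := fun _ => rfl
      s_arr := fun _ => rfl
      arr_one := fun _ => rfl
      arr_mul := fun _ _ _ => rfl
      isLocalHomeomorph_arr := (Homeomorph.refl _).isLocalHomeomorph }
  comp φ ψ :=
    { obj := ψ.obj ∘ φ.obj
      arr := ψ.arr ∘ φ.arr
      r_arr := fun g => by simp [ψ.r_arr, φ.r_arr]
      s_arr := fun g => by simp [ψ.s_arr, φ.s_arr]
      arr_one := fun x => by simp [ψ.arr_one, φ.arr_one]
      arr_mul := fun g h w => by simp [ψ.arr_mul, φ.arr_mul]
      isLocalHomeomorph_arr := ψ.isLocalHomeomorph_arr.comp φ.isLocalHomeomorph_arr }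

namespace Hom

variable {G H : EtaleGroupoid}

theorem isLocalHomeomorph_obj (φ : Hom G H) : IsLocalHomeomorph φ.obj := by
  have hone : ∀ K : EtaleGroupoid, IsLocalHomeomorph K.one := fun K => by
    refine IsLocalHomeomorph.of_comp ?_ K.isLocalHomeomorph_r K.continuous_one
    rw [show K.r ∘ K.one = id from funext K.r_one]
    exact (Homeomorph.refl _).isLocalHomeomorph
  have : φ.obj = H.r ∘ φ.arr ∘ G.one := funext fun x => by
    simp [φ.arr_one, H.r_one]
  rw [this]
  exact H.isLocalHomeomorph_r.comp (φ.isLocalHomeomorph_arr.comp (hone G))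

/-- The map `G⁽ⁿ⁾ → H⁽ⁿ⁾` induced by a morphism `G ⟶ H`. -/
def nerve (φ : Hom G H) (n : ℕ) (x : G.Nerve n) : H.Nerve n where
  vert i := φ.obj (x.vert i)
  arr p := φ.arr (x.arr p)
  r_arr p := by rw [φ.r_arr, x.r_arr]
  s_arr p := by rw [φ.s_arr, x.s_arr]
  arr_self i := by rw [x.arr_self, φ.arr_one]
  arr_mul i j k hij hjk := by
    rw [← φ.arr_mul _ _ ((x.s_arr ⟨(i, j), hij⟩).trans (x.r_arr ⟨(j, k), hjk⟩).symm), x.arr_mul]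

theorem isLocalHomeomorph_nerve (φ : Hom G H) (n : ℕ) : IsLocalHomeomorph (φ.nerve n) := by
  refine IsLocalHomeomorph.of_comp (g := fun x : H.Nerve n => x.vert 0) ?_
    (Nerve.isLocalHomeomorph_vert 0) ?_
  · exact φ.isLocalHomeomorph_obj.comp (Nerve.isLocalHomeomorph_vert 0)
  · refine Nerve.isEmbedding.continuous_iff.2 (Continuous.prodMk ?_ ?_)
    · exact continuous_pi fun i =>
        φ.isLocalHomeomorph_obj.continuous.comp (Nerve.continuous_vert i)
    · exact continuous_pi fun p =>
        φ.isLocalHomeomorph_arr.continuous.comp (Nerve.continuous_arr p)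

end Hom

/-- The simplicial abelian group `n ↦ C_c(G⁽ⁿ⁾, ℤ)`. -/
noncomputable def simplicialModule (G : EtaleGroupoid) : SimplicialObject (ModuleCat.{0} ℤ) where
  obj Δ := ModuleCat.of ℤ C_c(G.Nerve Δ.unop.len, ℤ)
  map θ := ModuleCat.ofHom
    (pushforward (Nerve.pull θ.unop.toOrderHom) (Nerve.isLocalHomeomorph_pull _))
  map_id Δ := by
    rw [← ModuleCat.ofHom_id]
    congr 1
    exact pushforward_id (Homeomorph.refl _).isLocalHomeomorph
  map_comp θ θ' := by
    rw [← ModuleCat.ofHom_comp]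
    congr 1
    exact pushforward_comp (Nerve.isLocalHomeomorph_pull _) (Nerve.isLocalHomeomorph_pull _)
      ((Nerve.isLocalHomeomorph_pull _).comp (Nerve.isLocalHomeomorph_pull _))

/-- The simplicial abelian group `n ↦ C_c(G⁽ⁿ⁾, ℤ)`, as a functor of `G`. -/
noncomputable def simplicialModuleFunctor :
    EtaleGroupoid ⥤ SimplicialObject (ModuleCat.{0} ℤ) where
  obj G := simplicialModule G
  map {G H} φ :=
    { app := fun Δ => ModuleCat.ofHom
        (pushforward (Hom.nerve φ Δ.unop.len) (Hom.isLocalHomeomorph_nerve φ _))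
      naturality := fun Δ Δ' θ => by
        have h := (Hom.isLocalHomeomorph_nerve φ Δ'.unop.len).comp
          (Nerve.isLocalHomeomorph_pull (G := G) θ.unop.toOrderHom)
        refine (ModuleCat.ofHom_comp _ _).symm.trans
          (Eq.trans ?_ (ModuleCat.ofHom_comp _ _))
        congr 1
        exact (pushforward_comp _ _ h).symm.trans
          (pushforward_comp (Hom.isLocalHomeomorph_nerve φ _)
            (Nerve.isLocalHomeomorph_pull θ.unop.toOrderHom) h) }
  map_id G := by
    apply NatTrans.ext
    funext Δ
    exact congrArg ModuleCat.ofHom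
      (pushforward_id (X := G.Nerve Δ.unop.len) (Homeomorph.refl _).isLocalHomeomorph)
  map_comp φ ψ := by
    apply NatTrans.ext
    funext Δ
    refine Eq.trans ?_ (ModuleCat.ofHom_comp _ _)
    exact congrArg ModuleCat.ofHom (pushforward_comp (Hom.isLocalHomeomorph_nerve φ _)
      (Hom.isLocalHomeomorph_nerve ψ _)
      ((Hom.isLocalHomeomorph_nerve ψ _).comp (Hom.isLocalHomeomorph_nerve φ _)))

/-- The groupoid homology `Hₙ(G) = Hₙ(G, ℤ)`, as a functor of `G`: the `n`-th homology of the
complex `C_c(G⁽ⁿ⁾, ℤ)` with differential `∂ₙ = ∑ᵢ (-1)ⁱ (dᵢ)_*`. -/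
noncomputable def homology (n : ℕ) : EtaleGroupoid ⥤ ModuleCat.{0} ℤ :=
  simplicialModuleFunctor ⋙ AlgebraicTopology.alternatingFaceMapComplex (ModuleCat.{0} ℤ) ⋙
    HomologicalComplex.homologyFunctor (ModuleCat.{0} ℤ) (ComplexShape.down ℕ) n

theorem isLocalHomeomorph_prodMap {X X' Y Y' : Type} [TopologicalSpace X] [TopologicalSpace X']
    [TopologicalSpace Y] [TopologicalSpace Y'] {f : X → X'} {g : Y → Y'}
    (hf : IsLocalHomeomorph f) (hg : IsLocalHomeomorph g) :
    IsLocalHomeomorph (Prod.map f g) := by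
  rintro ⟨x, y⟩
  obtain ⟨e, hx, rfl⟩ := hf x
  obtain ⟨e', hy, rfl⟩ := hg y
  exact ⟨e.prod e', ⟨hx, hy⟩, rfl⟩

/-- The product groupoid `G × H`. -/
def prod (G H : EtaleGroupoid) : EtaleGroupoid where
  Obj := G.Obj × H.Obj
  Arr := G.Arr × H.Arr
  r := Prod.map G.r H.r
  s := Prod.map G.s H.s
  one := Prod.map G.one H.one
  inv := Prod.map G.inv H.inv
  mul g h w := (G.mul g.1 h.1 (congrArg Prod.fst w), H.mul g.2 h.2 (congrArg Prod.snd w))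
  r_one x := Prod.ext (G.r_one _) (H.r_one _)
  s_one x := Prod.ext (G.s_one _) (H.s_one _)
  r_inv g := Prod.ext (G.r_inv _) (H.r_inv _)
  s_inv g := Prod.ext (G.s_inv _) (H.s_inv _)
  r_mul g h w := Prod.ext (G.r_mul _ _ _) (H.r_mul _ _ _)
  s_mul g h w := Prod.ext (G.s_mul _ _ _) (H.s_mul _ _ _)
  one_mul g := Prod.ext (G.one_mul _) (H.one_mul _)
  mul_one g := Prod.ext (G.mul_one _) (H.mul_one _)
  inv_mul g := Prod.ext (G.inv_mul _) (H.inv_mul _)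
  mul_inv g := Prod.ext (G.mul_inv _) (H.mul_inv _)
  mul_assoc g h k w w' := Prod.ext (G.mul_assoc _ _ _ _ _) (H.mul_assoc _ _ _ _ _)
  continuous_s := G.continuous_s.prodMap H.continuous_s
  continuous_one := G.continuous_one.prodMap H.continuous_one
  continuous_inv := G.continuous_inv.prodMap H.continuous_inv
  continuous_mul := by
    let T := {p : (G.Arr × H.Arr) × (G.Arr × H.Arr) //
      Prod.map G.s H.s p.1 = Prod.map G.r H.r p.2}
    have h1 : Continuous fun p : T => p.1.1 := by fun_prop
    have h2 : Continuous fun p : T => p.1.2 := by fun_prop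
    exact (G.continuous_mul_of_continuous h1.fst h2.fst fun p => congrArg Prod.fst p.2).prodMk
      (H.continuous_mul_of_continuous h1.snd h2.snd fun p => congrArg Prod.snd p.2)
  isLocalHomeomorph_r := isLocalHomeomorph_prodMap G.isLocalHomeomorph_r H.isLocalHomeomorph_r

/-- The product `(G, H) ↦ G × H` as a functor. -/
def prodFunctor : EtaleGroupoid × EtaleGroupoid ⥤ EtaleGroupoid where
  obj P := prod P.1 P.2
  map {P Q} φ :=
    { obj := Prod.map (Hom.obj φ.1) (Hom.obj φ.2)
      arr := Prod.map (Hom.arr φ.1) (Hom.arr φ.2)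
      r_arr := fun g => Prod.ext (Hom.r_arr φ.1 _) (Hom.r_arr φ.2 _)
      s_arr := fun g => Prod.ext (Hom.s_arr φ.1 _) (Hom.s_arr φ.2 _)
      arr_one := fun x => Prod.ext (Hom.arr_one φ.1 _) (Hom.arr_one φ.2 _)
      arr_mul := fun g h w => Prod.ext (Hom.arr_mul φ.1 _ _ _) (Hom.arr_mul φ.2 _ _ _)
      isLocalHomeomorph_arr := isLocalHomeomorph_prodMap (Hom.isLocalHomeomorph_arr φ.1)
        (Hom.isLocalHomeomorph_arr φ.2) }

instance (n k : ℕ) : Finite {p : ℕ × ℕ // p.1 + p.2 + k = n} :=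
  Set.Finite.to_subtype (s := {p : ℕ × ℕ | p.1 + p.2 + k = n})
    ((Set.finite_Iic (n, n)).subset fun p (hp : p.1 + p.2 + k = n) =>
      Prod.mk_le_mk.2 ⟨by omega, by omega⟩)

/-- The pointwise direct sum of a finite family of functors to abelian groups. -/
noncomputable def directSumFunctor {C : Type*} [Category C] {J : Type} [Finite J]
    (F : J → C ⥤ ModuleCat.{0} ℤ) : C ⥤ ModuleCat.{0} ℤ where
  obj P := ⨁ fun j => (F j).obj P
  map φ := biproduct.map fun j => (F j).map φ
  map_id P := by apply biproduct.hom_ext; simp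
  map_comp φ ψ := by apply biproduct.hom_ext; simp

/-- The functor `(G, H) ↦ ⨁_{i + j = n} Hᵢ(G) ⊗ Hⱼ(H)`. -/
noncomputable def tensorSum (n : ℕ) : EtaleGroupoid × EtaleGroupoid ⥤ ModuleCat.{0} ℤ :=
  directSumFunctor fun p : {p : ℕ × ℕ // p.1 + p.2 + 0 = n} =>
    (homology p.1.1).prod (homology p.1.2) ⋙ tensor (ModuleCat.{0} ℤ)

/-- The functor `(G, H) ↦ ⨁_{i + j = n - 1} Tor(Hᵢ(G), Hⱼ(H))`, where `Tor = Tor₁^ℤ`. The sum is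
empty for `n = 0`. -/
noncomputable def torSum (n : ℕ) : EtaleGroupoid × EtaleGroupoid ⥤ ModuleCat.{0} ℤ :=
  directSumFunctor fun p : {p : ℕ × ℕ // p.1 + p.2 + 1 = n} =>
    (homology p.1.1).prod (homology p.1.2) ⋙ Functor.uncurry.obj (Tor (ModuleCat.{0} ℤ) 1)

end EtaleGroupoid

/-! Write `C` and `D` for the complexes of `G` and `H`. The theorem combines three facts.

Products: the nerve of `G × H` is the product of the nerves, and the external product `C_c(X, ℤ) ⊗
C_c(Y, ℤ) → C_c(X × Y, ℤ)` is bijective (`externalProduct_injective`, `externalProduct_surjective`)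
and compatible with pushforward. Hence the simplicial group of `G × H` is the diagonal of the
bisimplicial group `(p, q) ↦ C p ⊗ D q` (`simplicialModuleProdIso`).

Eilenberg–Zilber: for a bisimplicial module `X`, both `X (p, q)` and `X (q, q)` are compared with `X
(q * p, q)`, where `*` is the ordinal sum; no shuffle or Alexander–Whitney formulas occur.
Restriction to `p` is a homotopy equivalence for fixed `p`, because `q` can be pushed onto the first
element of `p`. Restriction to `q` is an augmentation that has extra degeneracies for fixed `q`.
Both comparisons therefore induce isomorphisms on the homology of total complexes
(`coneExact_totMap`, `bijective_totAug`), and they are natural in `X`.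

Algebraic Künneth: the range of a compactly supported integer-valued function is compact, so the
function extends to the Stone–Čech compactification and descends to its profinite space of
components. Thus `C_c(X, ℤ)` embeds into a group of locally constant functions, free by Nöbeling's
theorem, and is projective. Over a principal ideal domain cycles and boundaries are then projective
too, so `0 → B_q → Z_q → H_q → 0` is a projective resolution and `Tor(H_p C, H_q D)` is the kernel
of `H_p C ⊗ B_q D → H_p C ⊗ Z_q D`. The first map of the sequence is the cross product of cycles.
The second sends the class of `z` to the image of its component `z_{p,q+1}` under (class) ⊗
(differential). Exactness is a computation with elements (`exists_eq_sum_α`, `exists_β_eq`).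

Splitting: a retraction of chains onto cycles extends the class map to a chain map `clsExt` from `C`
to its homology with zero differential. The tensor product of two such maps induces a left inverse
of the cross product. It depends on the chosen retractions, whereas the two maps of the sequence are
natural. -/

namespace ChainComplex

/-! ### Cycles, homology classes and mapping cones in terms of elements -/

variable {R : Type} [CommRing R] {K L M : ChainComplex (ModuleCat.{0} R) ℕ}

/-- The submodule of `n`-cycles of a complex of abelian groups. -/
noncomputable def cyc (K : ChainComplex (ModuleCat.{0} R) ℕ) (n : ℕ) : Submodule R (K.X n) :=
  LinearMap.ker (K.sc n).g.hom

/-- Quantifying over `m` with `m + 1 = n` makes the condition empty in degree `0`, so that later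
arguments need no separate case there. -/
theorem mem_cyc {n : ℕ} {z : K.X n} : z ∈ cyc K n ↔ ∀ m, m + 1 = n → K.d n m z = 0 := by
  change K.d n ((ComplexShape.down ℕ).next n) z = 0 ↔ _
  constructor
  · rintro h m rfl
    rwa [ChainComplex.next_nat_succ] at h
  · intro h
    cases n with
    | zero => rw [K.shape _ _ (by simp)]; rfl
    | succ n => rw [ChainComplex.next_nat_succ]; exact h n rfl

theorem mem_cyc_succ {n : ℕ} {z : K.X (n + 1)} : z ∈ cyc K (n + 1) ↔ K.d (n + 1) n z = 0 := by
  rw [mem_cyc]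
  exact ⟨fun h => h n rfl, fun h m hm => by obtain rfl := Nat.succ.inj hm; exact h⟩

@[simp]
theorem d_d_apply (i j k : ℕ) (z : K.X i) : K.d j k (K.d i j z) = 0 := by
  rw [← ConcreteCategory.comp_apply, K.d_comp_d]; rfl

theorem d_mem_cyc (n : ℕ) (w : K.X (n + 1)) : K.d (n + 1) n w ∈ cyc K n :=
  mem_cyc.2 fun _ _ => d_d_apply _ _ _ _

theorem map_d_apply (f : K ⟶ L) (i j : ℕ) (z : K.X i) :
    f.f j (K.d i j z) = L.d i j (f.f i z) := by
  rw [← ConcreteCategory.comp_apply, ← ConcreteCategory.comp_apply, f.comm]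

theorem map_mem_cyc (f : K ⟶ L) {n : ℕ} {z : K.X n} (hz : z ∈ cyc K n) : f.f n z ∈ cyc L n :=
  mem_cyc.2 fun m hm => by rw [← map_d_apply, mem_cyc.1 hz m hm, map_zero]

/-- A cycle as an element of the object of cycles. -/
noncomputable def cycMk (K : ChainComplex (ModuleCat.{0} R) ℕ) (n : ℕ) :
    cyc K n →ₗ[R] K.cycles n :=
  (K.sc n).moduleCatCyclesIso.inv.hom

theorem iCycles_cycMk (n : ℕ) (z : cyc K n) : K.iCycles n (cycMk K n z) = z :=
  ShortComplex.moduleCatCyclesIso_inv_iCycles_apply (K.sc n) z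

/-- The class of a cycle in the homology. -/
noncomputable def cls (K : ChainComplex (ModuleCat.{0} R) ℕ) (n : ℕ) :
    cyc K n →ₗ[R] K.homology n :=
  (K.homologyπ n).hom ∘ₗ cycMk K n

theorem cls_apply (n : ℕ) (z : cyc K n) : cls K n z = K.homologyπ n (cycMk K n z) := rfl

theorem cls_surjective (n : ℕ) : Function.Surjective (cls K n) :=
  (ModuleCat.epi_iff_surjective ((K.sc n).moduleCatCyclesIso.inv ≫ (K.sc n).homologyπ)).1
    inferInstance

theorem cls_eq_zero_iff {n : ℕ} (z : cyc K n) :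
    cls K n z = 0 ↔ ∃ w : K.X (n + 1), K.d (n + 1) n w = z := by
  have h1 : cls K n z = (K.sc n).moduleCatHomologyIso.inv
      ((K.sc n).moduleCatLeftHomologyData.π z) :=
    ShortComplex.moduleCatCyclesIso_inv_π_apply (K.sc n) z
  have h2 : cls K n z = 0 ↔ (K.sc n).moduleCatLeftHomologyData.π z = 0 := by
    rw [h1]
    exact map_eq_zero_iff _ ((ModuleCat.mono_iff_injective _).1 inferInstance)
  rw [h2]
  refine (Submodule.Quotient.mk_eq_zero _).trans ?_
  -- The incoming differential starts in degree `prev n`, which is equal to `n + 1` but not by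
  -- definition; a general `j` allows the substitution.
  have key : ∀ j, (ComplexShape.down ℕ).Rel j n → ((∃ w : K.X j, K.d j n w = z) ↔
      ∃ w : K.X (n + 1), K.d (n + 1) n w = z) := by
    rintro j (rfl : n + 1 = j)
    rfl
  rw [← key ((ComplexShape.down ℕ).prev n) (by rw [ChainComplex.prev]; rfl)]
  constructor
  · rintro ⟨w, hw⟩
    exact ⟨w, congrArg Subtype.val hw⟩
  · rintro ⟨w, hw⟩
    exact ⟨w, Subtype.ext hw⟩

theorem cyclesMap_cycMk (f : K ⟶ L) {n : ℕ} (z : cyc K n) :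
    HomologicalComplex.cyclesMap f n (cycMk K n z) =
      cycMk L n ⟨f.f n z, map_mem_cyc f z.2⟩ := by
  apply (ModuleCat.mono_iff_injective (L.iCycles n)).1 inferInstance
  rw [iCycles_cycMk, ← ConcreteCategory.comp_apply, HomologicalComplex.cyclesMap_i,
    ConcreteCategory.comp_apply, iCycles_cycMk]

theorem homologyMap_cls (f : K ⟶ L) {n : ℕ} (z : cyc K n) :
    HomologicalComplex.homologyMap f n (cls K n z) =
      cls L n ⟨f.f n z, map_mem_cyc f z.2⟩ := by
  rw [cls_apply, cls_apply, ← cyclesMap_cycMk, ← ConcreteCategory.comp_apply,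
    ← ConcreteCategory.comp_apply, HomologicalComplex.homologyπ_naturality]

/-- A chain map is a quasi-isomorphism if and only if its mapping cone is exact; this is the
exactness of the cone in degree `n`, in terms of elements. -/
def ConeExact (f : K ⟶ L) (n : ℕ) : Prop :=
  ∀ (b : L.X n) (a : ∀ m, m + 1 = n → K.X m), (∀ m h, a m h ∈ cyc K m) →
    (∀ m h, f.f m (a m h) = L.d n m b) →
    ∃ (a' : K.X n) (b' : L.X (n + 1)), (∀ m h, K.d n m a' = a m h) ∧
      b = f.f n a' + L.d (n + 1) n b'

/-- Injectivity one degree lower makes `a` a boundary `d a₁`. Then `b - f a₁` is a cycle, and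
surjectivity in degree `n` matches its class with that of a cycle of `K`. -/
theorem coneExact_of_bijective (f : K ⟶ L)
    (h : ∀ n, Function.Bijective (HomologicalComplex.homologyMap f n)) (n : ℕ) :
    ConeExact f n := by
  intro b a ha hab
  obtain ⟨a₁, ha₁⟩ : ∃ a₁ : K.X n, ∀ m h, K.d n m a₁ = a m h := by
    cases n with
    | zero => exact ⟨0, fun m h => absurd h (by omega)⟩
    | succ n =>
      have h0 : cls K n ⟨a n rfl, ha n rfl⟩ = 0 := by
        apply (h n).1
        rw [homologyMap_cls, map_zero, cls_eq_zero_iff]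
        exact ⟨b, (hab n rfl).symm⟩
      obtain ⟨w, hw⟩ := (cls_eq_zero_iff _).1 h0
      refine ⟨w, fun m hm => ?_⟩
      obtain rfl := Nat.succ.inj hm
      exact hw
  have hc : b - f.f n a₁ ∈ cyc L n := mem_cyc.2 fun m hm => by
    rw [map_sub, ← map_d_apply, ha₁ m hm, hab m hm, sub_self]
  obtain ⟨y, hy⟩ := (h n).2 (cls L n ⟨_, hc⟩)
  obtain ⟨c, rfl⟩ := cls_surjective n y
  rw [homologyMap_cls, ← sub_eq_zero, ← map_sub, cls_eq_zero_iff] at hy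
  obtain ⟨w, hw⟩ := hy
  refine ⟨a₁ + c, -w, fun m hm => ?_, ?_⟩
  · rw [map_add, ha₁ m hm, mem_cyc.1 c.2 m hm, add_zero]
  · rw [map_neg, hw, map_add]
    simp

/-- Injectivity is exactness of the cone one degree higher, at a pair with `f z = d w`; surjectivity
is the case `a = 0`. -/
theorem bijective_of_coneExact (f : K ⟶ L) (h : ∀ n, ConeExact f n) (n : ℕ) :
    Function.Bijective (HomologicalComplex.homologyMap f n) := by
  constructor
  · rw [injective_iff_map_eq_zero]
    intro x hx
    obtain ⟨z, rfl⟩ := cls_surjective n x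
    rw [homologyMap_cls, cls_eq_zero_iff] at hx
    obtain ⟨w, hw⟩ := hx
    obtain ⟨a', b', h1, -⟩ := h (n + 1) w (fun m hm => Nat.succ.inj hm ▸ z.1)
      (fun m hm => by obtain rfl := Nat.succ.inj hm; exact z.2)
      (fun m hm => by obtain rfl := Nat.succ.inj hm; exact hw.symm)
    exact (cls_eq_zero_iff _).2 ⟨a', h1 n rfl⟩
  · intro y
    obtain ⟨z, rfl⟩ := cls_surjective n y
    obtain ⟨a', b', h1, h2⟩ := h n z.1 (fun m hm => 0) (fun m hm => zero_mem _)
      (fun m hm => by rw [map_zero, mem_cyc.1 z.2 m hm])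
    refine ⟨cls K n ⟨a', mem_cyc.2 h1⟩, ?_⟩
    rw [homologyMap_cls, eq_comm, ← sub_eq_zero, ← map_sub, cls_eq_zero_iff]
    exact ⟨b', by simp [h2]⟩

end ChainComplex

/-! ### Total complexes and columnwise quasi-isomorphisms -/

namespace DoubleComplex

open ChainComplex

variable {R : Type} [CommRing R] {K L : ChainComplex (ChainComplex (ModuleCat.{0} R) ℕ) ℕ}

theorem h_h (p q : ℕ) (x : (K.X (p + 1 + 1)).X q) :
    (K.d (p + 1) p).f q ((K.d (p + 1 + 1) (p + 1)).f q x) = 0 := by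
  rw [← ConcreteCategory.comp_apply, ← HomologicalComplex.comp_f, K.d_comp_d]; rfl

theorem map_h (f : K ⟶ L) (p q : ℕ) (x : (K.X (p + 1)).X q) :
    (f.f p).f q ((K.d (p + 1) p).f q x) = (L.d (p + 1) p).f q ((f.f (p + 1)).f q x) := by
  rw [← ConcreteCategory.comp_apply, ← ConcreteCategory.comp_apply, ← HomologicalComplex.comp_f,
    ← HomologicalComplex.comp_f, f.comm]

/-- The degree `n` part of the total complex. -/
abbrev Tot (K : ChainComplex (ChainComplex (ModuleCat.{0} R) ℕ) ℕ) (n : ℕ) : Type :=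
  ∀ x : {x : ℕ × ℕ // x.1 + x.2 = n}, (K.X x.1.1).X x.1.2

/-- The differential of the total complex: on the component of bidegree `(p, q)` it is the sum of
the horizontal differential and of `(-1) ^ p` times the vertical one. -/
noncomputable def totD (K : ChainComplex (ChainComplex (ModuleCat.{0} R) ℕ) ℕ) (n : ℕ) :
    Tot K (n + 1) →ₗ[R] Tot K n :=
  LinearMap.pi fun x =>
    ((K.d (x.1.1 + 1) x.1.1).f x.1.2).hom ∘ₗ
        LinearMap.proj (φ := fun x : {x : ℕ × ℕ // x.1 + x.2 = n + 1} => (K.X x.1.1).X x.1.2)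
          ⟨(x.1.1 + 1, x.1.2), by have := x.2; dsimp only; omega⟩ +
      ((-1 : ℤ) ^ x.1.1) • (((K.X x.1.1).d (x.1.2 + 1) x.1.2).hom ∘ₗ
        LinearMap.proj (φ := fun x : {x : ℕ × ℕ // x.1 + x.2 = n + 1} => (K.X x.1.1).X x.1.2)
          ⟨(x.1.1, x.1.2 + 1), by have := x.2; dsimp only; omega⟩)

theorem totD_apply {n : ℕ} (z : Tot K (n + 1)) (p q : ℕ) (hpq : p + q = n) :
    totD K n z ⟨(p, q), hpq⟩ = (K.d (p + 1) p).f q (z ⟨(p + 1, q), by omega⟩) +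
      ((-1 : ℤ) ^ p) • (K.X p).d (q + 1) q (z ⟨(p, q + 1), by omega⟩) := rfl

theorem totD_totD {n : ℕ} (z : Tot K (n + 1 + 1)) : totD K n (totD K (n + 1) z) = 0 := by
  funext ⟨⟨p, q⟩, hpq⟩
  rw [totD_apply, totD_apply, totD_apply, map_add, map_add, h_h, map_zsmul, map_zsmul, d_d_apply,
    map_d_apply, pow_succ]
  simp

/-- The total complex of a double complex. -/
noncomputable def tot (K : ChainComplex (ChainComplex (ModuleCat.{0} R) ℕ) ℕ) :
    ChainComplex (ModuleCat.{0} R) ℕ :=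
  ChainComplex.of (fun n => ModuleCat.of R (Tot K n)) (fun n => ModuleCat.ofHom (totD K n))
    fun n => by
      refine ModuleCat.hom_ext (LinearMap.ext fun z => ?_)
      exact totD_totD z

/-- The component of bidegree `(p, q)` of an element of the total complex. -/
noncomputable def comp (K : ChainComplex (ChainComplex (ModuleCat.{0} R) ℕ) ℕ) {n : ℕ} (p q : ℕ)
    (h : p + q = n) : (tot K).X n →ₗ[R] (K.X p).X q :=
  LinearMap.proj (φ := fun x : {x : ℕ × ℕ // x.1 + x.2 = n} => (K.X x.1.1).X x.1.2) ⟨(p, q), h⟩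

/-- The inclusion of the component of bidegree `(p, q)` into the total complex. -/
noncomputable def single (K : ChainComplex (ChainComplex (ModuleCat.{0} R) ℕ) ℕ) {n : ℕ} (p q : ℕ)
    (h : p + q = n) : (K.X p).X q →ₗ[R] (tot K).X n :=
  LinearMap.single R (fun x : {x : ℕ × ℕ // x.1 + x.2 = n} => (K.X x.1.1).X x.1.2) ⟨(p, q), h⟩

theorem tot_ext {n : ℕ} {z w : (tot K).X n} (h : ∀ p q h, comp K p q h z = comp K p q h w) :
    z = w :=
  funext fun x => h x.1.1 x.1.2 x.2

@[simp]
theorem comp_single {n : ℕ} (p q : ℕ) (h h' : p + q = n) (x : (K.X p).X q) :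
    comp K p q h (single K p q h' x) = x := Pi.single_eq_same _ _

theorem comp_single_of_ne {n : ℕ} {p q p' q' : ℕ} (h : p + q = n) (x : (K.X p).X q)
    (h' : p' + q' = n) (hq : q' ≠ q) : comp K p' q' h' (single K p q h x) = 0 :=
  Pi.single_eq_of_ne (by simpa using fun _ => hq) _

theorem comp_d {n m : ℕ} (h : n + 1 = m) (z : (tot K).X m) (p q : ℕ) (hpq : p + q = n) :
    comp K p q hpq ((tot K).d m n z) =
      (K.d (p + 1) p).f q (comp K (p + 1) q (by omega) z) +
      ((-1 : ℤ) ^ p) • (K.X p).d (q + 1) q (comp K p (q + 1) (by omega) z) := by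
  subst h
  have : (tot K).d (n + 1) n z = totD K n z := by
    simp only [tot, ChainComplex.of_d]
    rfl
  rw [this]
  exact totD_apply z p q hpq

/-- The map of total complexes induced by a map of double complexes. -/
noncomputable def totMap (f : K ⟶ L) : tot K ⟶ tot L :=
  ChainComplex.ofHom
    (fun n => ModuleCat.ofHom (LinearMap.pi fun x =>
      ((f.f x.1.1).f x.1.2).hom ∘ₗ comp K x.1.1 x.1.2 x.2))
    fun n => by
      refine ModuleCat.hom_ext (LinearMap.ext fun z => tot_ext fun p q hpq => ?_)
      refine (comp_d (K := L) rfl _ p q hpq).trans ?_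
      refine Eq.trans ?_ (congrArg ((f.f p).f q) (comp_d rfl z p q hpq)).symm
      rw [map_add, map_zsmul, map_h, map_d_apply]
      rfl

theorem comp_totMap (f : K ⟶ L) {n : ℕ} (z : (tot K).X n) (p q : ℕ) (h : p + q = n) :
    comp L p q h ((totMap f).f n z) = (f.f p).f q (comp K p q h z) := rfl

theorem totMap_comp {M : ChainComplex (ChainComplex (ModuleCat.{0} R) ℕ) ℕ} (f : K ⟶ L)
    (g : L ⟶ M) : totMap (f ≫ g) = totMap f ≫ totMap g := by
  ext n
  rfl

theorem totMap_id : totMap (𝟙 K) = 𝟙 (tot K) := by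
  ext n
  rfl

theorem neg_one_pow_smul_smul {M : Type*} [AddCommGroup M] (j : ℕ) (x : M) :
    ((-1 : ℤ) ^ j) • ((-1 : ℤ) ^ j) • x = x := by
  rw [smul_smul, ← mul_pow]
  simp

/-- The components are corrected one at a time, by increasing vertical degree `k`. Once `b` vanishes
below `k` and `a` below `k - 1`, the components `b_{j,k}` and `a_{j,k-1}` satisfy the cone relations
of column `j`, up to sign. The correction that removes them otherwise changes only components of
higher vertical degree. -/
theorem coneExact_totMap_aux (f : K ⟶ L) (hf : ∀ p n, ConeExact (f.f p) n) (n j : ℕ) :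
    ∀ k, j + k = n + 1 → ∀ (b : (tot L).X n) (a : ∀ m, m + 1 = n → (tot K).X m),
      (∀ m h, a m h ∈ cyc (tot K) m) →
      (∀ m h, (totMap f).f m (a m h) = (tot L).d n m b) →
      (∀ p q h, q < k → comp L p q h b = 0) →
      (∀ m h p q h', q + 1 < k → comp K p q h' (a m h) = 0) →
    ∃ (a' : (tot K).X n) (b' : (tot L).X (n + 1)), (∀ m h, (tot K).d n m a' = a m h) ∧
      b = (totMap f).f n a' + (tot L).d (n + 1) n b' := by
  induction j with
  | zero =>
    -- Here `k = n + 1` exceeds every vertical degree that occurs, so `a` and `b` are zero.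
    intro k hk b a ha hab hb0 ha0
    refine ⟨0, 0, fun m h => ?_, ?_⟩
    · rw [map_zero]
      exact tot_ext fun p q h' => ((ha0 m h p q h' (by omega)).trans (map_zero _).symm).symm
    · rw [map_zero, map_zero, add_zero]
      exact tot_ext fun p q h' => (hb0 p q h' (by omega)).trans (map_zero _).symm
  | succ j ih =>
    intro k hk b a ha hab hb0 ha0
    have hjk : j + k = n := by omega
    -- The vertical differential of column `j` enters the total differential with the sign `(-1) ^
    -- j`; scaling `b` by it gives the unsigned cone relation of the column.
    obtain ⟨a', b', h1, h2⟩ := hf j k (((-1 : ℤ) ^ j) • comp L j k hjk b)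
      (fun m h => comp K j m rfl (a (j + m) (by omega)))
      (fun m h => mem_cyc.2 fun m' h' => by
        subst h'
        have := comp_d (by omega) (a (j + (m' + 1)) (by omega)) j m' rfl
        rw [ha0 _ _ _ _ _ (by omega), map_zero, zero_add,
          mem_cyc.1 (ha (j + (m' + 1)) (by omega)) (j + m') (by omega), map_zero] at this
        rw [← neg_one_pow_smul_smul j ((K.X j).d (m' + 1) m' _), ← this, smul_zero])
      (fun m h => by
        subst h
        have := comp_d (by omega) b j m rfl
        rw [hb0 _ _ _ (by omega), map_zero, zero_add, ← map_zsmul, ← hab (j + m) (by omega)] at this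
        exact this)
    set x : (tot K).X n := single K j k hjk (((-1 : ℤ) ^ j) • a') with hx
    set y : (tot L).X (n + 1) := single L j (k + 1) (by omega) b' with hy
    obtain ⟨a'', b'', h3, h4⟩ := ih (k + 1) (by omega)
      (b - (totMap f).f n x - (tot L).d (n + 1) n y) (fun m h => a m h - (tot K).d n m x)
      (fun m h => mem_cyc.2 fun m' h' => by
        rw [map_sub, mem_cyc.1 (ha m h) m' h', d_d_apply, sub_zero])
      (fun m h => by
        rw [map_sub, map_sub, map_sub, d_d_apply, hab, map_d_apply, sub_zero])
      (fun p q h hq => by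
        have hy0 : comp L (p + 1) q (by omega) y = 0 := comp_single_of_ne _ _ _ (by omega)
        rw [map_sub, map_sub, comp_totMap, comp_d rfl, hy0, map_zero, zero_add, hy, hx]
        rcases Nat.lt_succ_iff_lt_or_eq.1 hq with hq | rfl
        · rw [hb0 _ _ _ hq, comp_single_of_ne _ _ _ (by omega), comp_single_of_ne _ _ _ (by omega)]
          simp
        · obtain rfl : p = j := by omega
          rw [comp_single, comp_single, map_zsmul, ← neg_one_pow_smul_smul p (comp L p q hjk b), h2,
            smul_add]
          abel)
      (fun m h p q h' hq => by
        rw [map_sub, comp_d h, hx, comp_single_of_ne _ _ _ (by omega), map_zero, zero_add]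
        by_cases hqk : q + 1 = k
        · subst hqk
          obtain rfl : p = j := by omega
          subst h'
          rw [comp_single, map_zsmul, neg_one_pow_smul_smul, h1 q rfl, sub_self]
        · rw [ha0 _ _ _ _ _ (by omega), comp_single_of_ne _ _ _ (by omega)]
          simp)
    refine ⟨a'' + x, b'' + y, fun m h => ?_, ?_⟩
    · rw [map_add, h3, sub_add_cancel]
    · rw [map_add, map_add, add_add_add_comm, ← h4]
      abel

/-- A map of double complexes that is a quasi-isomorphism on every column is a quasi-isomorphism
on the total complexes. -/
theorem coneExact_totMap (f : K ⟶ L) (hf : ∀ p n, ConeExact (f.f p) n) (n : ℕ) :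
    ConeExact (totMap f) n := fun b a ha hab =>
  coneExact_totMap_aux f hf n (n + 1) 0 rfl b a ha hab (fun _ _ _ h => absurd h (by omega))
    (fun _ _ _ _ _ h => absurd h (by omega))

/-! ### Double complexes with exact augmented rows -/

section Augmentation

variable {M : ChainComplex (ModuleCat.{0} R) ℕ}

/-- The map from the total complex to a complex `M` that is induced by an augmentation of the rows
of the double complex. -/
noncomputable def totAug (e : K.X 0 ⟶ M) (he : K.d 1 0 ≫ e = 0) : tot K ⟶ M where
  f n := ModuleCat.ofHom ((e.f n).hom ∘ₗ comp K 0 n (zero_add n))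
  comm' i j hij := by
    obtain rfl : j + 1 = i := hij
    refine ModuleCat.hom_ext (LinearMap.ext fun z => ?_)
    have h0 : e.f j ((K.d 1 0).f j (comp K (0 + 1) j (by omega) z)) = 0 := by
      rw [← ConcreteCategory.comp_apply, ← HomologicalComplex.comp_f, he]; rfl
    refine Eq.trans ?_ (congrArg (e.f j) (comp_d rfl z 0 j (zero_add j))).symm
    rw [map_add, h0, zero_add, pow_zero, one_smul, map_d_apply]
    rfl

theorem totAug_apply (e : K.X 0 ⟶ M) (he : K.d 1 0 ≫ e = 0) (n : ℕ) (z : (tot K).X n) :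
    (totAug e he).f n z = e.f n (comp K 0 n (zero_add n) z) := rfl

/-- The cycle is cleared by increasing horizontal degree `k`: its first nonzero component lies in
the kernel of the horizontal differential (of the augmentation for `k = 0`), hence lifts along the
row. All lifts have positive horizontal degree, so `w` has zero component in column `0` and is
invisible to the augmentation. -/
theorem exists_tot_d_eq_of_rows_exact (e : K.X 0 ⟶ M) (he : K.d 1 0 ≫ e = 0)
    (h0 : ∀ q (z : (K.X 0).X q), e.f q z = 0 → ∃ w, (K.d 1 0).f q w = z)
    (h1 : ∀ p q (z : (K.X (p + 1)).X q), (K.d (p + 1) p).f q z = 0 →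
      ∃ w, (K.d (p + 1 + 1) (p + 1)).f q w = z) (n j : ℕ) :
    ∀ k, j + k = n + 1 → ∀ z ∈ cyc (tot K) n, e.f n (comp K 0 n (zero_add n) z) = 0 →
      (∀ p q h, p < k → comp K p q h z = 0) →
    ∃ w : (tot K).X (n + 1), (tot K).d (n + 1) n w = z ∧ comp K 0 (n + 1) (zero_add _) w = 0 := by
  induction j with
  | zero =>
    intro k hk z _ _ hz
    exact ⟨0, (map_zero _).trans (tot_ext fun p q h => ((hz p q h (by omega)).trans
      (map_zero _).symm).symm), map_zero _⟩
  | succ j ih =>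
    intro k hk z hz hez hz0
    have hjk : k + j = n := by omega
    obtain ⟨w, hw⟩ : ∃ w, (K.d (k + 1) k).f j w = comp K k j hjk z := by
      cases k with
      | zero =>
        obtain rfl : j = n := by omega
        exact h0 _ _ hez
      | succ k =>
        apply h1
        -- In the component `(k, j)` of `d z = 0` the vertical term comes from `z_{k,j+1}`, which is
        -- already zero.
        have := comp_d (by omega) z k j rfl
        rw [mem_cyc.1 hz _ (by omega), hz0 k (j + 1) _ (by omega)] at this
        simpa using this.symm
    set x : (tot K).X (n + 1) := single K (k + 1) j (by omega) w with hx
    have hx0 : comp K 0 (n + 1) (zero_add _) x = 0 := comp_single_of_ne _ _ _ (by omega)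
    obtain ⟨w', h3, h4⟩ := ih (k + 1) (by omega) (z - (tot K).d (n + 1) n x)
      (sub_mem hz (d_mem_cyc _ _))
      (by
        have h0 : ∀ t, e.f n ((K.d (0 + 1) 0).f n t) = 0 := fun t => by
          rw [← ConcreteCategory.comp_apply, ← HomologicalComplex.comp_f, he]; rfl
        rw [map_sub, map_sub, hez, comp_d rfl, map_add, hx0, h0]
        simp)
      (fun p q h hp => by
        rw [map_sub, comp_d rfl, hx]
        rcases Nat.lt_succ_iff_lt_or_eq.1 hp with hp | rfl
        · rw [hz0 _ _ _ hp, comp_single_of_ne _ _ _ (by omega), comp_single_of_ne _ _ _ (by omega)]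
          simp
        · obtain rfl : q = j := by omega
          rw [comp_single, comp_single_of_ne _ _ _ (by omega), hw]
          simp)
    refine ⟨w' + x, by rw [map_add, h3, sub_add_cancel], by rw [map_add, h4, hx0, add_zero]⟩

/-- If the augmented rows of a double complex are exact, then the map from the total complex to the
augmentation is a quasi-isomorphism. -/
theorem bijective_totAug (e : K.X 0 ⟶ M) (he : K.d 1 0 ≫ e = 0)
    (hs : ∀ q, Function.Surjective (e.f q))
    (h0 : ∀ q (z : (K.X 0).X q), e.f q z = 0 → ∃ w, (K.d 1 0).f q w = z)
    (h1 : ∀ p q (z : (K.X (p + 1)).X q), (K.d (p + 1) p).f q z = 0 →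
      ∃ w, (K.d (p + 1 + 1) (p + 1)).f q w = z) (n : ℕ) :
    Function.Bijective (HomologicalComplex.homologyMap (totAug e he) n) := by
  apply bijective_of_coneExact
  intro n b a ha hab
  obtain ⟨x, rfl⟩ := hs n b
  set y : (tot K).X n := single K 0 n (zero_add n) x with hy
  have hey : (totAug e he).f n y = e.f n x := by rw [totAug_apply, hy, comp_single]
  -- The lift `y` of `b` already has the right augmentation, and `a - d y` is a cycle with zero
  -- augmentation. It is therefore the boundary of some `w` that does not change the augmentation.
  obtain ⟨w, hw, hw0⟩ : ∃ w : (tot K).X n, (∀ m h, (tot K).d n m w = a m h - (tot K).d n m y) ∧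
      comp K 0 n (zero_add n) w = 0 := by
    cases n with
    | zero => exact ⟨0, fun m h => absurd h (by omega), map_zero _⟩
    | succ n =>
      obtain ⟨w, h1, h2⟩ := exists_tot_d_eq_of_rows_exact e he h0 h1 n (n + 1) 0 rfl
        (a n rfl - (tot K).d (n + 1) n y) (sub_mem (ha n rfl) (d_mem_cyc _ _))
        (by
          have := hab n rfl
          rw [← totAug_apply e he, map_sub, this, map_d_apply, hey, sub_self])
        (fun p q h hp => absurd hp (by omega))
      exact ⟨w, fun m h => by obtain rfl := Nat.succ.inj h; exact h1, h2⟩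
  refine ⟨w + y, 0, fun m h => by rw [map_add, hw m h, sub_add_cancel], ?_⟩
  rw [map_zero, add_zero, map_add, totAug_apply, hw0, map_zero, zero_add, hey]

end Augmentation

end DoubleComplex

/-! ### Ordinal sums in the simplex category -/

namespace SimplexCategory

open scoped Simplicial

/-- The ordinal sum of two objects of the simplex category. -/
abbrev join (a b : SimplexCategory) : SimplexCategory := ⦋a.len + b.len + 1⦌

/-- The inclusion of the first summand into the ordinal sum. -/
def joinInl (a b : SimplexCategory) : a ⟶ join a b :=
  Hom.mk ⟨fun i => ⟨i, by have := i.2; dsimp only [len_mk]; omega⟩, fun _ _ h => h⟩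

/-- The inclusion of the second summand into the ordinal sum. -/
def joinInr (a b : SimplexCategory) : b ⟶ join a b :=
  Hom.mk ⟨fun i => ⟨a.len + 1 + i, by have := i.2; dsimp only [len_mk]; omega⟩,
    fun _ _ h => Nat.add_le_add_left h _⟩

variable {a b c a' b' a'' b'' : SimplexCategory}

/-- The map from the ordinal sum that is given by two maps. -/
def joinDesc (f : a ⟶ c) (g : b ⟶ c) (h : ∀ i j, f.toOrderHom i ≤ g.toOrderHom j) :
    join a b ⟶ c :=
  Hom.mk
    { toFun x := if hx : x.1 < a.len + 1 then f.toOrderHom ⟨x, hx⟩ else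
        g.toOrderHom ⟨x - (a.len + 1), by have := x.2; dsimp only [len_mk] at this; omega⟩
      monotone' x y hxy := by
        have hxy' : x.1 ≤ y.1 := hxy
        dsimp only
        split_ifs with h1 h2 h2
        · exact f.toOrderHom.monotone hxy'
        · exact h _ _
        · omega
        · exact g.toOrderHom.monotone (Nat.sub_le_sub_right hxy' _) }

theorem joinInl_joinDesc (f : a ⟶ c) (g : b ⟶ c) (h) : joinInl a b ≫ joinDesc f g h = f := by
  ext i : 3
  exact dif_pos i.2

theorem joinInr_joinDesc (f : a ⟶ c) (g : b ⟶ c) (h) : joinInr a b ≫ joinDesc f g h = g := by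
  ext i : 3
  refine (dif_neg (fun h : a.len + 1 + i.1 < a.len + 1 => by omega)).trans ?_
  congr 1
  exact Fin.ext (Nat.add_sub_cancel_left _ _)

theorem join_hom_ext {f g : join a b ⟶ c} (h : joinInl a b ≫ f = joinInl a b ≫ g)
    (h' : joinInr a b ≫ f = joinInr a b ≫ g) : f = g := by
  ext x : 3
  by_cases hx : x.1 < a.len + 1
  · exact congrArg (fun k : a ⟶ c => k.toOrderHom ⟨x, hx⟩) h
  · have hx' : x.1 - (a.len + 1) < b.len + 1 := by
      have := x.2; dsimp only [len_mk] at this; omega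
    have e : x = (joinInr a b).toOrderHom ⟨x - (a.len + 1), hx'⟩ :=
      Fin.ext (by change x.1 = a.len + 1 + (x.1 - (a.len + 1)); omega)
    rw [e]
    exact congrArg (fun k : b ⟶ c => k.toOrderHom ⟨x - (a.len + 1), hx'⟩) h'

/-- The functoriality of the ordinal sum. -/
def joinMap (f : a ⟶ a') (g : b ⟶ b') : join a b ⟶ join a' b' :=
  joinDesc (f ≫ joinInl a' b') (g ≫ joinInr a' b') fun i j => by
    have := (f.toOrderHom i).2
    change (f.toOrderHom i).1 ≤ a'.len + 1 + (g.toOrderHom j).1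
    omega

@[simp]
theorem joinInl_joinMap (f : a ⟶ a') (g : b ⟶ b') :
    joinInl a b ≫ joinMap f g = f ≫ joinInl a' b' := joinInl_joinDesc _ _ _

@[simp]
theorem joinInl_joinMap_assoc (f : a ⟶ a') (g : b ⟶ b') (k : join a' b' ⟶ c) :
    joinInl a b ≫ joinMap f g ≫ k = f ≫ joinInl a' b' ≫ k := by
  rw [← Category.assoc, joinInl_joinMap, Category.assoc]

@[simp]
theorem joinInr_joinMap (f : a ⟶ a') (g : b ⟶ b') :
    joinInr a b ≫ joinMap f g = g ≫ joinInr a' b' := joinInr_joinDesc _ _ _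

@[simp]
theorem joinInr_joinMap_assoc (f : a ⟶ a') (g : b ⟶ b') (k : join a' b' ⟶ c) :
    joinInr a b ≫ joinMap f g ≫ k = g ≫ joinInr a' b' ≫ k := by
  rw [← Category.assoc, joinInr_joinMap, Category.assoc]

@[simp]
theorem joinMap_id : joinMap (𝟙 a) (𝟙 b) = 𝟙 (join a b) := by
  apply join_hom_ext <;> simp

theorem joinMap_comp (f : a ⟶ a') (g : b ⟶ b') (f' : a' ⟶ a'') (g' : b' ⟶ b'') :
    joinMap (f ≫ f') (g ≫ g') = joinMap f g ≫ joinMap f' g' := by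
  apply join_hom_ext <;> simp

/-- The map that collapses the first summand to the first element of the second one. -/
def joinSnd (a b : SimplexCategory) : join a b ⟶ b :=
  joinDesc (const a b 0) (𝟙 b) fun _ _ => Fin.zero_le _

/-- The map that collapses the second summand to the last element of the first one. -/
def joinFst (a b : SimplexCategory) : join a b ⟶ a :=
  joinDesc (𝟙 a) (const b a (Fin.last _)) fun _ _ => Fin.le_last _

@[simp]
theorem joinInl_joinSnd:
    joinInl a b ≫ joinSnd a b = const a b 0 := joinInl_joinDesc _ _ _

@[simp]
theorem joinInl_joinSnd_assoc (k : b ⟶ c) :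
    joinInl a b ≫ joinSnd a b ≫ k = const a b 0 ≫ k := by
  rw [← Category.assoc, joinInl_joinSnd]

@[simp]
theorem joinInr_joinFst:
    joinInr a b ≫ joinFst a b = const b a (Fin.last _) :=  joinInr_joinDesc _ _ _

@[simp]
theorem joinInr_joinFst_assoc (k : a ⟶ c) :
    joinInr a b ≫ joinFst a b ≫ k = const b a (Fin.last _) ≫ k := by
  rw [← Category.assoc, joinInr_joinFst]

@[simp]
theorem joinInr_joinSnd:
    joinInr a b ≫ joinSnd a b = 𝟙 b := joinInr_joinDesc _ _ _

@[simp]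
theorem joinInr_joinSnd_assoc (k : b ⟶ c) :
    joinInr a b ≫ joinSnd a b ≫ k = 𝟙 b ≫ k := by
  rw [← Category.assoc, joinInr_joinSnd]

@[simp]
theorem joinInl_joinFst:
    joinInl a b ≫ joinFst a b = 𝟙 a := joinInl_joinDesc _ _ _

@[simp]
theorem joinInl_joinFst_assoc (k : a ⟶ c) :
    joinInl a b ≫ joinFst a b ≫ k = 𝟙 a ≫ k := by
  rw [← Category.assoc, joinInl_joinFst]

theorem joinMap_joinSnd (f : a ⟶ a') : joinMap f (𝟙 b) ≫ joinSnd a' b = joinSnd a b := by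
  apply join_hom_ext
  · simp only [joinInl_joinMap_assoc, joinInl_joinSnd]
    rfl
  · simp

/-- The restriction to the second summand of `joinShift`. -/
def joinShiftInr (a : SimplexCategory) (p : ℕ) : ⦋p + 1⦌ ⟶ join a ⦋p⦌ :=
  Hom.mk
    { toFun j := ⟨a.len + j.1, by have := j.2; dsimp only [len_mk] at *; omega⟩
      monotone' _ _ h := Nat.add_le_add_left h _ }

/-- The map that sends the first element of the second summand to the last element of the first
one. -/
def joinShift (a : SimplexCategory) (p : ℕ) : join a ⦋p + 1⦌ ⟶ join a ⦋p⦌ :=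
  joinDesc (joinInl _ _) (joinShiftInr a p) fun i j => by
    have := i.2
    change i.1 ≤ a.len + j.1
    omega

@[simp]
theorem joinInl_joinShift (p : ℕ) :
    joinInl a ⦋p + 1⦌ ≫ joinShift a p = joinInl a ⦋p⦌ :=  joinInl_joinDesc _ _ _

@[simp]
theorem joinInl_joinShift_assoc (p : ℕ) (k : join a ⦋p⦌ ⟶ c) :
    joinInl a ⦋p + 1⦌ ≫ joinShift a p ≫ k = joinInl a ⦋p⦌ ≫ k := by
  rw [← Category.assoc, joinInl_joinShift]

@[simp]
theorem joinInr_joinShift (p : ℕ) :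
    joinInr a ⦋p + 1⦌ ≫ joinShift a p = joinShiftInr a p :=  joinInr_joinDesc _ _ _

@[simp]
theorem joinInr_joinShift_assoc (p : ℕ) (k : join a ⦋p⦌ ⟶ c) :
    joinInr a ⦋p + 1⦌ ≫ joinShift a p ≫ k = joinShiftInr a p ≫ k := by
  rw [← Category.assoc, joinInr_joinShift]

/-- The shift moves only the first element of the second summand across the gap, and `δ 0` omits
exactly that element. -/
theorem joinMap_δ_zero_joinShift (p : ℕ) :
    joinMap (𝟙 a) (δ (0 : Fin (p + 2))) ≫ joinShift a p = 𝟙 _ := by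
  apply join_hom_ext
  · simp
  · simp only [joinInr_joinMap_assoc, joinInr_joinShift, Category.comp_id]
    ext j : 4
    change a.len + (j.1 + 1) = a.len + 1 + j.1
    omega

/-- Faces and degeneracies as functions on natural numbers, which turns the identities below into
case distinctions in linear arithmetic. -/
theorem val_δ_apply {n : ℕ} (i : Fin (n + 2)) (j : Fin (n + 1)) :
    ((δ i).toOrderHom j).1 = if j.1 < i.1 then j.1 else j.1 + 1 := by
  change (i.succAbove j).1 = _
  unfold Fin.succAbove
  simp only [Fin.lt_def, Fin.val_castSucc]
  split_ifs <;> rfl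

theorem val_σ_apply {n : ℕ} (i : Fin (n + 1)) (j : Fin (n + 2)) :
    ((σ i).toOrderHom j).1 = if j.1 ≤ i.1 then j.1 else j.1 - 1 := by
  change (i.predAbove j).1 = _
  unfold Fin.predAbove
  simp only [Fin.lt_def, Fin.val_castSucc]
  split_ifs <;> first | omega | rfl

theorem joinMap_δ_succ_joinShift (p : ℕ) (i : Fin (p + 2)) :
    joinMap (𝟙 a) (δ i.succ) ≫ joinShift a (p + 1) = joinShift a p ≫ joinMap (𝟙 a) (δ i) := by
  apply join_hom_ext
  · simp
  · simp only [joinInr_joinMap_assoc, joinInr_joinShift, joinInr_joinShift_assoc]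
    ext j : 3
    cases j using Fin.cases with
    -- The first element of the second summand goes to the last element of `a` on both sides, and
    -- `joinMap (𝟙 a) (δ i)` fixes it there.
    | zero =>
      have := congrArg (fun k : a ⟶ _ => k.toOrderHom (Fin.last _))
        (joinInl_joinMap (𝟙 a) (δ i))
      refine Eq.trans ?_ this.symm
      refine Fin.ext ?_
      change a.len + ((δ i.succ).toOrderHom 0).1 = a.len
      rw [val_δ_apply]
      simp
    | succ j =>
      have e : (joinShiftInr a p).toOrderHom j.succ = (joinInr a ⦋p⦌).toOrderHom j :=
        Fin.ext (by change a.len + (j.1 + 1) = a.len + 1 + j.1; omega)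
      have := congrArg (fun k : ⦋p⦌ ⟶ _ => k.toOrderHom j) (joinInr_joinMap (𝟙 a) (δ i))
      refine Eq.trans ?_ (this.symm.trans (congrArg (joinMap (𝟙 a) (δ i)).toOrderHom e.symm))
      refine Fin.ext ?_
      change a.len + ((δ i.succ).toOrderHom j.succ).1 = a.len + 1 + ((δ i).toOrderHom j).1
      rw [val_δ_apply, val_δ_apply]
      simp only [Fin.val_succ, Nat.add_lt_add_iff_right]
      split_ifs <;> omega

/-- Omitting `1` from `{0, 1}` leaves `0`, which the shift sends to the last element of `a`; this is
why the section of the augmentation collapses the second summand onto that element. -/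
theorem joinMap_δ_one_joinShift :
    joinMap (𝟙 a) (δ (1 : Fin 2)) ≫ joinShift a 0 = joinFst a ⦋0⦌ ≫ joinInl a ⦋0⦌ := by
  apply join_hom_ext
  · simp
  · simp only [joinInr_joinMap_assoc, joinInr_joinShift, joinInr_joinFst_assoc]
    ext j : 3
    obtain rfl : j = 0 := Subsingleton.elim (α := Fin 1) j 0
    rfl

/-- The restriction to the first summand of `joinHomotopy`. -/
def joinHomotopyInl (b : SimplexCategory) {n : ℕ} (i : Fin (n + 1)) : ⦋n + 1⦌ ⟶ join ⦋n⦌ b :=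
  Hom.mk
    -- The value `n + 1` is the first element of `b` inside `join ⦋n⦌ b`: elements up to `i` stay in
    -- place, and the later ones are pushed to the start of `b`.
    { toFun j := ⟨if j.1 ≤ i.1 then j.1 else n + 1, by
        dsimp only [len_mk]; split_ifs <;> omega⟩
      monotone' j k hjk := by
        have h : j.1 ≤ k.1 := hjk
        change (if j.1 ≤ i.1 then j.1 else n + 1) ≤ (if k.1 ≤ i.1 then k.1 else n + 1)
        split_ifs <;> omega }

theorem val_joinHomotopyInl_apply (b : SimplexCategory) {n : ℕ} (i : Fin (n + 1))
    (j : Fin (n + 2)) : ((joinHomotopyInl b i).toOrderHom j).1 =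
      if j.1 ≤ i.1 then j.1 else n + 1 := rfl

/-- The maps that define the simplicial homotopy collapsing the first summand. -/
def joinHomotopy (b : SimplexCategory) {n : ℕ} (i : Fin (n + 1)) : join ⦋n + 1⦌ b ⟶ join ⦋n⦌ b :=
  joinDesc (joinHomotopyInl b i) (joinInr _ _) fun j k => by
    change (if j.1 ≤ i.1 then j.1 else n + 1) ≤ n + 1 + k.1
    split_ifs <;> omega

@[simp]
theorem joinInl_joinHomotopy (b : SimplexCategory) {n : ℕ} (i : Fin (n + 1)) :
    joinInl ⦋n + 1⦌ b ≫ joinHomotopy b i = joinHomotopyInl b i := joinInl_joinDesc _ _ _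

@[simp]
theorem joinInl_joinHomotopy_assoc (b : SimplexCategory) {n : ℕ} (i : Fin (n + 1)) (k : join ⦋n⦌ b ⟶ c) :
    joinInl ⦋n + 1⦌ b ≫ joinHomotopy b i ≫ k = joinHomotopyInl b i ≫ k := by
  rw [← Category.assoc, joinInl_joinHomotopy]

@[simp]
theorem joinInr_joinHomotopy (b : SimplexCategory) {n : ℕ} (i : Fin (n + 1)) :
    joinInr ⦋n + 1⦌ b ≫ joinHomotopy b i = joinInr ⦋n⦌ b := joinInr_joinDesc _ _ _

@[simp]
theorem joinInr_joinHomotopy_assoc (b : SimplexCategory) {n : ℕ} (i : Fin (n + 1)) (k : join ⦋n⦌ b ⟶ c) :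
    joinInr ⦋n + 1⦌ b ≫ joinHomotopy b i ≫ k = joinInr ⦋n⦌ b ≫ k := by
  rw [← Category.assoc, joinInr_joinHomotopy]

/-- Composition with `joinMap f (𝟙 b)` of a map to the ordinal sum, in terms of values. -/
theorem val_comp_joinMap_apply {n m : ℕ} (x : c ⟶ join ⦋n⦌ b) (f : ⦋n⦌ ⟶ ⦋m⦌)
    (j : Fin (c.len + 1)) (k : ℕ) (hk : k = (x.toOrderHom j).1) :
    ((x ≫ joinMap f (𝟙 b)).toOrderHom j).1 =
      if h : k < n + 1 then (f.toOrderHom ⟨k, h⟩).1 else m + 1 + (k - (n + 1)) := by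
  subst hk
  change ((joinMap f (𝟙 b)).toOrderHom (x.toOrderHom j)).1 = _
  unfold joinMap joinDesc
  change Fin.val (dite _ _ _) = _
  split_ifs <;> rfl

variable {n : ℕ}

/-- For `i = 0` only the element `0` stays in the first summand, and `δ 0` omits it, so the whole
summand is collapsed. -/
theorem joinMap_δ_zero_joinHomotopy :
    joinMap (δ (0 : Fin (n + 2))) (𝟙 b) ≫ joinHomotopy b 0 = joinSnd ⦋n⦌ b ≫ joinInr ⦋n⦌ b := by
  apply join_hom_ext
  · simp only [joinInl_joinMap_assoc, joinInl_joinHomotopy, joinInl_joinSnd_assoc]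
    ext j : 4
    change ((joinHomotopyInl b 0).toOrderHom ((δ 0).toOrderHom j)).1 = n + 1 + 0
    rw [val_joinHomotopyInl_apply, val_δ_apply]
    simp
  · simp

/-- For the last `i` only the top element of the first summand moves, and the last face omits it. -/
theorem joinMap_δ_last_joinHomotopy :
    joinMap (δ (Fin.last (n + 1))) (𝟙 b) ≫ joinHomotopy b (Fin.last n) = 𝟙 _ := by
  apply join_hom_ext
  · simp only [joinInl_joinMap_assoc, joinInl_joinHomotopy, Category.comp_id]
    ext j : 4
    change ((joinHomotopyInl b _).toOrderHom ((δ _).toOrderHom j)).1 = j.1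
    have : j.1 < n + 1 := j.2
    rw [val_joinHomotopyInl_apply, val_δ_apply]
    simp only [Fin.val_last]
    split_ifs <;> omega
  · simp

/-- This and the next four identities are the relations of a simplicial homotopy, with the order of
composition reversed. On the second summand both sides are the inclusion, so only the piecewise
formula on the first summand has to be compared. -/
theorem joinMap_δ_castSucc_joinHomotopy (i : Fin (n + 2)) (j : Fin (n + 1))
    (hij : i ≤ j.castSucc) : joinMap (δ i.castSucc) (𝟙 b) ≫ joinHomotopy b j.succ =
      joinHomotopy b j ≫ joinMap (δ i) (𝟙 b) := by
  have hij' : i.1 ≤ j.1 := hij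
  apply join_hom_ext
  · simp only [joinInl_joinMap_assoc, joinInl_joinHomotopy, joinInl_joinHomotopy_assoc]
    ext k : 4
    rw [val_comp_joinMap_apply _ _ _ _ (val_joinHomotopyInl_apply _ _ _).symm]
    change ((joinHomotopyInl b _).toOrderHom ((δ _).toOrderHom k)).1 = _
    have : k.1 < n + 2 := k.2
    simp only [val_joinHomotopyInl_apply, val_δ_apply, Fin.val_succ, Fin.val_castSucc]
    split_ifs <;> omega
  · simp

theorem joinMap_δ_joinHomotopy_succ (j : Fin (n + 1)) :
    joinMap (δ j.castSucc.succ) (𝟙 b) ≫ joinHomotopy b j.succ =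
      joinMap (δ j.castSucc.succ) (𝟙 b) ≫ joinHomotopy b j.castSucc := by
  apply join_hom_ext
  · simp only [joinInl_joinMap_assoc, joinInl_joinHomotopy]
    ext k : 4
    change ((joinHomotopyInl b _).toOrderHom ((δ _).toOrderHom k)).1 =
      ((joinHomotopyInl b _).toOrderHom ((δ _).toOrderHom k)).1
    have : k.1 < n + 2 := k.2
    simp only [val_joinHomotopyInl_apply, val_δ_apply, Fin.val_succ, Fin.val_castSucc]
    split_ifs <;> omega
  · simp

theorem joinMap_δ_succ_joinHomotopy (i : Fin (n + 2)) (j : Fin (n + 1))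
    (hji : j.castSucc < i) : joinMap (δ i.succ) (𝟙 b) ≫ joinHomotopy b j.castSucc =
      joinHomotopy b j ≫ joinMap (δ i) (𝟙 b) := by
  have hij' : j.1 < i.1 := hji
  apply join_hom_ext
  · simp only [joinInl_joinMap_assoc, joinInl_joinHomotopy, joinInl_joinHomotopy_assoc]
    ext k : 4
    rw [val_comp_joinMap_apply _ _ _ _ (val_joinHomotopyInl_apply _ _ _).symm]
    change ((joinHomotopyInl b _).toOrderHom ((δ _).toOrderHom k)).1 = _
    have : k.1 < n + 2 := k.2
    simp only [val_joinHomotopyInl_apply, val_δ_apply, Fin.val_succ, Fin.val_castSucc]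
    split_ifs <;> omega
  · simp

theorem joinMap_σ_castSucc_joinHomotopy (i j : Fin (n + 1)) (hij : i ≤ j) :
    joinMap (σ i.castSucc) (𝟙 b) ≫ joinHomotopy b j =
      joinHomotopy b j.succ ≫ joinMap (σ i) (𝟙 b) := by
  have hij' : i.1 ≤ j.1 := hij
  apply join_hom_ext
  · simp only [joinInl_joinMap_assoc, joinInl_joinHomotopy, joinInl_joinHomotopy_assoc]
    ext k : 4
    rw [val_comp_joinMap_apply _ _ _ _ (val_joinHomotopyInl_apply _ _ _).symm]
    change ((joinHomotopyInl b _).toOrderHom ((σ _).toOrderHom k)).1 = _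
    have : k.1 < n + 3 := k.2
    simp only [val_joinHomotopyInl_apply, val_σ_apply, Fin.val_succ, Fin.val_castSucc]
    split_ifs <;> omega
  · simp

theorem joinMap_σ_succ_joinHomotopy (i j : Fin (n + 1)) (hji : j ≤ i) :
    joinMap (σ i.succ) (𝟙 b) ≫ joinHomotopy b j =
      joinHomotopy b j.castSucc ≫ joinMap (σ i) (𝟙 b) := by
  have hij' : j.1 ≤ i.1 := hji
  apply join_hom_ext
  · simp only [joinInl_joinMap_assoc, joinInl_joinHomotopy, joinInl_joinHomotopy_assoc]
    ext k : 4
    rw [val_comp_joinMap_apply _ _ _ _ (val_joinHomotopyInl_apply _ _ _).symm]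
    change ((joinHomotopyInl b _).toOrderHom ((σ _).toOrderHom k)).1 = _
    have : k.1 < n + 3 := k.2
    simp only [val_joinHomotopyInl_apply, val_σ_apply, Fin.val_succ, Fin.val_castSucc]
    split_ifs <;> omega
  · simp

end SimplexCategory

/-! ### Bisimplicial objects and the ordinal sum construction -/

namespace Bisimplicial

open SimplexCategory
open scoped Simplicial

variable {C : Type*} [Category C] (X : SimplexCategoryᵒᵖ × SimplexCategoryᵒᵖ ⥤ C)
  {a b c d a' b' c' d' a'' b'' : SimplexCategory}

/-- The structure maps of a bisimplicial object. -/
def bimap (f : a ⟶ b) (g : c ⟶ d) : X.obj (op b, op d) ⟶ X.obj (op a, op c) :=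
  X.map (X := (op b, op d)) (Y := (op a, op c)) (f.op, g.op)

theorem bimap_id : bimap X (𝟙 a) (𝟙 b) = 𝟙 (X.obj (op a, op b)) := X.map_id _

theorem bimap_comp (f : a ⟶ a') (f' : a' ⟶ a'') (g : b ⟶ b') (g' : b' ⟶ b'') :
    bimap X f' g' ≫ bimap X f g = bimap X (f ≫ f') (g ≫ g') :=
  (X.map_comp (X := (op a'', op b'')) (Y := (op a', op b')) (Z := (op a, op b))
    (f'.op, g'.op) (f.op, g.op)).symm

variable {X} in
theorem bimap_comp_eq {f : a ⟶ a'} {f' : a' ⟶ a''} {g : b ⟶ b'} {g' : b' ⟶ b''}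
    {k : a ⟶ a''} {l : b ⟶ b''} (h : f ≫ f' = k) (h' : g ≫ g' = l) :
    bimap X f' g' ≫ bimap X f g = bimap X k l := by
  rw [bimap_comp, h, h']

variable {X} in
theorem bimap_square {f : a ⟶ a'} {f' : a' ⟶ a''} {g : b ⟶ b'} {g' : b' ⟶ b''}
    {k : a ⟶ c} {k' : c ⟶ a''} {l : b ⟶ d} {l' : d ⟶ b''} (h : f ≫ f' = k ≫ k')
    (h' : g ≫ g' = l ≫ l') :
    bimap X f' g' ≫ bimap X f g = bimap X k' l' ≫ bimap X k l := by
  rw [bimap_comp, bimap_comp, h, h']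

variable {X} in
theorem bimap_comp_eq_id {f : a ⟶ a'} {f' : a' ⟶ a} {g : b ⟶ b'} {g' : b' ⟶ b}
    (h : f ≫ f' = 𝟙 a) (h' : g ≫ g' = 𝟙 b) :
    bimap X f' g' ≫ bimap X f g = 𝟙 (X.obj (op a, op b)) := by
  rw [bimap_comp, h, h', bimap_id]

/-- The diagonal of a bisimplicial object. -/
def diag : SimplicialObject C where
  obj n := X.obj (n, n)
  map f := bimap X f.unop f.unop
  map_id _ := bimap_id X
  map_comp _ _ := (bimap_comp X _ _ _ _).symm

/-- A bisimplicial object as a simplicial object in the category of simplicial objects. -/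
def curried : SimplicialObject (SimplicialObject C) where
  obj p :=
    { obj := fun q => X.obj (p, q)
      map := fun g => bimap X (𝟙 p.unop) g.unop
      map_id := fun _ => bimap_id X
      map_comp := fun _ _ => (bimap_comp_eq (Category.comp_id _) rfl).symm }
  map f :=
    { app := fun q => bimap X f.unop (𝟙 q.unop)
      naturality := fun _ _ _ => bimap_square (by simp) (by simp) }
  map_id p := by
    apply NatTrans.ext
    funext q
    exact bimap_id X
  map_comp f g := by
    apply NatTrans.ext
    funext q
    exact (bimap_comp_eq rfl (Category.comp_id _)).symm

/-- The bisimplicial object `(p, q) ↦ X (q * p, q)`, where `*` is the ordinal sum. -/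
def joined : SimplicialObject (SimplicialObject C) where
  obj p :=
    { obj := fun q => X.obj (op (join q.unop p.unop), q)
      map := fun g => bimap X (joinMap g.unop (𝟙 p.unop)) g.unop
      map_id := fun _ => (congrArg₂ (bimap X) joinMap_id rfl).trans (bimap_id X)
      map_comp := fun _ _ =>
        (bimap_comp_eq (by rw [← joinMap_comp, Category.comp_id]; rfl) rfl).symm }
  map f :=
    { app := fun q => bimap X (joinMap (𝟙 q.unop) f.unop) (𝟙 q.unop)
      naturality := fun _ _ _ =>
        bimap_square (by rw [← joinMap_comp, ← joinMap_comp]; simp) (by simp) }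
  map_id p := by
    apply NatTrans.ext
    funext q
    exact (congrArg₂ (bimap X) joinMap_id rfl).trans (bimap_id X)
  map_comp f g := by
    apply NatTrans.ext
    funext q
    exact (bimap_comp_eq (by rw [← joinMap_comp, Category.comp_id]; rfl)
      (Category.comp_id _)).symm

/-- The projection from `X (q * p, q)` to `X (p, q)`. -/
def toCurried : joined X ⟶ curried X where
  app p :=
    { app := fun q => bimap X (joinInr q.unop p.unop) (𝟙 q.unop)
      naturality := fun _ _ _ => bimap_square (by simp) (by simp) }
  naturality _ _ _ := by
    apply NatTrans.ext
    funext q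
    exact bimap_square (by simp) (by simp)

/-- The augmentation from `X (q * 0, q)` to `X (q, q)`. -/
def aug : (joined X).obj (op ⦋0⦌) ⟶ diag X where
  app q := bimap X (joinInl q.unop ⦋0⦌) (𝟙 q.unop)
  naturality _ _ _ := bimap_square (by simp) (by simp)

/-- The two faces act on the second summand only, and the augmentation restricts to the first. -/
theorem δ_aug : (joined X).δ (0 : Fin 2) ≫ aug X = (joined X).δ 1 ≫ aug X := by
  apply NatTrans.ext
  funext q
  exact bimap_square (by simp) (by simp)

/-- The section of `toCurried` in a fixed first degree. -/
def fromCurried (p : SimplexCategoryᵒᵖ) : (curried X).obj p ⟶ (joined X).obj p where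
  app q := bimap X (joinSnd q.unop p.unop) (𝟙 q.unop)
  naturality _ _ _ := bimap_square (by simp [joinMap_joinSnd]) (by simp)

theorem fromCurried_toCurried (p : SimplexCategoryᵒᵖ) :
    fromCurried X p ≫ (toCurried X).app p = 𝟙 _ := by
  apply NatTrans.ext
  funext q
  exact bimap_comp_eq_id (by simp) (by simp)

/-- The simplicial homotopy between the identity of `X (q * p, q)` and the map that collapses
`q`. -/
def homotopy (p : SimplexCategoryᵒᵖ) : SimplicialObject.Homotopy (𝟙 ((joined X).obj p))
    ((toCurried X).app p ≫ fromCurried X p) where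
  -- The index `q` occurs in both variables. In the first it is pushed step by step into `p`, and in
  -- the second the ordinary degeneracy is applied, so both variables satisfy the homotopy relations
  -- simultaneously.
  h {_} i := bimap X (joinHomotopy p.unop i) (σ i)
  h_zero_comp_δ_zero _ :=
    (bimap_comp X _ _ _ _).trans <| (congrArg₂ (bimap X) joinMap_δ_zero_joinHomotopy
      ((δ_comp_σ_self (i := (0 : Fin (_ + 1)))).trans (Category.comp_id _).symm)).trans
        (bimap_comp X _ _ _ _).symm
  h_last_comp_δ_last _ :=
    bimap_comp_eq_id joinMap_δ_last_joinHomotopy (δ_comp_σ_succ (i := Fin.last _))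
  h_succ_comp_δ_castSucc_of_lt i j hij :=
    bimap_square (joinMap_δ_castSucc_joinHomotopy i j hij) (δ_comp_σ_of_le hij)
  h_succ_comp_δ_castSucc_succ j :=
    bimap_square (joinMap_δ_joinHomotopy_succ j)
      ((δ_comp_σ_self (i := j.succ)).trans (δ_comp_σ_succ (i := j.castSucc)).symm)
  h_castSucc_comp_δ_succ_of_lt i j hji :=
    bimap_square (joinMap_δ_succ_joinHomotopy i j hji) (δ_comp_σ_of_gt hji)
  h_comp_σ_castSucc_of_le i j hij :=
    bimap_square (joinMap_σ_castSucc_joinHomotopy i j hij) (σ_comp_σ hij)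
  h_comp_σ_succ_of_lt i j hji :=
    bimap_square (joinMap_σ_succ_joinHomotopy i j hji) (σ_comp_σ hji).symm

/-- The section of the augmentation. -/
def augSection (q : SimplexCategory) : X.obj (op q, op q) ⟶ X.obj (op (join q ⦋0⦌), op q) :=
  bimap X (joinFst q ⦋0⦌) (𝟙 q)

/-- The extra degeneracies of `p ↦ X (q * p, q)`. -/
def extraDegeneracy (q : SimplexCategory) (p : ℕ) :
    X.obj (op (join q ⦋p⦌), op q) ⟶ X.obj (op (join q ⦋p + 1⦌), op q) :=
  bimap X (joinShift q p) (𝟙 q)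

theorem augSection_aug (q : SimplexCategory) : augSection X q ≫ (aug X).app (op q) = 𝟙 _ :=
  bimap_comp_eq_id (by simp) (by simp)

/-- Together with the two identities that follow, this says that the extra degeneracies and
`augSection` contract the augmented row `X (q * p, q) → X (q, q)`. -/
theorem extraDegeneracy_δ_zero (q : SimplexCategory) (p : ℕ) :
    extraDegeneracy X q p ≫ ((joined X).δ (0 : Fin (p + 2))).app (op q) = 𝟙 _ :=
  bimap_comp_eq_id (joinMap_δ_zero_joinShift p) (by simp)

theorem extraDegeneracy_δ_succ (q : SimplexCategory) (p : ℕ) (i : Fin (p + 2)) :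
    extraDegeneracy X q (p + 1) ≫ ((joined X).δ i.succ).app (op q) =
      ((joined X).δ i).app (op q) ≫ extraDegeneracy X q p :=
  bimap_square (joinMap_δ_succ_joinShift p i) rfl

theorem extraDegeneracy_δ_one (q : SimplexCategory) :
    extraDegeneracy X q 0 ≫ ((joined X).δ (1 : Fin 2)).app (op q) =
      (aug X).app (op q) ≫ augSection X q :=
  bimap_square joinMap_δ_one_joinShift rfl

section Naturality

variable {X} {Y : SimplexCategoryᵒᵖ × SimplexCategoryᵒᵖ ⥤ C} (φ : X ⟶ Y)

theorem bimap_naturality (f : a ⟶ b) (g : c ⟶ d) :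
    bimap X f g ≫ φ.app (op a, op c) = φ.app (op b, op d) ≫ bimap Y f g :=
  φ.naturality _

/-- The functoriality of the diagonal. -/
def diagMap : diag X ⟶ diag Y where
  app n := φ.app (n, n)
  naturality _ _ _ := bimap_naturality φ _ _

/-- The functoriality of `curried`. -/
def curriedMap : curried X ⟶ curried Y where
  app p := { app := fun q => φ.app (p, q)
             naturality := fun _ _ _ => bimap_naturality φ _ _ }
  naturality _ _ _ := by
    apply NatTrans.ext
    funext q
    exact bimap_naturality φ _ _

/-- The functoriality of `joined`. -/
def joinedMap : joined X ⟶ joined Y where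
  app p := { app := fun q => φ.app (op (join q.unop p.unop), q)
             naturality := fun _ _ _ => bimap_naturality φ _ _ }
  naturality _ _ _ := by
    apply NatTrans.ext
    funext q
    exact bimap_naturality φ _ _

theorem joinedMap_toCurried : joinedMap φ ≫ toCurried Y = toCurried X ≫ curriedMap φ := by
  apply NatTrans.ext
  funext p
  apply NatTrans.ext
  funext q
  exact (bimap_naturality φ _ _).symm

theorem joinedMap_aug : (joinedMap φ).app (op ⦋0⦌) ≫ aug Y = aug X ≫ diagMap φ := by
  apply NatTrans.ext
  funext q
  exact (bimap_naturality φ _ _).symm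

end Naturality

end Bisimplicial

/-! ### The Eilenberg–Zilber theorem -/

namespace Bisimplicial

open SimplexCategory AlgebraicTopology DoubleComplex
open scoped Simplicial

variable {R : Type} [CommRing R]

/-- The double complex of alternating sums of face maps of a bisimplicial module. -/
noncomputable def biAlt : SimplicialObject (SimplicialObject (ModuleCat.{0} R)) ⥤
    ChainComplex (ChainComplex (ModuleCat.{0} R) ℕ) ℕ :=
  alternatingFaceMapComplex (SimplicialObject (ModuleCat.{0} R)) ⋙
    (alternatingFaceMapComplex (ModuleCat.{0} R)).mapHomologicalComplex _

theorem sum_zsmul_hom_apply {M N : ModuleCat.{0} R} {k : ℕ} (f : Fin k → (M ⟶ N)) (x : M) :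
    (∑ i : Fin k, (-1 : ℤ) ^ (i : ℕ) • f i).hom x =
      ∑ i : Fin k, (-1 : ℤ) ^ (i : ℕ) • (f i).hom x := by
  rw [ModuleCat.hom_sum, LinearMap.sum_apply]
  rfl

/-- This is the contraction formula `∂ s = id - s ∂` evaluated where `s ∂` vanishes: the zeroth face
of `s z` returns `z`, and the shifted index changes the sign of all the others. -/
theorem alternating_sum_eq_of_succ {V W : Type*} [AddCommGroup V] [AddCommGroup W] {k : ℕ}
    {u : Fin (k + 1) → V} (v : Fin k → W) (s : W →+ V) (h : ∀ i, u i.succ = s (v i)) {z : V}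
    (hz : u 0 = z) (hv : s (∑ i : Fin k, (-1 : ℤ) ^ (i : ℕ) • v i) = 0) :
    ∑ i : Fin (k + 1), (-1 : ℤ) ^ (i : ℕ) • u i = z := by
  have h1 : ∑ i : Fin k, (-1 : ℤ) ^ (i.succ : ℕ) • u i.succ =
      -s (∑ i : Fin k, (-1 : ℤ) ^ (i : ℕ) • v i) := by
    rw [map_sum, ← Finset.sum_neg_distrib]
    refine Finset.sum_congr rfl fun i _ => ?_
    rw [h, map_zsmul, Fin.val_succ, pow_succ]
    simp
  rw [Fin.sum_univ_succ, hz, h1, hv]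
  simp

theorem biAlt_d_apply (S : SimplicialObject (SimplicialObject (ModuleCat.{0} R))) (p q : ℕ)
    (x : (S.obj (op ⦋p + 1⦌)).obj (op ⦋q⦌)) :
    ((((biAlt.obj S).d (p + 1) p).f q).hom x : (S.obj (op ⦋p⦌)).obj (op ⦋q⦌)) =
      ∑ i : Fin (p + 2), (-1 : ℤ) ^ (i : ℕ) • ((S.δ i).app (op ⦋q⦌)).hom x := by
  have h : ((biAlt.obj S).d (p + 1) p).f q =
      ∑ i : Fin (p + 2), (-1 : ℤ) ^ (i : ℕ) • (S.δ i).app (op ⦋q⦌) := by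
    change (((alternatingFaceMapComplex (SimplicialObject (ModuleCat.{0} R))).obj S).d
      (p + 1) p).app (op ⦋q⦌) = _
    rw [alternatingFaceMapComplex_obj_d, AlternatingFaceMapComplex.objD]
    simp only [NatTrans.app_sum, NatTrans.app_zsmul]
  exact (congrArg (fun g : (S.obj (op ⦋p + 1⦌)).obj (op ⦋q⦌) ⟶ (S.obj (op ⦋p⦌)).obj (op ⦋q⦌) =>
    g.hom x) h).trans (sum_zsmul_hom_apply _ x)

variable (X : SimplexCategoryᵒᵖ × SimplexCategoryᵒᵖ ⥤ ModuleCat.{0} R)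

/-- The map from the total complex of `joined X` to the complex of the diagonal. -/
noncomputable def totJoinedToDiag :
    tot (biAlt.obj (joined X)) ⟶ (alternatingFaceMapComplex _).obj (diag X) :=
  totAug ((alternatingFaceMapComplex _).map (aug X)) <| by
    change (alternatingFaceMapComplex _).map (((alternatingFaceMapComplex _).obj (joined X)).d 1 0)
      ≫ _ = 0
    rw [← Functor.map_comp, alternatingFaceMapComplex_obj_d, AlternatingFaceMapComplex.objD,
      Fin.sum_univ_two]
    simp only [Fin.val_zero, Fin.val_one, pow_zero, pow_one, one_smul, Preadditive.add_comp,
      δ_aug]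
    simp

/-- For fixed `q` the row `p ↦ X (q * p, q)` with its augmentation to `X (q, q)` is contracted by
the extra degeneracies, hence exact. -/
theorem bijective_homologyMap_totJoinedToDiag (n : ℕ) :
    Function.Bijective (HomologicalComplex.homologyMap (totJoinedToDiag X) n) := by
  have h0 : ∀ q p (z : X.obj (op (join ⦋q⦌ ⦋p⦌), op ⦋q⦌)),
      ((joined X).δ (0 : Fin (p + 2))).app (op ⦋q⦌) ((extraDegeneracy X ⦋q⦌ p).hom z) = z :=
    fun q p z => congrArg (fun f => ModuleCat.Hom.hom f z) (extraDegeneracy_δ_zero X ⦋q⦌ p)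
  apply bijective_totAug
  · intro q z
    exact ⟨(augSection X ⦋q⦌).hom z,
      congrArg (fun f => ModuleCat.Hom.hom f z) (augSection_aug X ⦋q⦌)⟩
  · intro q z hz
    have h1 : ((joined X).δ (1 : Fin 2)).app (op ⦋q⦌) ((extraDegeneracy X ⦋q⦌ 0).hom z) = 0 :=
      (congrArg (fun f => ModuleCat.Hom.hom f z) (extraDegeneracy_δ_one X ⦋q⦌)).trans
        ((congrArg (augSection X ⦋q⦌).hom hz).trans (map_zero _))
    refine ⟨(extraDegeneracy X ⦋q⦌ 0).hom z, ?_⟩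
    refine (biAlt_d_apply (joined X) 0 q _).trans ?_
    -- The only other face of the extra degeneracy factors through the augmentation of `z`, which is
    -- zero, so the family `v` is taken to be zero.
    refine alternating_sum_eq_of_succ (fun _ : Fin 1 => (0 : X.obj (op ⦋q⦌, op ⦋q⦌)))
      (augSection X ⦋q⦌).hom.toAddMonoidHom (fun i => ?_) (h0 q 0 z) ?_
    · obtain rfl : i = 0 := Subsingleton.elim _ _
      exact h1.trans (map_zero (augSection X ⦋q⦌).hom).symm
    · refine (congrArg (augSection X ⦋q⦌).hom ?_).trans (map_zero (augSection X ⦋q⦌).hom)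
      simp
  · intro p q z hz
    refine ⟨(extraDegeneracy X ⦋q⦌ (p + 1)).hom z, ?_⟩
    refine (biAlt_d_apply (joined X) (p + 1) q _).trans ?_
    refine alternating_sum_eq_of_succ _ (extraDegeneracy X ⦋q⦌ p).hom.toAddMonoidHom (fun i =>
      congrArg (fun f => ModuleCat.Hom.hom f z) (extraDegeneracy_δ_succ X ⦋q⦌ p i))
      (h0 q (p + 1) z) ?_
    exact (congrArg (extraDegeneracy X ⦋q⦌ p).hom
      ((biAlt_d_apply (joined X) p q z).symm.trans hz)).trans
        (map_zero (extraDegeneracy X ⦋q⦌ p).hom)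

/-- The map of total complexes from `joined X` to `X`. -/
noncomputable def totJoinedToCurried :
    tot (biAlt.obj (joined X)) ⟶ tot (biAlt.obj (curried X)) :=
  totMap (biAlt.map (toCurried X))

/-- For fixed `p` the projection has a section and a simplicial homotopy, so it is an isomorphism on
the homology of the column. The section need not be natural in `p`, but `coneExact_totMap` uses only
the individual columns. -/
theorem bijective_homologyMap_totJoinedToCurried (n : ℕ) :
    Function.Bijective (HomologicalComplex.homologyMap (totJoinedToCurried X) n) := by
  apply ChainComplex.bijective_of_coneExact
  apply coneExact_totMap
  intro p
  apply ChainComplex.coneExact_of_bijective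
  intro q
  let f := (alternatingFaceMapComplex (ModuleCat.{0} R)).map ((toCurried X).app (op ⦋p⦌))
  let g := (alternatingFaceMapComplex (ModuleCat.{0} R)).map (fromCurried X (op ⦋p⦌))
  have hgf : g ≫ f = 𝟙 _ := by
    rw [← Functor.map_comp, fromCurried_toCurried]
    exact CategoryTheory.Functor.map_id _ _
  have h1 : HomologicalComplex.homologyMap f q ≫ HomologicalComplex.homologyMap g q = 𝟙 _ := by
    rw [← HomologicalComplex.homologyMap_comp, ← Functor.map_comp]
    have h := (homotopy X (op ⦋p⦌)).map_homology_eq q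
    rw [CategoryTheory.Functor.map_id] at h
    exact h.symm.trans (CategoryTheory.Functor.map_id _ _)
  have h2 : HomologicalComplex.homologyMap g q ≫ HomologicalComplex.homologyMap f q = 𝟙 _ := by
    rw [← HomologicalComplex.homologyMap_comp, hgf, HomologicalComplex.homologyMap_id]
  have : IsIso (HomologicalComplex.homologyMap f q) := ⟨_, h1, h2⟩
  exact ConcreteCategory.bijective_of_isIso (HomologicalComplex.homologyMap f q)

/-- **Eilenberg–Zilber**: the homology of the diagonal of a bisimplicial module is isomorphic to the
homology of its total complex. -/
noncomputable def homologyTotEquivDiag (n : ℕ) :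
    (tot (biAlt.obj (curried X))).homology n ≃ₗ[R]
      ((alternatingFaceMapComplex _).obj (diag X)).homology n :=
  (LinearEquiv.ofBijective (HomologicalComplex.homologyMap (totJoinedToCurried X) n).hom
    (bijective_homologyMap_totJoinedToCurried X n)).symm ≪≫ₗ
  LinearEquiv.ofBijective (HomologicalComplex.homologyMap (totJoinedToDiag X) n).hom
    (bijective_homologyMap_totJoinedToDiag X n)

theorem homologyTotEquivDiag_apply (n : ℕ) (x : (tot (biAlt.obj (joined X))).homology n) :
    homologyTotEquivDiag X n (HomologicalComplex.homologyMap (totJoinedToCurried X) n x) =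
      HomologicalComplex.homologyMap (totJoinedToDiag X) n x :=
  congrArg (HomologicalComplex.homologyMap (totJoinedToDiag X) n)
    ((LinearEquiv.ofBijective _ (bijective_homologyMap_totJoinedToCurried X n)).symm_apply_apply x)

-- Both legs of the comparison through `joined X` are natural. Since the leg to `X` is bijective on
-- homology, it suffices to check classes that come from `joined X`.
variable {X} in
theorem homologyTotEquivDiag_naturality {Y : SimplexCategoryᵒᵖ × SimplexCategoryᵒᵖ ⥤ ModuleCat.{0} R}
    (φ : X ⟶ Y) (n : ℕ) (x : (tot (biAlt.obj (curried X))).homology n) :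
    homologyTotEquivDiag Y n
        (HomologicalComplex.homologyMap (totMap (biAlt.map (curriedMap φ))) n x) =
      HomologicalComplex.homologyMap ((alternatingFaceMapComplex _).map (diagMap φ)) n
        (homologyTotEquivDiag X n x) := by
  obtain ⟨x, rfl⟩ := (bijective_homologyMap_totJoinedToCurried X n).2 x
  rw [homologyTotEquivDiag_apply]
  have h1 : totJoinedToCurried X ≫ totMap (biAlt.map (curriedMap φ)) =
      totMap (biAlt.map (joinedMap φ)) ≫ totJoinedToCurried Y := by
    rw [totJoinedToCurried, totJoinedToCurried, ← totMap_comp, ← totMap_comp, ← Functor.map_comp,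
      ← Functor.map_comp, joinedMap_toCurried]
  have h2 : totJoinedToDiag X ≫ (alternatingFaceMapComplex _).map (diagMap φ) =
      totMap (biAlt.map (joinedMap φ)) ≫ totJoinedToDiag Y := by
    ext m : 1
    refine ModuleCat.hom_ext (LinearMap.ext fun z => ?_)
    exact (congrArg (fun f => (f.app (op ⦋m⦌)).hom
      (DoubleComplex.comp (biAlt.obj (joined X)) 0 m (zero_add m) z)) (joinedMap_aug φ)).symm
  rw [← ConcreteCategory.comp_apply, ← ConcreteCategory.comp_apply,
    ← HomologicalComplex.homologyMap_comp, ← HomologicalComplex.homologyMap_comp, h1, h2,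
    HomologicalComplex.homologyMap_comp, HomologicalComplex.homologyMap_comp,
    ConcreteCategory.comp_apply, ConcreteCategory.comp_apply, homologyTotEquivDiag_apply]

end Bisimplicial

/-! ### The tensor product double complex and its bisimplicial origin -/

namespace DoubleComplex

variable {R : Type} [CommRing R] (C D : ChainComplex (ModuleCat.{0} R) ℕ)
  {C' D' : ChainComplex (ModuleCat.{0} R) ℕ}

/-- The double complex `(p, q) ↦ C p ⊗ D q`. -/
noncomputable def tensorDC : ChainComplex (ChainComplex (ModuleCat.{0} R) ℕ) ℕ where
  X p :=
    { X := fun q => C.X p ⊗ D.X q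
      d := fun i j => C.X p ◁ D.d i j
      shape := fun i j h => by rw [D.shape i j h, MonoidalPreadditive.whiskerLeft_zero]
      d_comp_d' := fun i j k _ _ => by
        rw [← MonoidalCategory.whiskerLeft_comp, D.d_comp_d,
          MonoidalPreadditive.whiskerLeft_zero] }
  d i j :=
    { f := fun q => C.d i j ▷ D.X q
      comm' := fun q r _ => (whisker_exchange _ _).symm }
  shape i j h := by
    ext q : 1
    exact (congrArg (· ▷ D.X q) (C.shape i j h)).trans MonoidalPreadditive.zero_whiskerRight
  d_comp_d' i j k _ _ := by
    ext q : 1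
    exact ((comp_whiskerRight _ _ _).symm.trans (congrArg (· ▷ D.X q) (C.d_comp_d i j k))).trans
      MonoidalPreadditive.zero_whiskerRight

variable {C D}

/-- The functoriality of `tensorDC`. -/
noncomputable def tensorDCMap (f : C ⟶ C') (g : D ⟶ D') : tensorDC C D ⟶ tensorDC C' D' where
  f p :=
    { f := fun q => f.f p ⊗ₘ g.f q
      comm' := fun q r _ => by
        change (f.f p ⊗ₘ g.f q) ≫ C'.X p ◁ D'.d q r = C.X p ◁ D.d q r ≫ (f.f p ⊗ₘ g.f r)
        rw [← id_tensorHom, ← id_tensorHom, tensorHom_comp_tensorHom, tensorHom_comp_tensorHom,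
          g.comm]
        simp }
  comm' i j _ := by
    ext q : 1
    change (f.f i ⊗ₘ g.f q) ≫ C'.d i j ▷ D'.X q = C.d i j ▷ D.X q ≫ (f.f j ⊗ₘ g.f q)
    rw [← tensorHom_id, ← tensorHom_id, tensorHom_comp_tensorHom, tensorHom_comp_tensorHom,
      f.comm]
    simp

end DoubleComplex

namespace Bisimplicial

open SimplexCategory AlgebraicTopology DoubleComplex
open scoped Simplicial

variable {R : Type} [CommRing R] (A B : SimplicialObject (ModuleCat.{0} R))
  {A' B' : SimplicialObject (ModuleCat.{0} R)}

/-- The bisimplicial module `(p, q) ↦ A p ⊗ B q`. -/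
noncomputable abbrev outer : SimplexCategoryᵒᵖ × SimplexCategoryᵒᵖ ⥤ ModuleCat.{0} R :=
  A.prod B ⋙ tensor (ModuleCat.{0} R)

theorem curried_outer_vertical_d (p : SimplexCategoryᵒᵖ) (q : ℕ) :
    ((alternatingFaceMapComplex _).obj ((curried (outer A B)).obj p)).d (q + 1) q =
      A.obj p ◁ ((alternatingFaceMapComplex _).obj B).d (q + 1) q := by
  rw [alternatingFaceMapComplex_obj_d, alternatingFaceMapComplex_obj_d,
    AlternatingFaceMapComplex.objD, AlternatingFaceMapComplex.objD, whiskerLeft_sum]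
  refine Finset.sum_congr rfl fun i _ => ?_
  refine Eq.trans ?_ ((tensorLeft (A.obj p)).map_zsmul (f := B.δ i)).symm
  congr 1
  change A.map (𝟙 p) ⊗ₘ B.δ i = A.obj p ◁ B.δ i
  rw [A.map_id, id_tensorHom]

theorem curried_outer_horizontal_d (p q : ℕ) :
    ((biAlt.obj (curried (outer A B))).d (p + 1) p).f q =
      ((alternatingFaceMapComplex _).obj A).d (p + 1) p ▷ B.obj (op ⦋q⦌) := by
  change (((alternatingFaceMapComplex (SimplicialObject (ModuleCat.{0} R))).obj
    (curried (outer A B))).d (p + 1) p).app (op ⦋q⦌) = _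
  rw [alternatingFaceMapComplex_obj_d, alternatingFaceMapComplex_obj_d,
    AlternatingFaceMapComplex.objD, AlternatingFaceMapComplex.objD, sum_whiskerRight,
    NatTrans.app_sum]
  refine Finset.sum_congr rfl fun i _ => ?_
  refine Eq.trans ?_ ((tensorRight (B.obj (op ⦋q⦌))).map_zsmul (f := A.δ i)).symm
  rw [NatTrans.app_zsmul]
  congr 1
  change A.δ i ⊗ₘ B.map (𝟙 (op ⦋q⦌)) = A.δ i ▷ B.obj (op ⦋q⦌)
  rw [B.map_id, tensorHom_id]

/-- The double complex of `outer A B` is a tensor product of complexes. -/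
noncomputable def biAltOuterIso : biAlt.obj (curried (outer A B)) ≅
    tensorDC ((alternatingFaceMapComplex _).obj A) ((alternatingFaceMapComplex _).obj B) :=
  HomologicalComplex.Hom.isoOfComponents
    (fun p => HomologicalComplex.Hom.isoOfComponents
      (fun q => Iso.refl (A.obj (op ⦋p⦌) ⊗ B.obj (op ⦋q⦌))) (by
        rintro _ q rfl
        exact (Category.id_comp _).trans
          ((curried_outer_vertical_d A B (op ⦋p⦌) q).symm.trans (Category.comp_id _).symm)))
    (by
      rintro _ p rfl
      ext q : 1
      exact (Category.id_comp _).trans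
          ((curried_outer_horizontal_d A B p q).symm.trans (Category.comp_id _).symm))

variable {A B} in
theorem biAltOuterIso_naturality (f : A ⟶ A') (g : B ⟶ B') :
    biAlt.map (curriedMap (Functor.whiskerRight (NatTrans.prod f g) (tensor (ModuleCat.{0} R)))) ≫
        (biAltOuterIso A' B').hom =
      (biAltOuterIso A B).hom ≫ tensorDCMap ((alternatingFaceMapComplex _).map f)
        ((alternatingFaceMapComplex _).map g) := by
  ext p q : 2
  exact (Category.comp_id _).trans (Category.id_comp _).symm

end Bisimplicial

/-! ### Submodules of projective modules over a principal ideal domain -/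

namespace Module

variable {R : Type} [CommRing R] [IsDomain R] [IsPrincipalIdealRing R]

/-- Over a principal ideal domain, quotients of injective modules are injective. -/
theorem Baer.of_surjective {I J : Type} [AddCommGroup I] [Module R I] [AddCommGroup J] [Module R J]
    (hI : Baer R I) (p : I →ₗ[R] J) (hp : Function.Surjective p) : Baer R J := by
  intro 𝔞 g
  obtain ⟨a, rfl⟩ := IsPrincipalIdealRing.principal 𝔞
  by_cases ha : a = 0
  · subst ha
    refine ⟨0, fun x hx => ?_⟩
    obtain rfl : x = 0 := by simpa using hx
    exact (map_zero g).symm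
  · have haa : a ∈ Submodule.span R {a} := Submodule.mem_span_singleton_self a
    -- A nonzero principal ideal is free on its generator, so `a ↦ y` defines a map from the ideal
    -- to `I`. It extends to the ring, and its composite with `p` extends `g`.
    obtain ⟨y, hy⟩ := hp (g ⟨a, haa⟩)
    let e := LinearEquiv.toSpanNonzeroSingleton R R a ha
    obtain ⟨h, hh⟩ := hI _ (LinearMap.toSpanSingleton R I y ∘ₗ e.symm.toLinearMap)
    have hay : h a = y := by
      rw [hh a haa]
      have : e.symm ⟨a, haa⟩ = 1 := by
        rw [LinearEquiv.symm_apply_eq]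
        exact Subtype.ext (one_smul R a).symm
      simp [this]
    refine ⟨p ∘ₗ h, fun x hx => ?_⟩
    obtain ⟨c, rfl⟩ := Submodule.mem_span_singleton.1 hx
    rw [map_smul, LinearMap.comp_apply, hay, hy, ← map_smul]
    rfl

/-- Over a principal ideal domain, submodules of projective modules are projective. -/
theorem Projective.of_injective {S P : Type} [AddCommGroup S] [Module R S] [AddCommGroup P]
    [Module R P] [Projective R P] (i : S →ₗ[R] P) (hi : Function.Injective i) :
    Projective R S := by
  refine Projective.of_lifting_property'' fun f hf => ?_
  -- To split the free cover `f` of `S`, embed its source into an injective `I`. The quotient of `I`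
  -- by the image of `ker f` is injective again and contains `S`.
  let I := CategoryTheory.Injective.under (ModuleCat.of R (S →₀ R))
  let j : (S →₀ R) →ₗ[R] I := (CategoryTheory.Injective.ι (ModuleCat.of R (S →₀ R))).hom
  have hj : Function.Injective j := (ModuleCat.mono_iff_injective _).1 inferInstance
  have hI : Baer R I :=
    Baer.of_injective ((injective_iff_injective_object (R := R) (M := I)).2 (inferInstanceAs (CategoryTheory.Injective I)))
  let q : I →ₗ[R] I ⧸ (LinearMap.ker f).map j := Submodule.mkQ _
  have hq : Function.Surjective q := Submodule.mkQ_surjective _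
  have hqj : ∀ x, q (j x) = 0 ↔ f x = 0 := fun x => by
    rw [Submodule.mkQ_apply, Submodule.Quotient.mk_eq_zero, Submodule.mem_map]
    constructor
    · rintro ⟨y, hy, hyx⟩
      rwa [← hj hyx]
    · exact fun hx => ⟨x, hx, rfl⟩
  obtain ⟨σ, hσ⟩ := hf.hasRightInverse
  -- The embedding of `S` into that quotient; it is linear because the set-theoretic section `σ` is
  -- linear modulo `ker f`.
  let u : S →ₗ[R] I ⧸ (LinearMap.ker f).map j :=
    { toFun := fun s => q (j (σ s))
      map_add' := fun a b => by
        rw [← sub_eq_zero, ← map_add, ← map_add, ← map_sub, ← map_sub, hqj]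
        simp [hσ _]
      map_smul' := fun c a => by
        rw [RingHom.id_apply, ← sub_eq_zero, ← map_smul, ← map_smul, ← map_sub, ← map_sub, hqj]
        simp [hσ _] }
  -- Extend `u` from `S` to `P` by injectivity of the quotient, then lift to `I` by projectivity of
  -- `P`.
  obtain ⟨v, hv⟩ := (hI.of_surjective q hq).extension_property i hi u
  obtain ⟨w, hw⟩ := projective_lifting_property q v hq
  -- On `S` the lift agrees with `j ∘ σ` modulo `j (ker f)`, so it takes values in the free module,
  -- where it is the required section of `f`.
  have key : ∀ s, ∃ m, j m = w (i s) ∧ f m = s := fun s => by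
    have h1 : q (w (i s)) = q (j (σ s)) :=
      (LinearMap.congr_fun hw (i s)).trans (LinearMap.congr_fun hv s)
    have h2 : w (i s) - j (σ s) ∈ (LinearMap.ker f).map j := by
      rw [← Submodule.Quotient.mk_eq_zero, ← Submodule.mkQ_apply, map_sub]
      exact sub_eq_zero.2 h1
    obtain ⟨k, hk, hkj⟩ := h2
    refine ⟨k + σ s, ?_, ?_⟩
    · rw [map_add, hkj, sub_add_cancel]
    · rw [map_add, LinearMap.mem_ker.1 hk, hσ, zero_add]
  choose h hjh hfh using key
  refine ⟨{ toFun := h, map_add' := fun a b => hj ?_, map_smul' := fun c a => hj ?_ }, ?_⟩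
  · simp only [map_add, hjh]
  · simp only [map_smul, hjh, RingHom.id_apply]
  · exact LinearMap.ext hfh

theorem Projective.submodule {P : Type} [AddCommGroup P] [Module R P] [Projective R P]
    (S : Submodule R P) : Projective R S :=
  Projective.of_injective S.subtype S.injective_subtype

end Module

/-! ### Compactly supported integer-valued functions: projectivity and products -/

section CompactlySupported

open TensorProduct

variable {X Y X' Y' : Type} [TopologicalSpace X] [TopologicalSpace Y]
  [TopologicalSpace X'] [TopologicalSpace Y']

/-- The map from a space to the space of components of its Stone–Čech compactification. -/
def profiniteUnit (x : X) : Profinite.of (ConnectedComponents (StoneCech X)) :=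
  ConnectedComponents.mk (stoneCechUnit x)

theorem denseRange_profiniteUnit : DenseRange (profiniteUnit (X := X)) :=
  ConnectedComponents.surjective_coe.denseRange.comp denseRange_stoneCechUnit
    ConnectedComponents.continuous_coe

/-- The range of `f` is compact and discrete, so `f` extends to the Stone–Čech compactification with
values in that range, and such an extension is constant on connected components. -/
theorem exists_comp_profiniteUnit (f : C_c(X, ℤ)) :
    ∃ g : LocallyConstant (Profinite.of (ConnectedComponents (StoneCech X))) ℤ,
      ∀ x, g (profiniteUnit x) = f x := by
  have hc : IsCompact (Set.range f) := f.hasCompactSupport.isCompact_range (map_continuous f)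
  have : CompactSpace (Set.range f) := isCompact_iff_compactSpace.1 hc
  have hcont : Continuous (Set.rangeFactorization f) := (map_continuous f).subtype_mk _
  let g₀ : StoneCech X → Set.range f := stoneCechExtend hcont
  have hg₀ : Continuous g₀ := continuous_stoneCechExtend hcont
  refine ⟨⟨fun c => (hg₀.connectedComponentsLift c : ℤ), ?_⟩, fun x => ?_⟩
  · exact (IsLocallyConstant.iff_continuous _).2
      (continuous_subtype_val.comp hg₀.connectedComponentsLift_continuous)
  · exact congrArg Subtype.val (stoneCechExtend_stoneCechUnit hcont x)

/-- The group `C_c(X, ℤ)` is projective, hence free. -/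
instance CompactlySupportedContinuousMap.projective : Module.Projective ℤ C_c(X, ℤ) := by
  -- Because `X` has dense image in `S`, locally constant functions on `S` are determined by their
  -- values on `X`. They form a group of functions on `X` containing `C_c(X, ℤ)`, and Nöbeling's
  -- theorem makes that group free.
  let S := Profinite.of (ConnectedComponents (StoneCech X))
  let κ : LocallyConstant S ℤ →ₗ[ℤ] X → ℤ :=
    { toFun := fun g x => g (profiniteUnit x)
      map_add' := fun _ _ => rfl
      map_smul' := fun _ _ => rfl }
  have hκ : Function.Injective κ := fun g g' h => by
    apply LocallyConstant.coe_injective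
    refine g.continuous.ext_on denseRange_profiniteUnit g'.continuous ?_
    rintro _ ⟨x, rfl⟩
    exact congrFun h x
  let c : C_c(X, ℤ) →ₗ[ℤ] X → ℤ :=
    { toFun := fun f => f
      map_add' := fun _ _ => rfl
      map_smul' := fun _ _ => rfl }
  let i : C_c(X, ℤ) →ₗ[ℤ] LocallyConstant S ℤ :=
    (LinearEquiv.ofInjective κ hκ).symm.toLinearMap ∘ₗ c.codRestrict (LinearMap.range κ)
      fun f => let ⟨g, hg⟩ := exists_comp_profiniteUnit f; ⟨g, funext hg⟩
  have : Module.Free ℤ (LocallyConstant S ℤ) := LocallyConstant.freeOfProfinite S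
  have : Module.Projective ℤ (LocallyConstant S ℤ) := Module.Projective.of_free
  refine Module.Projective.of_injective (P := LocallyConstant S ℤ) i ?_
  refine (LinearEquiv.ofInjective κ hκ).symm.injective.comp fun f f' h => ?_
  exact DFunLike.coe_injective (congrArg Subtype.val h)

/-- The function `(x, y) ↦ f x * g y`. -/
def externalMul (f : C_c(X, ℤ)) (g : C_c(Y, ℤ)) : C_c(X × Y, ℤ) where
  toFun p := f p.1 * g p.2
  continuous_toFun := ((map_continuous f).comp continuous_fst).mul
    ((map_continuous g).comp continuous_snd)
  hasCompactSupport' := by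
    have hK := f.hasCompactSupport.isCompact.prod g.hasCompactSupport.isCompact
    refine hK.of_isClosed_subset (isClosed_tsupport _)
      (closure_minimal ?_ ((isClosed_tsupport _).prod (isClosed_tsupport _)))
    intro p hp
    exact ⟨subset_tsupport _ (left_ne_zero_of_mul hp), subset_tsupport _ (right_ne_zero_of_mul hp)⟩

@[simp]
theorem externalMul_apply (f : C_c(X, ℤ)) (g : C_c(Y, ℤ)) (p : X × Y) :
    externalMul f g p = f p.1 * g p.2 := rfl

/-- The map `C_c(X, ℤ) ⊗ C_c(Y, ℤ) → C_c(X × Y, ℤ)`. -/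
noncomputable def externalProduct (X Y : Type) [TopologicalSpace X] [TopologicalSpace Y] :
    C_c(X, ℤ) ⊗[ℤ] C_c(Y, ℤ) →ₗ[ℤ] C_c(X × Y, ℤ) :=
  TensorProduct.lift <| LinearMap.mk₂ ℤ externalMul
    (fun _ _ _ => CompactlySupportedContinuousMap.ext fun _ => add_mul _ _ _)
    (fun _ _ _ => CompactlySupportedContinuousMap.ext fun _ => mul_assoc _ _ _)
    (fun _ _ _ => CompactlySupportedContinuousMap.ext fun _ => mul_add _ _ _)
    (fun _ _ _ => CompactlySupportedContinuousMap.ext fun _ => mul_left_comm _ _ _)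

@[simp]
theorem externalProduct_tmul (f : C_c(X, ℤ)) (g : C_c(Y, ℤ)) :
    externalProduct X Y (f ⊗ₜ g) = externalMul f g := rfl

/-- The first factors of a given tensor lie in a finitely generated subgroup `M`, which is free. In
a basis the tensor is `∑ bᵢ ⊗ nᵢ`; if its image vanishes, then for each `y` so does `∑ nᵢ(y) bᵢ`,
hence every `nᵢ(y)`. -/
theorem externalProduct_injective : Function.Injective (externalProduct X Y) := by
  rw [injective_iff_map_eq_zero]
  intro t ht
  obtain ⟨M, hM, hMt⟩ := TensorProduct.exists_finite_submodule_left_of_setFinite {t}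
    (Set.finite_singleton t)
  obtain ⟨t, rfl⟩ := hMt rfl
  have : Module.Projective ℤ M := .submodule M
  have : Module.Free ℤ M := inferInstance
  let b := Module.Free.chooseBasis ℤ M
  obtain ⟨n, hn⟩ := TensorProduct.eq_repr_basis_left b t
  rw [← hn, Finsupp.sum] at ht ⊢
  suffices h : ∀ i, n i = 0 by simp [h]
  intro i
  ext y
  have h0 : ∑ i ∈ n.support, n i y • b i = 0 := by
    apply Subtype.ext
    ext x
    have := DFunLike.congr_fun ht (x, y)
    simpa [mul_comm] using this
  by_cases hi : i ∈ n.support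
  · exact linearIndependent_iff'.1 b.linearIndependent _ _ h0 i hi
  · rw [Finsupp.notMem_support_iff.1 hi]

/-- The function `F (x, ·)`. -/
def CompactlySupportedContinuousMap.curryLeft [T2Space Y] (F : C_c(X × Y, ℤ)) (x : X) :
    C_c(Y, ℤ) where
  toFun y := F (x, y)
  continuous_toFun := (map_continuous F).comp (by fun_prop)
  hasCompactSupport' := by
    refine HasCompactSupport.intro (F.hasCompactSupport.isCompact.image continuous_snd) ?_
    intro y hy
    by_contra h
    exact hy ⟨(x, y), subset_tsupport _ h, rfl⟩

theorem CompactlySupportedContinuousMap.curryLeft_apply [T2Space Y] (F : C_c(X × Y, ℤ)) (x : X)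
    (y : Y) : F.curryLeft x y = F (x, y) := rfl

/-- The set where `F (x, y) = F (x₀, y)` is open and contains `{x₀} × L` for the compact projection
`L` of the support to `Y`. The tube lemma makes a neighbourhood of `x₀` uniform over `L`; outside
`L` both sides are zero. -/
theorem isLocallyConstant_curryLeft [T2Space Y] (F : C_c(X × Y, ℤ)) :
    IsLocallyConstant F.curryLeft := by
  rw [IsLocallyConstant.iff_eventually_eq]
  intro x₀
  have hL : IsCompact (Prod.snd '' tsupport F) :=
    F.hasCompactSupport.isCompact.image continuous_snd
  have hO : IsOpen {p : X × Y | F p = F (x₀, p.2)} := by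
    have h : Continuous fun p : X × Y => F p - F (x₀, p.2) :=
      (map_continuous F).sub ((map_continuous F).comp (by fun_prop))
    convert (isOpen_discrete ({0} : Set ℤ)).preimage h using 1
    ext p
    exact sub_eq_zero.symm
  obtain ⟨u, v, hu, -, hxu, hLv, huv⟩ := generalized_tube_lemma (isCompact_singleton (x := x₀)) hL hO
    (by rintro ⟨x, y⟩ ⟨rfl, -⟩; rfl)
  filter_upwards [hu.mem_nhds (hxu rfl)] with x hx
  ext y
  rw [CompactlySupportedContinuousMap.curryLeft_apply,
    CompactlySupportedContinuousMap.curryLeft_apply]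
  by_cases hy : y ∈ Prod.snd '' tsupport F
  · exact huv (Set.mk_mem_prod hx (hLv hy))
  · have h0 : ∀ x, F (x, y) = 0 := fun x => by
      by_contra h
      exact hy ⟨(x, y), subset_tsupport _ h, rfl⟩
    rw [h0, h0]

/-- The map `x ↦ F (x, ·)` is locally constant and takes finitely many values on the compact
projection of the support. Hence `F` is the finite sum of (indicator of the set where the value is
`v`) ⊗ `v`. -/
theorem externalProduct_surjective [T2Space X] [T2Space Y] :
    Function.Surjective (externalProduct X Y) := by
  classical
  intro F
  have hφ := isLocallyConstant_curryLeft F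
  have hK : IsCompact (Prod.fst '' tsupport F) :=
    F.hasCompactSupport.isCompact.image continuous_fst
  have hφK : ∀ x, F.curryLeft x ≠ 0 → x ∈ Prod.fst '' tsupport F := fun x hx => by
    by_contra h
    refine hx (CompactlySupportedContinuousMap.ext fun y => ?_)
    by_contra h'
    exact h ⟨(x, y), subset_tsupport _ h', rfl⟩
  have hfin : (F.curryLeft '' (Prod.fst '' tsupport F)).Finite := by
    -- With the discrete topology on the target, the image of a compact set is compact and hence
    -- finite.
    let _ : TopologicalSpace C_c(Y, ℤ) := ⊥
    have : DiscreteTopology C_c(Y, ℤ) := ⟨rfl⟩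
    exact (hK.image hφ.continuous).finite_of_discrete
  let ind : C_c(Y, ℤ) → C_c(X, ℤ) := fun v =>
    -- The level set of the value `0` need not have compact closure; it contributes nothing and is
    -- left out.
    if hv : v = 0 then 0 else
    { toFun := fun x => if F.curryLeft x = v then 1 else 0
      continuous_toFun := (hφ.comp fun w => if w = v then (1 : ℤ) else 0).continuous
      hasCompactSupport' := by
        refine HasCompactSupport.intro hK fun x hx => if_neg ?_
        rintro rfl
        exact hx (hφK x hv) }
  have hind : ∀ v, v ≠ 0 → ∀ x, ind v x = if F.curryLeft x = v then 1 else 0 := fun v hv x => by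
    simp only [ind, dif_neg hv]; rfl
  refine ⟨∑ v ∈ hfin.toFinset, ind v ⊗ₜ v, ?_⟩
  ext ⟨x, y⟩
  rw [map_sum, CompactlySupportedContinuousMap.sum_apply]
  simp only [externalProduct_tmul, externalMul_apply]
  have h1 : ∀ v, ind v x * v y = if F.curryLeft x = v then v y else 0 := fun v => by
    by_cases hv : v = 0
    · subst hv; simp
    · rw [hind v hv, ite_mul, one_mul, zero_mul]
  simp only [h1]
  rw [Finset.sum_ite_eq]
  split_ifs with h
  · rfl
  · by_contra h'
    refine h (hfin.mem_toFinset.2 ⟨x, hφK x fun h0 => h' ?_, rfl⟩)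
    exact (DFunLike.congr_fun h0 y).symm

/-- Fibres of a product map are products of fibres, so the finite sum over a fibre factors. -/
theorem pushforward_externalMul [T2Space X] [T2Space Y] [T2Space X'] [T2Space Y'] {π : X → X'}
    {ρ : Y → Y'} (hπ : IsLocalHomeomorph π) (hρ : IsLocalHomeomorph ρ)
    (h : IsLocalHomeomorph (Prod.map π ρ)) (f : C_c(X, ℤ)) (g : C_c(Y, ℤ)) :
    pushforward (Prod.map π ρ) h (externalMul f g) =
      externalMul (pushforward π hπ f) (pushforward ρ hρ g) := by
  classical
  ext ⟨x', y'⟩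
  have hf := finite_fiber_inter_support hπ f x'
  have hg := finite_fiber_inter_support hρ g y'
  have h1 : pushforward π hπ f x' = ∑ x ∈ hf.toFinset, f x := by
    rw [pushforward_apply]
    apply finsum_mem_eq_sum_of_inter_support_eq
    ext x
    simp
  have h2 : pushforward ρ hρ g y' = ∑ y ∈ hg.toFinset, g y := by
    rw [pushforward_apply]
    apply finsum_mem_eq_sum_of_inter_support_eq
    ext x
    simp
  rw [externalMul_apply, h1, h2, Finset.sum_mul_sum, ← Finset.sum_product', pushforward_apply]
  apply finsum_mem_eq_sum_of_inter_support_eq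
  ext ⟨x, y⟩
  simp [Prod.ext_iff]
  tauto

end CompactlySupported

/-! ### The nerve of a product groupoid -/

namespace EtaleGroupoid

open scoped TensorProduct

variable (G H : EtaleGroupoid)

/-- The nerve of a product is the product of the nerves. -/
def nerveProd (n : ℕ) : G.Nerve n × H.Nerve n ≃ₜ (prod G H).Nerve n where
  toFun x :=
    { vert := fun i => (x.1.vert i, x.2.vert i)
      arr := fun p => (x.1.arr p, x.2.arr p)
      r_arr := fun p => Prod.ext (x.1.r_arr p) (x.2.r_arr p)
      s_arr := fun p => Prod.ext (x.1.s_arr p) (x.2.s_arr p)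
      arr_self := fun i => Prod.ext (x.1.arr_self i) (x.2.arr_self i)
      arr_mul := fun i j k hij hjk =>
        Prod.ext (x.1.arr_mul i j k hij hjk) (x.2.arr_mul i j k hij hjk) }
  invFun x :=
    ({ vert := fun i => (x.vert i).1
       arr := fun p => (x.arr p).1
       r_arr := fun p => congrArg Prod.fst (x.r_arr p)
       s_arr := fun p => congrArg Prod.fst (x.s_arr p)
       arr_self := fun i => congrArg Prod.fst (x.arr_self i)
       arr_mul := fun i j k hij hjk => congrArg Prod.fst (x.arr_mul i j k hij hjk) },
     { vert := fun i => (x.vert i).2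
       arr := fun p => (x.arr p).2
       r_arr := fun p => congrArg Prod.snd (x.r_arr p)
       s_arr := fun p => congrArg Prod.snd (x.s_arr p)
       arr_self := fun i => congrArg Prod.snd (x.arr_self i)
       arr_mul := fun i j k hij hjk => congrArg Prod.snd (x.arr_mul i j k hij hjk) })
  left_inv _ := rfl
  right_inv _ := rfl
  continuous_toFun := Nerve.isEmbedding.continuous_iff.2 <|
    (continuous_pi fun i => ((Nerve.continuous_vert i).comp continuous_fst).prodMk
      ((Nerve.continuous_vert i).comp continuous_snd)).prodMk
    (continuous_pi fun i => ((Nerve.continuous_arr i).comp continuous_fst).prodMk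
      ((Nerve.continuous_arr i).comp continuous_snd))
  continuous_invFun := by
    refine Continuous.prodMk ?_ ?_
    · exact Nerve.isEmbedding.continuous_iff.2 <|
        (continuous_pi fun i => continuous_fst.comp (Nerve.continuous_vert i)).prodMk
          (continuous_pi fun p => continuous_fst.comp (Nerve.continuous_arr p))
    · exact Nerve.isEmbedding.continuous_iff.2 <|
        (continuous_pi fun i => continuous_snd.comp (Nerve.continuous_vert i)).prodMk
          (continuous_pi fun p => continuous_snd.comp (Nerve.continuous_arr p))

theorem bijective_pushforward {X Y : Type} [TopologicalSpace X] [TopologicalSpace Y] [T2Space X]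
    [T2Space Y] (e : X ≃ₜ Y) : Function.Bijective (pushforward e e.isLocalHomeomorph) := by
  have h1 := pushforward_comp e.isLocalHomeomorph e.symm.isLocalHomeomorph
    (e.symm.isLocalHomeomorph.comp e.isLocalHomeomorph)
  have h2 := pushforward_comp e.symm.isLocalHomeomorph e.isLocalHomeomorph
    (e.isLocalHomeomorph.comp e.symm.isLocalHomeomorph)
  simp only [e.symm_comp_self, e.self_comp_symm, pushforward_id] at h1 h2
  exact Function.bijective_iff_has_inverse.2
    ⟨_, fun x => (LinearMap.congr_fun h1 x).symm, fun x => (LinearMap.congr_fun h2 x).symm⟩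

/-- The identification of `C_c(G⁽ⁿ⁾, ℤ) ⊗ C_c(H⁽ⁿ⁾, ℤ)` with `C_c((G × H)⁽ⁿ⁾, ℤ)`. -/
noncomputable def nerveTensor (n : ℕ) :
    C_c(G.Nerve n, ℤ) ⊗[ℤ] C_c(H.Nerve n, ℤ) →ₗ[ℤ] C_c((prod G H).Nerve n, ℤ) :=
  pushforward (nerveProd G H n) (nerveProd G H n).isLocalHomeomorph ∘ₗ externalProduct _ _

theorem nerveTensor_bijective (n : ℕ) : Function.Bijective (nerveTensor G H n) :=
  (bijective_pushforward _).comp ⟨externalProduct_injective, externalProduct_surjective⟩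

-- Stated for any compatible triple of local homeomorphisms, so that it serves both for the
-- simplicial structure maps and for morphisms of groupoids.
variable {G H} in
theorem nerveTensor_pushforward {G' H' : EtaleGroupoid} {n m : ℕ} {π : G.Nerve n → G'.Nerve m}
    {ρ : H.Nerve n → H'.Nerve m} {τ : (prod G H).Nerve n → (prod G' H').Nerve m}
    (hπ : IsLocalHomeomorph π) (hρ : IsLocalHomeomorph ρ) (hτ : IsLocalHomeomorph τ)
    (h : τ ∘ nerveProd G H n = nerveProd G' H' m ∘ Prod.map π ρ)
    (f : C_c(G.Nerve n, ℤ)) (g : C_c(H.Nerve n, ℤ)) :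
    pushforward τ hτ (nerveTensor G H n (f ⊗ₜ g)) =
      nerveTensor G' H' m (pushforward π hπ f ⊗ₜ pushforward ρ hρ g) := by
  have hπρ := isLocalHomeomorph_prodMap hπ hρ
  have h1 := pushforward_comp (nerveProd G H n).isLocalHomeomorph hτ
    (hτ.comp (nerveProd G H n).isLocalHomeomorph)
  have h2 := pushforward_comp hπρ (nerveProd G' H' m).isLocalHomeomorph
    ((nerveProd G' H' m).isLocalHomeomorph.comp hπρ)
  simp only [h] at h1
  have h3 := LinearMap.congr_fun (h1.symm.trans h2) (externalMul f g)
  simp only [LinearMap.comp_apply, pushforward_externalMul hπ hρ hπρ] at h3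
  exact h3

/-- The simplicial module of a product is the diagonal of a bisimplicial module. -/
noncomputable def simplicialModuleProdIso :
    Bisimplicial.diag (Bisimplicial.outer (simplicialModule G) (simplicialModule H)) ≅
      simplicialModule (prod G H) :=
  NatIso.ofComponents
    (fun Δ => (LinearEquiv.ofBijective _ (nerveTensor_bijective G H Δ.unop.len)).toModuleIso)
    (fun {Δ Δ'} θ => by
      refine ModuleCat.MonoidalCategory.tensor_ext (R := ℤ) fun f g => ?_
      exact (nerveTensor_pushforward (Nerve.isLocalHomeomorph_pull θ.unop.toOrderHom)
        (Nerve.isLocalHomeomorph_pull θ.unop.toOrderHom)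
        (Nerve.isLocalHomeomorph_pull θ.unop.toOrderHom) rfl f g).symm)

variable {G H} in
theorem simplicialModuleProdIso_naturality {G' H' : EtaleGroupoid} (φ : G ⟶ G') (ψ : H ⟶ H') :
    Bisimplicial.diagMap (Functor.whiskerRight (NatTrans.prod (simplicialModuleFunctor.map φ)
        (simplicialModuleFunctor.map ψ)) (tensor (ModuleCat.{0} ℤ))) ≫
        (simplicialModuleProdIso G' H').hom =
      (simplicialModuleProdIso G H).hom ≫
        simplicialModuleFunctor.map (prodFunctor.map (X := (G, H)) (Y := (G', H')) (φ, ψ)) := by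
  refine NatTrans.ext (funext fun Δ => ?_)
  refine ModuleCat.MonoidalCategory.tensor_ext (R := ℤ) fun f g => ?_
  exact (nerveTensor_pushforward (Hom.isLocalHomeomorph_nerve φ Δ.unop.len)
    (Hom.isLocalHomeomorph_nerve ψ Δ.unop.len)
    (Hom.isLocalHomeomorph_nerve (prodFunctor.map (X := (G, H)) (Y := (G', H')) (φ, ψ))
      Δ.unop.len) rfl f g).symm

end EtaleGroupoid

/-! ### `Tor` from a resolution of length one -/

/-- A projective resolution `0 → B → Z → Y → 0` of length one. -/
structure ShortResolution {R : Type} [CommRing R] (Y : ModuleCat.{0} R) where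
  B : ModuleCat.{0} R
  Z : ModuleCat.{0} R
  i : B ⟶ Z
  p : Z ⟶ Y
  projective_B : Module.Projective R B
  projective_Z : Module.Projective R Z
  injective_i : Function.Injective i
  surjective_p : Function.Surjective p
  p_eq_zero_iff : ∀ z, p z = 0 ↔ ∃ b, i b = z

namespace ShortResolution

open ChainComplex

variable {R : Type} [CommRing R] {X X' Y Y' : ModuleCat.{0} R} (S : ShortResolution Y)
  (S' : ShortResolution Y')

/-- The modules in a short resolution. -/
def objs : ℕ → ModuleCat.{0} R
  | 0 => S.Z
  | 1 => S.B
  | _ + 2 => ModuleCat.of R PUnit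

/-- The maps in a short resolution. -/
def maps : ∀ n, S.objs (n + 1) ⟶ S.objs n
  | 0 => S.i
  | _ + 1 => 0

/-- A short resolution as a chain complex. -/
noncomputable def complex : ChainComplex (ModuleCat.{0} R) ℕ :=
  ChainComplex.of S.objs S.maps fun _ => zero_comp

theorem complex_d (n : ℕ) : S.complex.d (n + 1) n = S.maps n := ChainComplex.of_d _ _ _

theorem complex_d_one_zero : S.complex.d 1 0 = S.i := S.complex_d 0

theorem i_comp_p : S.i ≫ S.p = 0 := by
  ext b
  exact (S.p_eq_zero_iff _).2 ⟨b, rfl⟩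

/-- The augmentation of a short resolution. -/
noncomputable def augmentation : S.complex ⟶ (ChainComplex.single₀ (ModuleCat.{0} R)).obj Y :=
  (ChainComplex.toSingle₀Equiv _ _).symm ⟨S.p, by rw [complex_d_one_zero]; exact S.i_comp_p⟩

theorem augmentation_f_zero : S.augmentation.f 0 = S.p :=
  ChainComplex.toSingle₀Equiv_symm_apply_f_zero _ _

theorem subsingleton_single (n : ℕ) :
    Subsingleton (((ChainComplex.single₀ (ModuleCat.{0} R)).obj Y).X (n + 1)) :=
  ModuleCat.subsingleton_of_isZero
    (HomologicalComplex.isZero_single_obj_X (ComplexShape.down ℕ) 0 Y (n + 1) (by omega))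

/-- Exactness of the cone is surjectivity of `p` in degree `0`, exactness at `Z` in degree `1` and
injectivity of `i` in degree `2`; above that the modules are zero. -/
instance : QuasiIso S.augmentation := by
  have key : ∀ n, ConeExact S.augmentation n := by
    intro n b a ha hab
    match n, b, a, ha, hab with
    | 0, b, a, ha, hab =>
      obtain ⟨z, hz⟩ := S.surjective_p b
      refine ⟨z, 0, fun m h => absurd h (by omega), ?_⟩
      rw [map_zero, add_zero, augmentation_f_zero]
      exact hz.symm
    | 1, b, a, ha, hab =>
      have h1 : S.p (a 0 rfl) = 0 := by
        rw [← augmentation_f_zero]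
        exact (hab 0 rfl).trans (by rw [HomologicalComplex.single_obj_d]; rfl)
      obtain ⟨c, hc⟩ := (S.p_eq_zero_iff _).1 h1
      have := subsingleton_single (Y := Y) 0
      refine ⟨c, 0, fun m h => ?_, Subsingleton.elim _ _⟩
      obtain rfl := Nat.succ.inj h
      rw [complex_d_one_zero]
      exact hc
    | 2, b, a, ha, hab =>
      have h1 : S.i (a 1 rfl) = S.i 0 := by
        rw [← complex_d_one_zero, map_zero]
        exact mem_cyc_succ.1 (ha 1 rfl)
      have := subsingleton_single (Y := Y) 1
      refine ⟨0, 0, fun m h => ?_, Subsingleton.elim _ _⟩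
      obtain rfl := Nat.succ.inj h
      rw [map_zero]
      exact (S.injective_i h1).symm
    | n + 3, b, a, ha, hab =>
      have := subsingleton_single (Y := Y) (n + 2)
      refine ⟨0, 0, fun m h => ?_, Subsingleton.elim _ _⟩
      obtain rfl := Nat.succ.inj h
      exact (Subsingleton.elim (α := PUnit) _ _)
  rw [quasiIso_iff]
  intro n
  rw [quasiIsoAt_iff_isIso_homologyMap]
  exact (ConcreteCategory.isIso_iff_bijective _).2 (bijective_of_coneExact _ key n)

/-- A short resolution as a projective resolution. -/
noncomputable def projectiveResolution : ProjectiveResolution Y where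
  complex := S.complex
  projective n := by
    rw [← IsProjective.iff_projective]
    match n with
    | 0 => exact S.projective_Z
    | 1 => exact S.projective_B
    | n + 2 => exact inferInstanceAs (Module.Projective R PUnit)
  π := S.augmentation

/-- The complex computing `Tor`. -/
noncomputable abbrev tensorComplex (X : ModuleCat.{0} R) : ChainComplex (ModuleCat.{0} R) ℕ :=
  (((tensoringLeft (ModuleCat.{0} R)).obj X).mapHomologicalComplex _).obj S.complex

theorem tensorComplex_d_one_zero (X : ModuleCat.{0} R) :
    (S.tensorComplex X).d 1 0 = X ◁ S.i :=
  congrArg (fun f => X ◁ f) S.complex_d_one_zero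

theorem mem_cyc_tensorComplex (X : ModuleCat.{0} R) (t : (X ⊗ S.B : ModuleCat.{0} R)) :
    t ∈ cyc (S.tensorComplex X) 1 ↔ (X ◁ S.i) t = 0 := by
  rw [← tensorComplex_d_one_zero]
  exact mem_cyc_succ

/-- The differential into degree `1` is zero, so a cycle there is determined by its class. -/
theorem cls_tensorComplex_injective (X : ModuleCat.{0} R) :
    Function.Injective (cls (S.tensorComplex X) 1) := by
  rw [injective_iff_map_eq_zero]
  intro z hz
  obtain ⟨w, hw⟩ := (cls_eq_zero_iff z).1 hz
  apply Subtype.ext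
  rw [← hw]
  have : (S.tensorComplex X).d (1 + 1) 1 = 0 :=
    (congrArg (fun f => X ◁ f) (S.complex_d 1)).trans MonoidalPreadditive.whiskerLeft_zero
  rw [this]
  rfl

/-- `Tor₁ X Y` is the kernel of `X ⊗ B → X ⊗ Z`. -/
noncomputable def torEquiv (X : ModuleCat.{0} R) :
    cyc (S.tensorComplex X) 1 ≃ₗ[R] ((Tor (ModuleCat.{0} R) 1).obj X).obj Y :=
  (LinearEquiv.ofBijective _ ⟨S.cls_tensorComplex_injective X, cls_surjective 1⟩).trans
    (S.projectiveResolution.isoLeftDerivedObj ((tensoringLeft _).obj X) 1).symm.toLinearEquiv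

variable {S S'} in
/-- A morphism of short resolutions as a chain map. -/
noncomputable def complexMap (b : S.B ⟶ S'.B) (z : S.Z ⟶ S'.Z) (h : S.i ≫ z = b ≫ S'.i) :
    S.complex ⟶ S'.complex where
  f
    | 0 => z
    | 1 => b
    | _ + 2 => 𝟙 _
  comm' := by
    rintro _ n rfl
    match n with
    | 0 =>
      exact (congrArg (b ≫ ·) S'.complex_d_one_zero).trans
        (h.symm.trans (congrArg (· ≫ z) S.complex_d_one_zero).symm)
    | n + 1 =>
      exact ((congrArg (𝟙 _ ≫ ·) (S'.complex_d (n + 1))).trans comp_zero).trans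
        ((congrArg (· ≫ _) (S.complex_d (n + 1))).trans zero_comp).symm

variable {S S'} in
theorem map_mem_cyc_tensorComplex {b : S.B ⟶ S'.B} {z : S.Z ⟶ S'.Z} (h : S.i ≫ z = b ≫ S'.i)
    (f : X ⟶ X') {x : (X ⊗ S.B : ModuleCat.{0} R)} (hx : x ∈ cyc (S.tensorComplex X) 1) :
    (f ⊗ₘ b) x ∈ cyc (S'.tensorComplex X') 1 := by
  rw [mem_cyc_tensorComplex] at hx ⊢
  rw [← ConcreteCategory.comp_apply]
  have : (f ⊗ₘ b) ≫ X' ◁ S'.i = X ◁ S.i ≫ (f ⊗ₘ z) := by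
    rw [← id_tensorHom, ← id_tensorHom, tensorHom_comp_tensorHom, tensorHom_comp_tensorHom, h]
    simp
  rw [this, ConcreteCategory.comp_apply, hx, map_zero]

variable {S} in
theorem torEquiv_naturality_left (f : X ⟶ X') (x : (X ⊗ S.B : ModuleCat.{0} R))
    (hx : x ∈ cyc (S.tensorComplex X) 1) (hx' : (f ▷ S.B) x ∈ cyc (S.tensorComplex X') 1) :
    ((Tor (ModuleCat.{0} R) 1).map f).app Y (S.torEquiv X ⟨x, hx⟩) =
      S.torEquiv X' ⟨(f ▷ S.B) x, hx'⟩ := by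
  have h1 := ProjectiveResolution.leftDerived_app_eq ((tensoringLeft (ModuleCat.{0} R)).map f)
    S.projectiveResolution 1
  have h2 := homologyMap_cls ((NatTrans.mapHomologicalComplex
    ((tensoringLeft (ModuleCat.{0} R)).map f) (ComplexShape.down ℕ)).app S.complex)
    (n := 1) ⟨x, hx⟩
  have h3 := ConcreteCategory.congr_hom (S.projectiveResolution.isoLeftDerivedObj
    ((tensoringLeft (ModuleCat.{0} R)).obj X) 1).inv_hom_id (cls (S.tensorComplex X) 1 ⟨x, hx⟩)
  exact (ConcreteCategory.congr_hom h1 (S.torEquiv X ⟨x, hx⟩)).trans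
    (congrArg (S.projectiveResolution.isoLeftDerivedObj
      ((tensoringLeft (ModuleCat.{0} R)).obj X') 1).inv
      ((congrArg (HomologicalComplex.homologyMap ((NatTrans.mapHomologicalComplex
    ((tensoringLeft (ModuleCat.{0} R)).map f) (ComplexShape.down ℕ)).app S.complex) 1) h3).trans h2))

-- The pair `(b, z)` is a chain map of resolutions lifting `g`, and such a lift computes the derived
-- functor on `g`.
variable {S S'} in
theorem torEquiv_naturality_right {b : S.B ⟶ S'.B} {z : S.Z ⟶ S'.Z} (h : S.i ≫ z = b ≫ S'.i)
    (g : Y ⟶ Y') (hg : S.p ≫ g = z ≫ S'.p) (x : (X ⊗ S.B : ModuleCat.{0} R))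
    (hx : x ∈ cyc (S.tensorComplex X) 1) (hx' : (X ◁ b) x ∈ cyc (S'.tensorComplex X) 1) :
    ((Tor (ModuleCat.{0} R) 1).obj X).map g (S.torEquiv X ⟨x, hx⟩) =
      S'.torEquiv X ⟨(X ◁ b) x, hx'⟩ := by
  have h1 := ProjectiveResolution.isoLeftDerivedObj_inv_naturality g S.projectiveResolution
    S'.projectiveResolution (complexMap b z h) (by
      change z ≫ S'.augmentation.f 0 = S.augmentation.f 0 ≫ g
      rw [augmentation_f_zero, augmentation_f_zero]
      exact hg.symm) ((tensoringLeft (ModuleCat.{0} R)).obj X) 1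
  have h2 := homologyMap_cls ((((tensoringLeft (ModuleCat.{0} R)).obj X).mapHomologicalComplex
    (ComplexShape.down ℕ)).map (complexMap b z h)) (n := 1) ⟨x, hx⟩
  exact (ConcreteCategory.congr_hom h1 (cls (S.tensorComplex X) 1 ⟨x, hx⟩)).trans
    (congrArg (S'.projectiveResolution.isoLeftDerivedObj
      ((tensoringLeft (ModuleCat.{0} R)).obj X) 1).inv h2)

-- One variable at a time: `f ⊗ b` is `f ⊗ 1` followed by `1 ⊗ b`.
variable {S S'} in
theorem torEquiv_naturality {b : S.B ⟶ S'.B} {z : S.Z ⟶ S'.Z} (h : S.i ≫ z = b ≫ S'.i)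
    (f : X ⟶ X') (g : Y ⟶ Y') (hg : S.p ≫ g = z ≫ S'.p) (x : (X ⊗ S.B : ModuleCat.{0} R))
    (hx : x ∈ cyc (S.tensorComplex X) 1) :
    ((Tor (ModuleCat.{0} R) 1).obj X').map g (((Tor (ModuleCat.{0} R) 1).map f).app Y
      (S.torEquiv X ⟨x, hx⟩)) = S'.torEquiv X' ⟨(f ⊗ₘ b) x, map_mem_cyc_tensorComplex h f hx⟩ := by
  have hx' : (f ▷ S.B) x ∈ cyc (S.tensorComplex X') 1 := by
    rw [← tensorHom_id]
    exact map_mem_cyc_tensorComplex (S := S) (S' := S) (z := 𝟙 _) (by simp) f hx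
  have e : (f ⊗ₘ b) x = (X' ◁ b) ((f ▷ S.B) x) := by
    rw [← ConcreteCategory.comp_apply, ← MonoidalCategory.tensorHom_def]
  have hx'' : (X' ◁ b) ((f ▷ S.B) x) ∈ cyc (S'.tensorComplex X') 1 :=
    e ▸ map_mem_cyc_tensorComplex h f hx
  refine (congrArg (((Tor (ModuleCat.{0} R) 1).obj X').map g)
    (torEquiv_naturality_left f x hx hx')).trans ?_
  refine (torEquiv_naturality_right h g hg _ hx' hx'').trans ?_
  exact congrArg (S'.torEquiv X') (Subtype.ext e.symm)

end ShortResolution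

/-! ### Descent along surjections, retractions and kernels in tensor products -/

section LinearAlgebra

open TensorProduct

variable {R M N P : Type} [CommRing R] [AddCommGroup M] [Module R M] [AddCommGroup N] [Module R N]
  [AddCommGroup P] [Module R P]

/-- The map induced on the target of a surjection. -/
noncomputable def LinearMap.descend (π : M →ₗ[R] N) (hπ : Function.Surjective π) (f : M →ₗ[R] P)
    (h : ∀ x, π x = 0 → f x = 0) : N →ₗ[R] P :=
  (LinearMap.ker π).liftQ f h ∘ₗ (π.quotKerEquivOfSurjective hπ).symm.toLinearMap

@[simp]
theorem LinearMap.descend_apply (π : M →ₗ[R] N) (hπ : Function.Surjective π) (f : M →ₗ[R] P)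
    (h : ∀ x, π x = 0 → f x = 0) (x : M) : π.descend hπ f h (π x) = f x := by
  have : (π.quotKerEquivOfSurjective hπ).symm (π x) = (LinearMap.ker π).mkQ x := by
    rw [LinearEquiv.symm_apply_eq]
    rfl
  rw [LinearMap.descend, LinearMap.comp_apply, LinearEquiv.coe_coe, this]
  rfl

/-- Over a principal ideal domain, the kernel of a map to a projective module is a direct
summand. -/
theorem LinearMap.exists_retraction_ker [IsDomain R] [IsPrincipalIdealRing R] (f : M →ₗ[R] N)
    [Module.Projective R N] : ∃ r : M →ₗ[R] LinearMap.ker f, ∀ z : LinearMap.ker f, r z = z := by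
  have : Module.Projective R (LinearMap.range f) := .submodule _
  -- The range is projective as a submodule of `N`, so `M → range f` has a section `s`; then `id - s
  -- ∘ f` is the retraction.
  obtain ⟨s, hs⟩ := f.rangeRestrict.exists_rightInverse_of_surjective f.range_rangeRestrict
  have hs' : ∀ x, f (s (f.rangeRestrict x)) = f x := fun x =>
    congrArg Subtype.val (LinearMap.congr_fun hs (f.rangeRestrict x))
  refine ⟨(LinearMap.id - s ∘ₗ f.rangeRestrict).codRestrict _ fun x => ?_, fun z => ?_⟩
  rotate_left
  · rw [LinearMap.mem_ker, LinearMap.sub_apply, map_sub, sub_eq_zero]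
    exact (hs' x).symm
  · apply Subtype.ext
    have : f.rangeRestrict z = 0 := Subtype.ext z.2
    simp [this]

theorem TensorProduct.exists_of_lTensor_eq_zero [Module.Flat R M] (g : N →ₗ[R] P)
    {t : M ⊗[R] N} (ht : g.lTensor M t = 0) :
    ∃ u : M ⊗[R] LinearMap.ker g, (LinearMap.ker g).subtype.lTensor M u = t :=
  (Module.Flat.lTensor_exact M (LinearMap.exact_subtype_ker_map g) t).1 ht

theorem TensorProduct.exists_of_rTensor_eq_zero [Module.Flat R M] (g : N →ₗ[R] P)
    {t : N ⊗[R] M} (ht : g.rTensor M t = 0) :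
    ∃ u : LinearMap.ker g ⊗[R] M, (LinearMap.ker g).subtype.rTensor M u = t :=
  (Module.Flat.rTensor_exact M (LinearMap.exact_subtype_ker_map g) t).1 ht

/-- Flatness of `M` first puts `t` into `M ⊗ ker g`. Its image in `M' ⊗ ker g` vanishes because that
module injects into `M' ⊗ N'`'s counterpart `M' ⊗ N`, and flatness of `ker g` then gives an element
of `ker f ⊗ ker g`. -/
theorem TensorProduct.exists_of_rTensor_lTensor_eq_zero {M' N' : Type} [AddCommGroup M']
    [Module R M'] [AddCommGroup N'] [Module R N'] [Module.Flat R M] [Module.Flat R M']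
    (f : M →ₗ[R] M') (g : N →ₗ[R] N') [Module.Flat R (LinearMap.ker g)] {t : M ⊗[R] N}
    (h₁ : f.rTensor N t = 0) (h₂ : g.lTensor M t = 0) :
    ∃ u : LinearMap.ker f ⊗[R] LinearMap.ker g,
      TensorProduct.map (LinearMap.ker f).subtype (LinearMap.ker g).subtype u = t := by
  obtain ⟨a, rfl⟩ := exists_of_lTensor_eq_zero g h₂
  have ha : f.rTensor _ a = 0 := by
    apply Module.Flat.lTensor_preserves_injective_linearMap (M := M') (LinearMap.ker g).subtype
      (Submodule.injective_subtype _)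
    rw [map_zero, ← h₁, ← LinearMap.comp_apply, ← LinearMap.comp_apply,
      LinearMap.lTensor_comp_rTensor, LinearMap.rTensor_comp_lTensor]
  obtain ⟨b, rfl⟩ := exists_of_rTensor_eq_zero f ha
  exact ⟨b, by rw [← LinearMap.comp_apply, LinearMap.lTensor_comp_rTensor]⟩

end LinearAlgebra

/-! ### Boundaries, retractions onto cycles and the resolution of homology -/

namespace ChainComplex

variable {R : Type} [CommRing R] (C : ChainComplex (ModuleCat.{0} R) ℕ)

/-- The submodule of boundaries, inside the cycles. -/
noncomputable def bnd (n : ℕ) : Submodule R (cyc C n) := LinearMap.ker (cls C n)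

/-- The differential as a map to the boundaries. -/
noncomputable def toBnd (n : ℕ) : C.X (n + 1) →ₗ[R] bnd C n :=
  ((C.d (n + 1) n).hom.codRestrict (cyc C n) (d_mem_cyc n)).codRestrict (bnd C n)
    fun x => (cls_eq_zero_iff _).2 ⟨x, rfl⟩

theorem toBnd_apply (n : ℕ) (x : C.X (n + 1)) : (toBnd C n x : C.X n) = C.d (n + 1) n x := rfl

theorem toBnd_surjective (n : ℕ) : Function.Surjective (toBnd C n) := fun x => by
  obtain ⟨w, hw⟩ := (cls_eq_zero_iff _).1 x.2
  exact ⟨w, Subtype.ext (Subtype.ext hw)⟩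

theorem toBnd_eq_zero_iff (n : ℕ) (x : C.X (n + 1)) : toBnd C n x = 0 ↔ x ∈ cyc C (n + 1) := by
  rw [mem_cyc_succ, Subtype.ext_iff, Subtype.ext_iff]
  rfl

theorem toBnd_d (n : ℕ) (x : C.X (n + 1 + 1)) : toBnd C n (C.d _ _ x) = 0 :=
  (toBnd_eq_zero_iff _ _ _).2 (d_mem_cyc _ _)

variable [IsDomain R] [IsPrincipalIdealRing R] [∀ n, Module.Projective R (C.X n)]

instance (n : ℕ) : Module.Projective R (cyc C n) := .submodule _

instance (n : ℕ) : Module.Projective R (bnd C n) := .submodule _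

theorem exists_retraction_cyc (n : ℕ) : ∃ r : C.X n →ₗ[R] cyc C n, ∀ z : cyc C n, r z = z :=
  have : Module.Projective R (C.sc n).X₃ := inferInstanceAs (Module.Projective R (C.X _))
  (C.sc n).g.hom.exists_retraction_ker

/-- A retraction to the cycles. -/
noncomputable def cycRetraction (n : ℕ) : C.X n →ₗ[R] cyc C n := (exists_retraction_cyc C n).choose

@[simp]
theorem cycRetraction_coe (n : ℕ) (z : cyc C n) : cycRetraction C n z = z :=
  (exists_retraction_cyc C n).choose_spec z

/-- An extension to all chains of the map from the cycles to the homology. -/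
noncomputable def clsExt (n : ℕ) : C.X n →ₗ[R] C.homology n := cls C n ∘ₗ cycRetraction C n

theorem clsExt_coe (n : ℕ) (z : cyc C n) : clsExt C n z = cls C n z := by
  rw [clsExt, LinearMap.comp_apply, cycRetraction_coe]

theorem clsExt_comp_subtype (n : ℕ) : clsExt C n ∘ₗ (cyc C n).subtype = cls C n :=
  LinearMap.ext (clsExt_coe C n)

/-- Boundaries are cycles, and on cycles `clsExt` is the class map. So `clsExt` is a chain map to
the homology with zero differential, which makes `β` and `ρ` well defined on classes. -/
theorem clsExt_d (n : ℕ) (x : C.X (n + 1)) : clsExt C n (C.d (n + 1) n x) = 0 := by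
  rw [← toBnd_apply, clsExt_coe]
  exact (toBnd C n x).2

theorem clsExt_comp_d (n : ℕ) : clsExt C n ∘ₗ (C.d (n + 1) n).hom = 0 :=
  LinearMap.ext (clsExt_d C n)

/-- The resolution `0 → Bₙ → Zₙ → Hₙ → 0`. -/
noncomputable def homologyResolution (n : ℕ) : ShortResolution (C.homology n) where
  B := ModuleCat.of R (bnd C n)
  Z := ModuleCat.of R (cyc C n)
  i := ModuleCat.ofHom (bnd C n).subtype
  p := ModuleCat.ofHom (cls C n)
  projective_B := inferInstanceAs (Module.Projective R (bnd C n))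
  projective_Z := inferInstanceAs (Module.Projective R (cyc C n))
  injective_i := Submodule.injective_subtype _
  surjective_p := cls_surjective n
  p_eq_zero_iff z := ⟨fun h => ⟨⟨z, h⟩, rfl⟩, by rintro ⟨b, rfl⟩; exact b.2⟩

end ChainComplex

/-! ### The tensor product of complexes and the cross product -/

namespace Kunneth

open ChainComplex DoubleComplex
open scoped TensorProduct

variable {R : Type} [CommRing R] (C D : ChainComplex (ModuleCat.{0} R) ℕ)
  {C' D' : ChainComplex (ModuleCat.{0} R) ℕ} {n m p q p' q' : ℕ}

/-- The tensor product of two complexes. -/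
noncomputable abbrev T : ChainComplex (ModuleCat.{0} R) ℕ := tot (tensorDC C D)

variable {C D}

/-- The component of bidegree `(p, q)` of an element of the tensor product of two complexes. -/
noncomputable def tcomp (h : p + q = n) : (T C D).X n →ₗ[R] C.X p ⊗[R] D.X q :=
  comp (tensorDC C D) p q h

/-- The inclusion of a component into the tensor product of two complexes. -/
noncomputable def tsingle (h : p + q = n) : C.X p ⊗[R] D.X q →ₗ[R] (T C D).X n :=
  single (tensorDC C D) p q h

theorem tcomp_d (h : n + 1 = m) (z : (T C D).X m) (hpq : p + q = n) :
    tcomp hpq ((T C D).d m n z) =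
      (C.d (p + 1) p).hom.rTensor (D.X q) (tcomp (p := p + 1) (q := q) (by omega) z) +
      ((-1 : ℤ) ^ p) • (D.d (q + 1) q).hom.lTensor (C.X p)
        (tcomp (p := p) (q := q + 1) (by omega) z) :=
  comp_d h z p q hpq

@[simp]
theorem tcomp_tsingle (h h' : p + q = n) (t : C.X p ⊗[R] D.X q) :
    tcomp h (tsingle h' t) = t :=
  comp_single (K := tensorDC C D) p q h h' t

theorem tcomp_tsingle_of_ne (h : p + q = n) (t : C.X p ⊗[R] D.X q) (h' : p' + q' = n)
    (hq : q' ≠ q) : tcomp h' (tsingle h t) = 0 :=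
  comp_single_of_ne (K := tensorDC C D) h t h' hq

theorem t_ext {z w : (T C D).X n} (h : ∀ p q (h : p + q = n), tcomp h z = tcomp h w) : z = w :=
  tot_ext h

theorem sum_tsingle_tcomp (z : (T C D).X n) :
    ∑ x : Finset.HasAntidiagonal.antidiagonal n, tsingle (Finset.HasAntidiagonal.mem_antidiagonal.1 x.2)
      (tcomp (Finset.HasAntidiagonal.mem_antidiagonal.1 x.2) z) = z := by
  refine t_ext fun p q h => ?_
  rw [map_sum, Finset.sum_eq_single ⟨(p, q), Finset.HasAntidiagonal.mem_antidiagonal.2 h⟩]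
  · exact tcomp_tsingle _ _ _
  · rintro ⟨⟨p', q'⟩, h'⟩ - hne
    have h'' := Finset.HasAntidiagonal.mem_antidiagonal.1 h'
    refine tcomp_tsingle_of_ne _ _ _ fun hq => hne ?_
    subst hq
    obtain rfl : p' = p := by dsimp only at h''; omega
    rfl
  · exact fun h => absurd (Finset.mem_univ _) h

/-- The condition on `t` removes the horizontal part of the differential; for `p = 0` it is empty,
as there is no horizontal part. -/
theorem d_tsingle_right (h : p + q = n) (h' : p + (q + 1) = m) (t : C.X p ⊗[R] D.X (q + 1))
    (ht : ∀ k, k + 1 = p → (C.d p k).hom.rTensor _ t = 0) :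
    (T C D).d m n (tsingle h' t) =
      ((-1 : ℤ) ^ p) • tsingle h ((D.d (q + 1) q).hom.lTensor (C.X p) t) := by
  refine t_ext fun a b hab => ?_
  rw [tcomp_d (by omega), map_zsmul]
  have h1 : (C.d (a + 1) a).hom.rTensor (D.X b)
      (tcomp (p := a + 1) (q := b) (by omega) (tsingle h' t)) = 0 := by
    by_cases hb : b = q + 1
    · subst hb
      obtain rfl : p = a + 1 := by omega
      rw [tcomp_tsingle, ht a rfl]
    · rw [tcomp_tsingle_of_ne _ _ _ hb, map_zero]
  rw [h1, zero_add]
  by_cases hb : b = q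
  · subst hb
    obtain rfl : p = a := by omega
    rw [tcomp_tsingle, tcomp_tsingle]
  · rw [tcomp_tsingle_of_ne _ _ _ hb, tcomp_tsingle_of_ne _ _ _ (by omega), map_zero, smul_zero,
      smul_zero]

theorem d_tsingle_left (h : p + q = n) (h' : p + 1 + q = m) (t : C.X (p + 1) ⊗[R] D.X q)
    (ht : ∀ k, k + 1 = q → (D.d q k).hom.lTensor _ t = 0) :
    (T C D).d m n (tsingle h' t) = tsingle h ((C.d (p + 1) p).hom.rTensor (D.X q) t) := by
  refine t_ext fun a b hab => ?_
  rw [tcomp_d (by omega)]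
  have h1 : (D.d (b + 1) b).hom.lTensor (C.X a)
      (tcomp (p := a) (q := b + 1) (by omega) (tsingle h' t)) = 0 := by
    by_cases hb : q = b + 1
    · subst hb
      obtain rfl : a = p + 1 := by omega
      rw [tcomp_tsingle, ht b rfl]
    · rw [tcomp_tsingle_of_ne _ _ _ (Ne.symm hb), map_zero]
  rw [h1, smul_zero, add_zero]
  by_cases hb : b = q
  · subst hb
    obtain rfl : p = a := by omega
    rw [tcomp_tsingle, tcomp_tsingle]
  · rw [tcomp_tsingle_of_ne _ _ _ hb, tcomp_tsingle_of_ne _ _ _ hb, map_zero]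

theorem tsingle_mem_cyc (h : p + q = n) (t : C.X p ⊗[R] D.X q)
    (h₁ : ∀ k, k + 1 = p → (C.d p k).hom.rTensor _ t = 0)
    (h₂ : ∀ k, k + 1 = q → (D.d q k).hom.lTensor _ t = 0) : tsingle h t ∈ cyc (T C D) n := by
  rw [mem_cyc]
  intro m hm
  refine t_ext fun a b hab => ?_
  rw [tcomp_d hm, map_zero]
  by_cases hb : b = q
  · subst hb
    obtain rfl : p = a + 1 := by omega
    rw [tcomp_tsingle, h₁ a rfl, tcomp_tsingle_of_ne _ _ _ (by omega), map_zero, smul_zero,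
      add_zero]
  · rw [tcomp_tsingle_of_ne _ _ _ hb, map_zero, zero_add]
    by_cases hb' : q = b + 1
    · subst hb'
      obtain rfl : p = a := by omega
      rw [tcomp_tsingle, h₂ b rfl, smul_zero]
    · rw [tcomp_tsingle_of_ne _ _ _ (Ne.symm hb'), map_zero, smul_zero]

theorem rTensor_d_coe (t : cyc C p ⊗[R] cyc D q) (k : ℕ) (hk : k + 1 = p) :
    (C.d p k).hom.rTensor _ (TensorProduct.map (cyc C p).subtype (cyc D q).subtype t) = 0 := by
  have : (C.d p k).hom ∘ₗ (cyc C p).subtype = 0 :=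
    LinearMap.ext fun z => mem_cyc.1 z.2 k hk
  rw [← LinearMap.comp_apply, LinearMap.rTensor_comp_map, this, TensorProduct.map_zero_left]
  rfl

theorem lTensor_d_coe (t : cyc C p ⊗[R] cyc D q) (k : ℕ) (hk : k + 1 = q) :
    (D.d q k).hom.lTensor _ (TensorProduct.map (cyc C p).subtype (cyc D q).subtype t) = 0 := by
  have : (D.d q k).hom ∘ₗ (cyc D q).subtype = 0 :=
    LinearMap.ext fun z => mem_cyc.1 z.2 k hk
  rw [← LinearMap.comp_apply, LinearMap.lTensor_comp_map, this, TensorProduct.map_zero_right]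
  rfl

/-- The tensor product of two cycles as a cycle. -/
noncomputable def cross (h : p + q = n) : cyc C p ⊗[R] cyc D q →ₗ[R] cyc (T C D) n :=
  (tsingle h ∘ₗ TensorProduct.map (cyc C p).subtype (cyc D q).subtype).codRestrict _ fun t =>
    tsingle_mem_cyc h _ (rTensor_d_coe t) (lTensor_d_coe t)

theorem cross_coe (h : p + q = n) (t : cyc C p ⊗[R] cyc D q) :
    (cross h t : (T C D).X n) =
      tsingle h (TensorProduct.map (cyc C p).subtype (cyc D q).subtype t) := rfl

theorem cls_cross_left (h : p + q = n) (x : C.X (p + 1)) (y : cyc D q) :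
    cls (T C D) n (cross h ((toBnd C p x : cyc C p) ⊗ₜ y)) = 0 := by
  rw [cls_eq_zero_iff]
  refine ⟨tsingle (p := p + 1) (q := q) (by omega) (x ⊗ₜ (y : D.X q)), ?_⟩
  rw [d_tsingle_left h]
  · rfl
  · intro k hk
    rw [LinearMap.lTensor_tmul]
    exact (congrArg (x ⊗ₜ ·) (mem_cyc.1 y.2 k hk)).trans (TensorProduct.tmul_zero _ _)

theorem cls_cross_right (h : p + q = n) (x : cyc C p) (y : D.X (q + 1)) :
    cls (T C D) n (cross h (x ⊗ₜ (toBnd D q y : cyc D q))) = 0 := by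
  rw [cls_eq_zero_iff]
  -- The sign cancels that of the vertical differential in column `p`.
  refine ⟨((-1 : ℤ) ^ p) • tsingle (p := p) (q := q + 1) (by omega) ((x : C.X p) ⊗ₜ y), ?_⟩
  rw [map_zsmul, d_tsingle_right h, smul_smul, ← mul_pow, neg_one_mul, neg_neg, one_pow, one_smul]
  · rfl
  · intro k hk
    rw [LinearMap.rTensor_tmul]
    exact (congrArg (· ⊗ₜ y) (mem_cyc.1 x.2 k hk)).trans (TensorProduct.zero_tmul _ _)

theorem map_cls_surjective : Function.Surjective (TensorProduct.map (cls C p) (cls D q)) :=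
  TensorProduct.map_surjective (cls_surjective p) (cls_surjective q)

/-- By right exactness the kernel of `Z_p ⊗ Z_q → H_p ⊗ H_q` is generated by the images of `Z_p ⊗
B_q` and `B_p ⊗ Z_q`, and a cycle tensored with a boundary is a boundary. -/
theorem cls_cross_eq_zero (h : p + q = n) (t : cyc C p ⊗[R] cyc D q)
    (ht : TensorProduct.map (cls C p) (cls D q) t = 0) : cls (T C D) n (cross h t) = 0 := by
  have hker := TensorProduct.map_ker (LinearMap.exact_subtype_ker_map (cls C p)) (cls_surjective p)
    (LinearMap.exact_subtype_ker_map (cls D q)) (cls_surjective q)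
  have ht' : t ∈ LinearMap.ker (TensorProduct.map (cls C p) (cls D q)) := ht
  rw [hker] at ht'
  refine (?_ : _ ≤ LinearMap.ker (cls (T C D) n ∘ₗ cross h)) ht'
  refine sup_le ?_ ?_
  · rintro _ ⟨u, rfl⟩
    induction u using TensorProduct.induction_on with
    | zero => rw [map_zero]; exact zero_mem _
    | add u v hu hv => rw [map_add]; exact add_mem hu hv
    | tmul x y =>
      obtain ⟨y, rfl⟩ := toBnd_surjective D q y
      exact cls_cross_right h x y
  · rintro _ ⟨u, rfl⟩
    induction u using TensorProduct.induction_on with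
    | zero => rw [map_zero]; exact zero_mem _
    | add u v hu hv => rw [map_add]; exact add_mem hu hv
    | tmul x y =>
      obtain ⟨x, rfl⟩ := toBnd_surjective C p x
      exact cls_cross_left h x y

/-- The cross product in homology. -/
noncomputable def α (h : p + q = n) : C.homology p ⊗[R] D.homology q →ₗ[R] (T C D).homology n :=
  (TensorProduct.map (cls C p) (cls D q)).descend map_cls_surjective (cls (T C D) n ∘ₗ cross h)
    (cls_cross_eq_zero h)

theorem α_map_cls (h : p + q = n) (t : cyc C p ⊗[R] cyc D q) :
    α h (TensorProduct.map (cls C p) (cls D q) t) = cls (T C D) n (cross h t) :=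
  LinearMap.descend_apply _ _ _ _ _

end Kunneth

/-! ### Cycles and boundaries inside tensor products -/

section LinearAlgebra

open TensorProduct

variable {R M N M' N' M'' N'' : Type} [CommRing R] [AddCommGroup M] [Module R M] [AddCommGroup N]
  [Module R N] [AddCommGroup M'] [Module R M'] [AddCommGroup N'] [Module R N'] [AddCommGroup M'']
  [Module R M''] [AddCommGroup N''] [Module R N'']

theorem TensorProduct.map_lTensor_apply (f : M →ₗ[R] M') (g : N' →ₗ[R] N'') (g' : N →ₗ[R] N')
    (t : M ⊗[R] N) : map f g (g'.lTensor M t) = map f (g ∘ₗ g') t := by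
  rw [← LinearMap.comp_apply, LinearMap.map_comp_lTensor]

theorem TensorProduct.map_rTensor_apply (f : M' →ₗ[R] M'') (g : N →ₗ[R] N') (f' : M →ₗ[R] M')
    (t : M ⊗[R] N) : map f g (f'.rTensor N t) = map (f ∘ₗ f') g t := by
  rw [← LinearMap.comp_apply, LinearMap.map_comp_rTensor]

theorem TensorProduct.rTensor_lTensor_apply (f : M →ₗ[R] M') (g : N →ₗ[R] N') (t : M ⊗[R] N) :
    f.rTensor N' (g.lTensor M t) = g.lTensor M' (f.rTensor N t) := by
  rw [← LinearMap.comp_apply, ← LinearMap.comp_apply, LinearMap.rTensor_comp_lTensor,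
    LinearMap.lTensor_comp_rTensor]

end LinearAlgebra

namespace ChainComplex

open scoped TensorProduct

variable {R : Type} [CommRing R] {C D : ChainComplex (ModuleCat.{0} R) ℕ} {p q : ℕ}

theorem exists_rTensor_cyc {M : Type} [AddCommGroup M] [Module R M] [Module.Flat R M]
    {t : C.X p ⊗[R] M} (ht : ∀ k, k + 1 = p → (C.d p k).hom.rTensor M t = 0) :
    ∃ u : cyc C p ⊗[R] M, (cyc C p).subtype.rTensor M u = t := by
  refine TensorProduct.exists_of_rTensor_eq_zero (C.d p ((ComplexShape.down ℕ).next p)).hom ?_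
  by_cases h : (ComplexShape.down ℕ).Rel p ((ComplexShape.down ℕ).next p)
  · exact ht _ h
  · rw [C.shape _ _ h, ModuleCat.hom_zero, LinearMap.rTensor_zero]
    rfl

theorem exists_map_cyc [IsDomain R] [IsPrincipalIdealRing R] [∀ n, Module.Projective R (C.X n)]
    [∀ n, Module.Projective R (D.X n)] {t : C.X p ⊗[R] D.X q}
    (h₁ : ∀ k, k + 1 = p → (C.d p k).hom.rTensor _ t = 0)
    (h₂ : ∀ k, k + 1 = q → (D.d q k).hom.lTensor _ t = 0) :
    ∃ u : cyc C p ⊗[R] cyc D q,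
      TensorProduct.map (cyc C p).subtype (cyc D q).subtype u = t := by
  have : Module.Flat R (LinearMap.ker (D.d q ((ComplexShape.down ℕ).next q)).hom) :=
    inferInstanceAs (Module.Flat R (cyc D q))
  refine TensorProduct.exists_of_rTensor_lTensor_eq_zero
    (C.d p ((ComplexShape.down ℕ).next p)).hom (D.d q ((ComplexShape.down ℕ).next q)).hom ?_ ?_
  · by_cases h : (ComplexShape.down ℕ).Rel p ((ComplexShape.down ℕ).next p)
    · exact h₁ _ h
    · rw [C.shape _ _ h, ModuleCat.hom_zero, LinearMap.rTensor_zero]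
      rfl
  · by_cases h : (ComplexShape.down ℕ).Rel q ((ComplexShape.down ℕ).next q)
    · exact h₂ _ h
    · rw [D.shape _ _ h, ModuleCat.hom_zero, LinearMap.lTensor_zero]
      rfl

/-- The inclusion of the boundaries into the chains. -/
noncomputable def bndι (D : ChainComplex (ModuleCat.{0} R) ℕ) (q : ℕ) : bnd D q →ₗ[R] D.X q :=
  (cyc D q).subtype ∘ₗ (bnd D q).subtype

theorem bndι_injective : Function.Injective (bndι D q) :=
  (Submodule.injective_subtype _).comp (Submodule.injective_subtype _)

theorem bndι_comp_toBnd : bndι D q ∘ₗ toBnd D q = (D.d (q + 1) q).hom := rfl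

theorem toBnd_comp_d : toBnd D q ∘ₗ (D.d (q + 1 + 1) (q + 1)).hom = 0 :=
  LinearMap.ext (toBnd_d D q)

theorem toBnd_comp_subtype : toBnd D q ∘ₗ (cyc D (q + 1)).subtype = 0 :=
  LinearMap.ext fun z => (toBnd_eq_zero_iff D q z).2 z.2

/-- The retraction fixes boundaries. Writing the map through `D.d` lets the relation between
neighbouring components of a cycle be applied. -/
theorem subtype_comp_toBnd [IsDomain R] [IsPrincipalIdealRing R]
    [∀ n, Module.Projective R (D.X n)] :
    (bnd D q).subtype ∘ₗ toBnd D q = cycRetraction D q ∘ₗ (D.d (q + 1) q).hom :=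
  LinearMap.ext fun x => (cycRetraction_coe D q (toBnd D q x)).symm

end ChainComplex

/-! ### The map to `Tor` and the retraction of the cross product -/

namespace Kunneth

open ChainComplex DoubleComplex
open scoped TensorProduct

variable {R : Type} [CommRing R] {C D : ChainComplex (ModuleCat.{0} R) ℕ}
  {C' D' : ChainComplex (ModuleCat.{0} R) ℕ} {n m p q p' q' : ℕ}

/-- This is the component of bidegree `(p, q)` of the equation `d z = 0`. -/
theorem rTensor_d_tcomp {z : (T C D).X n} (hz : z ∈ cyc (T C D) n) (h : p + q + 1 = n)
    (h₁ : p + 1 + q = n) (h₂ : p + (q + 1) = n) :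
    (C.d (p + 1) p).hom.rTensor (D.X q) (tcomp h₁ z) =
      -(((-1 : ℤ) ^ p) • (D.d (q + 1) q).hom.lTensor (C.X p) (tcomp h₂ z)) := by
  rw [eq_neg_iff_add_eq_zero, ← tcomp_d h z rfl, mem_cyc.1 hz _ h, map_zero]

theorem lTensor_d_tcomp {z : (T C D).X n} (hz : z ∈ cyc (T C D) n) (h : p + q + 1 = n)
    (h₁ : p + 1 + q = n) (h₂ : p + (q + 1) = n) :
    (D.d (q + 1) q).hom.lTensor (C.X p) (tcomp h₂ z) =
      -(((-1 : ℤ) ^ p) • (C.d (p + 1) p).hom.rTensor (D.X q) (tcomp h₁ z)) := by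
  rw [rTensor_d_tcomp hz h h₁ h₂, smul_neg, neg_neg, smul_smul, ← mul_pow, neg_one_mul, neg_neg,
    one_pow, one_smul]

variable [IsDomain R] [IsPrincipalIdealRing R] [∀ n, Module.Projective R (C.X n)]

/-- Both parts of the differential die: `clsExt` kills the horizontal one and `toBnd` the vertical
one. Hence `β` depends only on the homology class. -/
theorem map_toBnd_d (h : p + (q + 1) = n) (w : (T C D).X (n + 1)) :
    TensorProduct.map (clsExt C p) (toBnd D q) (tcomp h ((T C D).d (n + 1) n w)) = 0 := by
  rw [tcomp_d rfl, map_add, map_zsmul, TensorProduct.map_rTensor_apply,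
    TensorProduct.map_lTensor_apply, clsExt_comp_d, toBnd_comp_d,
    TensorProduct.map_zero_left, TensorProduct.map_zero_right, LinearMap.zero_apply,
    LinearMap.zero_apply, smul_zero, add_zero]

variable [∀ n, Module.Projective R (D.X n)]

/-- The horizontal differential of this element of `C_p ⊗ B_q` is, up to sign, obtained by applying
the vertical differential twice to a neighbouring component, so it vanishes. As `B_q` is flat, the
element comes from `Z_p ⊗ B_q`; thus `clsExt` is applied to honest cycles and the choice of
retraction does not matter for `β`. -/
theorem exists_rTensor_eq_toBnd {z : (T C D).X n} (hz : z ∈ cyc (T C D) n) (h : p + (q + 1) = n) :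
    ∃ u : cyc C p ⊗[R] bnd D q,
      (cyc C p).subtype.rTensor _ u = (toBnd D q).lTensor _ (tcomp h z) := by
  refine exists_rTensor_cyc fun k hk => ?_
  subst hk
  apply Module.Flat.lTensor_preserves_injective_linearMap (M := C.X k) (bndι D q) bndι_injective
  rw [map_zero, TensorProduct.rTensor_lTensor_apply, rTensor_d_tcomp hz (by omega) _ (by omega), map_neg, map_zsmul, map_neg, map_zsmul,
    ← LinearMap.lTensor_comp_apply (C.X k) (toBnd D q), toBnd_comp_d, LinearMap.lTensor_zero, LinearMap.zero_apply,
    map_zero, smul_zero, neg_zero]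

/-- In `H_p ⊗ Z_q` the vertical differential of `z_{p,q+1}` can be replaced, up to sign, by the
horizontal differential of `z_{p+1,q}`, which `clsExt` kills. -/
theorem map_toBnd_mem {z : (T C D).X n} (hz : z ∈ cyc (T C D) n) (h : p + (q + 1) = n) :
    TensorProduct.map (clsExt C p) (toBnd D q) (tcomp h z) ∈
      cyc ((homologyResolution D q).tensorComplex (C.homology p)) 1 := by
  refine ((homologyResolution D q).mem_cyc_tensorComplex _ _).2 ?_
  change (bnd D q).subtype.lTensor (C.homology p) _ = 0
  rw [← LinearMap.comp_apply, LinearMap.lTensor_comp_map, subtype_comp_toBnd,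
    ← LinearMap.map_comp_lTensor, LinearMap.comp_apply, lTensor_d_tcomp hz (by omega) (by omega),
    map_neg, map_zsmul, TensorProduct.map_rTensor_apply, clsExt_comp_d,
    TensorProduct.map_zero_left, LinearMap.zero_apply, smul_zero, neg_zero]

/-- The map from cycles to `Tor`. -/
noncomputable def preβ (h : p + (q + 1) = n) : cyc (T C D) n →ₗ[R]
    cyc ((homologyResolution D q).tensorComplex (C.homology p)) 1 :=
  LinearMap.codRestrict (cyc ((homologyResolution D q).tensorComplex (C.homology p)) 1)
    (TensorProduct.map (clsExt C p) (toBnd D q) ∘ₗ tcomp h ∘ₗ (cyc (T C D) n).subtype)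
    fun z => map_toBnd_mem z.2 h

theorem preβ_eq (h : p + (q + 1) = n) (z : cyc (T C D) n) : preβ h z =
    ⟨TensorProduct.map (clsExt C p) (toBnd D q) (tcomp h (z : (T C D).X n)),
      map_toBnd_mem z.2 h⟩ := rfl

theorem preβ_eq_zero_iff (h : p + (q + 1) = n) (z : cyc (T C D) n) : preβ h z = 0 ↔
    TensorProduct.map (clsExt C p) (toBnd D q) (tcomp h (z : (T C D).X n)) = 0 :=
  Subtype.ext_iff

/-- The map from homology to `Tor`. -/
noncomputable def β (h : p + (q + 1) = n) : (T C D).homology n →ₗ[R]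
    (((Tor (ModuleCat.{0} R) 1).obj (C.homology p)).obj (D.homology q) : ModuleCat.{0} R) :=
  (cls (T C D) n).descend (cls_surjective n)
    (((homologyResolution D q).torEquiv (C.homology p)).toLinearMap ∘ₗ preβ h) fun z hz => by
      obtain ⟨w, hw⟩ := (cls_eq_zero_iff z).1 hz
      have : preβ h z = 0 := by
        rw [preβ_eq_zero_iff, ← hw]
        exact map_toBnd_d h w
      rw [LinearMap.comp_apply, this, map_zero]

theorem β_cls (h : p + (q + 1) = n) (z : cyc (T C D) n) : β h (cls (T C D) n z) =
    (homologyResolution D q).torEquiv (C.homology p) (preβ h z) :=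
  LinearMap.descend_apply _ _ _ _ _

theorem β_cls_eq_zero_iff (h : p + (q + 1) = n) (z : cyc (T C D) n) : β h (cls (T C D) n z) = 0 ↔
    TensorProduct.map (clsExt C p) (toBnd D q) (tcomp h (z : (T C D).X n)) = 0 := by
  rw [β_cls, ← preβ_eq_zero_iff]
  exact LinearEquiv.map_eq_zero_iff _

/-- The retraction of the cross product. -/
noncomputable def ρ (h : p + q = n) :
    (T C D).homology n →ₗ[R] C.homology p ⊗[R] D.homology q :=
  (cls (T C D) n).descend (cls_surjective n)
    (TensorProduct.map (clsExt C p) (clsExt D q) ∘ₗ tcomp h ∘ₗ (cyc (T C D) n).subtype)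
    fun z hz => by
      obtain ⟨w, hw⟩ := (cls_eq_zero_iff z).1 hz
      rw [LinearMap.comp_apply, LinearMap.comp_apply, Submodule.subtype_apply, ← hw, tcomp_d rfl,
        map_add, map_zsmul, TensorProduct.map_rTensor_apply,
        TensorProduct.map_lTensor_apply, clsExt_comp_d, clsExt_comp_d,
        TensorProduct.map_zero_left, TensorProduct.map_zero_right, LinearMap.zero_apply,
        LinearMap.zero_apply, smul_zero, add_zero]

theorem ρ_cls (h : p + q = n) (z : cyc (T C D) n) : ρ h (cls (T C D) n z) =
    TensorProduct.map (clsExt C p) (clsExt D q) (tcomp h (z : (T C D).X n)) :=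
  LinearMap.descend_apply _ _ _ _ _

theorem ρ_α (h : p + q = n) (x : C.homology p ⊗[R] D.homology q) : ρ h (α h x) = x := by
  obtain ⟨t, rfl⟩ := map_cls_surjective x
  rw [α_map_cls, ρ_cls, cross_coe, tcomp_tsingle, ← LinearMap.comp_apply, ← TensorProduct.map_comp,
    clsExt_comp_subtype, clsExt_comp_subtype]

theorem ρ_α_of_ne (h : p + q = n) (h' : p' + q' = n) (hq : q' ≠ q)
    (x : C.homology p ⊗[R] D.homology q) : ρ h' (α h x) = 0 := by
  obtain ⟨t, rfl⟩ := map_cls_surjective x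
  rw [α_map_cls, ρ_cls, cross_coe, tcomp_tsingle_of_ne _ _ _ hq, map_zero]

/-- The components of a cross product lie in the tensor product of the cycles, and `toBnd` vanishes
on cycles. -/
theorem β_α (h : p + q = n) (h' : p' + (q' + 1) = n) (x : C.homology p ⊗[R] D.homology q) :
    β h' (α h x) = 0 := by
  obtain ⟨t, rfl⟩ := map_cls_surjective x
  rw [α_map_cls, β_cls_eq_zero_iff, cross_coe]
  by_cases hq : q' + 1 = q
  · subst hq
    obtain rfl : p = p' := by omega
    rw [tcomp_tsingle, ← LinearMap.comp_apply, ← TensorProduct.map_comp, toBnd_comp_subtype,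
      TensorProduct.map_zero_right, LinearMap.zero_apply]
  · rw [tcomp_tsingle_of_ne _ _ _ hq, map_zero]

end Kunneth

/-! ### Exactness of the algebraic Künneth sequence -/

namespace Kunneth

open ChainComplex DoubleComplex
open scoped TensorProduct

variable {R : Type} [CommRing R] {C D : ChainComplex (ModuleCat.{0} R) ℕ}
  {C' D' : ChainComplex (ModuleCat.{0} R) ℕ} {n m p q p' q' : ℕ}

theorem exists_tcomp_eq (w : ∀ p q, p + q = n → C.X p ⊗[R] D.X q) :
    ∃ z : (T C D).X n, ∀ p q (h : p + q = n), tcomp h z = w p q h :=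
  ⟨fun x => w x.1.1 x.1.2 x.2, fun _ _ _ => rfl⟩

theorem rTensor_cls_eq_zero {M : Type} [AddCommGroup M] [Module R M] {t : cyc C p ⊗[R] M}
    (ht : (cls C p).rTensor M t = 0) :
    ∃ s : C.X (p + 1) ⊗[R] M, ((bnd C p).subtype ∘ₗ toBnd C p).rTensor M s = t := by
  obtain ⟨s, rfl⟩ := (rTensor_exact M (LinearMap.exact_subtype_ker_map (cls C p))
    (cls_surjective p) t).1 ht
  obtain ⟨s, rfl⟩ := LinearMap.rTensor_surjective M (toBnd_surjective C p) s
  exact ⟨s, LinearMap.rTensor_comp_apply _ _ _ _⟩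

/-- After `1 ⊗ toBnd` only the horizontal part of `d V` survives, and the hypothesis makes that part
equal to the contribution of `z`. -/
theorem lTensor_toBnd_eq_of_map_toBnd_eq {z : (T C D).X n} {V : (T C D).X (n + 1)}
    (h : p + (q + 1) = n)
    (hV : TensorProduct.map (C.d (p + 1) p).hom (toBnd D q)
        (tcomp (p := p + 1) (q := q + 1) (by omega) V) = (toBnd D q).lTensor _ (tcomp h z)) :
    (toBnd D q).lTensor _ (tcomp h (z - (T C D).d (n + 1) n V)) = 0 := by
  rw [map_sub, map_sub, tcomp_d rfl, map_add, map_zsmul,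
    ← LinearMap.lTensor_comp_apply (C.X p) (toBnd D q), toBnd_comp_d, LinearMap.lTensor_zero,
    LinearMap.zero_apply, smul_zero, add_zero, ← hV, LinearMap.lTensor,
    TensorProduct.map_rTensor_apply, LinearMap.id_comp, sub_self]

variable [IsDomain R] [IsPrincipalIdealRing R] [∀ n, Module.Projective R (C.X n)]
  [∀ n, Module.Projective R (D.X n)]

/-- The element of `Z_p ⊗ B_q` determined by `z` goes to zero in `H_p ⊗ B_q`, so it comes from `B_p
⊗ B_q` and lifts to `C_{p+1} ⊗ D_{q+1}` through the two differentials. -/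
theorem exists_map_toBnd_eq {z : cyc (T C D) n} (h : p + (q + 1) = n)
    (hz : β h (cls (T C D) n z) = 0) : ∃ v : C.X (p + 1) ⊗[R] D.X (q + 1),
      TensorProduct.map (C.d (p + 1) p).hom (toBnd D q) v =
        (toBnd D q).lTensor _ (tcomp h (z : (T C D).X n)) := by
  obtain ⟨u, hu⟩ := exists_rTensor_eq_toBnd z.2 h
  have h1 : (cls C p).rTensor _ u = 0 := by
    rw [← clsExt_comp_subtype, LinearMap.rTensor_comp_apply, hu, LinearMap.rTensor,
      TensorProduct.map_lTensor_apply, LinearMap.id_comp]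
    exact (β_cls_eq_zero_iff h z).1 hz
  obtain ⟨s, rfl⟩ := rTensor_cls_eq_zero h1
  obtain ⟨v, rfl⟩ := LinearMap.lTensor_surjective _ (toBnd_surjective D q) s
  refine ⟨v, ?_⟩
  rw [← hu, ← LinearMap.rTensor_comp_apply, LinearMap.rTensor, TensorProduct.map_lTensor_apply,
    LinearMap.id_comp]
  rfl

/-- The hypothesis makes all vertical differentials of the components zero, and the cycle condition
then does the same for the horizontal ones. By flatness each component lies in `Z_p ⊗ Z_q`. -/
theorem exists_eq_sum_cross {z : cyc (T C D) n} (hz : ∀ p q (h : p + (q + 1) = n),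
    (toBnd D q).lTensor _ (tcomp h (z : (T C D).X n)) = 0) :
    ∃ b : ∀ x : Finset.HasAntidiagonal.antidiagonal n, cyc C x.1.1 ⊗[R] cyc D x.1.2,
      z = ∑ x, cross (Finset.HasAntidiagonal.mem_antidiagonal.1 x.2) (b x) := by
  have h2 : ∀ p q (h : p + (q + 1) = n),
      (D.d (q + 1) q).hom.lTensor _ (tcomp h (z : (T C D).X n)) = 0 := fun p q h => by
    rw [← bndι_comp_toBnd, LinearMap.lTensor_comp_apply, hz p q h, map_zero]
  have h1 : ∀ p q (h : p + 1 + q = n),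
      (C.d (p + 1) p).hom.rTensor _ (tcomp h (z : (T C D).X n)) = 0 := fun p q h => by
    rw [rTensor_d_tcomp z.2 (by omega) _ (by omega), h2, smul_zero, neg_zero]
  have key : ∀ x : Finset.HasAntidiagonal.antidiagonal n,
      ∃ b : cyc C x.1.1 ⊗[R] cyc D x.1.2,
      TensorProduct.map (cyc C x.1.1).subtype (cyc D x.1.2).subtype b =
        tcomp (Finset.HasAntidiagonal.mem_antidiagonal.1 x.2) (z : (T C D).X n) := by
    rintro ⟨⟨p, q⟩, h⟩
    refine exists_map_cyc ?_ ?_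
    · rintro k rfl
      exact h1 k q _
    · rintro k rfl
      exact h2 p k _
  choose b hb using key
  refine ⟨b, Subtype.ext ?_⟩
  rw [Submodule.coe_sum]
  simp only [cross_coe, hb]
  exact (sum_tsingle_tcomp _).symm

theorem exists_eq_sum_α (x : (T C D).homology n)
    (hx : ∀ p q (h : p + (q + 1) = n), β h x = 0) :
    ∃ y : ∀ x : Finset.HasAntidiagonal.antidiagonal n, C.homology x.1.1 ⊗[R] D.homology x.1.2,
      x = ∑ x, α (Finset.HasAntidiagonal.mem_antidiagonal.1 x.2) (y x) := by
  obtain ⟨z, rfl⟩ := cls_surjective n x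
  choose v hv using fun p q (h : p + (q + 1) = n) => exists_map_toBnd_eq h (hx p q h)
  -- The correcting chain `V` has the lifts in the bidegrees `(p + 1, q + 1)` and zero on the two
  -- edges. Subtracting `d V` leaves the class unchanged and makes all vertical differentials of
  -- components vanish.
  let w : ∀ p q, p + q = n + 1 → C.X p ⊗[R] D.X q := fun p q h =>
    match p, q, h with
    | 0, _, _ => 0
    | _ + 1, 0, _ => 0
    | p + 1, q + 1, h => v p q (by omega)
  obtain ⟨V, hV⟩ := exists_tcomp_eq w
  let z' : cyc (T C D) n := z - ⟨(T C D).d (n + 1) n V, d_mem_cyc n V⟩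
  have hz' : cls (T C D) n z = cls (T C D) n z' := by
    rw [map_sub, (cls_eq_zero_iff ⟨(T C D).d (n + 1) n V, d_mem_cyc n V⟩).2 ⟨V, rfl⟩, sub_zero]
  obtain ⟨b, hb⟩ := exists_eq_sum_cross (z := z') fun p q h => by
    refine lTensor_toBnd_eq_of_map_toBnd_eq h ?_
    rw [hV]
    exact hv p q h
  refine ⟨fun x => TensorProduct.map (cls C x.1.1) (cls D x.1.2) (b x), ?_⟩
  rw [hz', hb, map_sum]
  exact Finset.sum_congr rfl fun x _ => (α_map_cls _ _).symm

/-- Lift the element of `H_p ⊗ B_q` to `a` in `Z_p ⊗ D_{q+1}`. Its vertical differential vanishes in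
`H_p ⊗ Z_q`, hence is the horizontal differential of some `s` in `C_{p+1} ⊗ Z_q`, and the two
combine to a cycle. The second component is invisible to every `β` because `toBnd` kills cycles;
this vanishing allows preimages of different summands to be added. -/
theorem exists_β_eq (h : p + (q + 1) = n)
    (t : (((Tor (ModuleCat.{0} R) 1).obj (C.homology p)).obj (D.homology q) : ModuleCat.{0} R)) :
    ∃ x : (T C D).homology n, β h x = t ∧
      ∀ p' q' (h' : p' + (q' + 1) = n), q' ≠ q → β h' x = 0 := by
  obtain ⟨⟨t₀, ht₀⟩, rfl⟩ := ((homologyResolution D q).torEquiv (C.homology p)).surjective t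
  have ht₁ : (bnd D q).subtype.lTensor (C.homology p) t₀ = 0 :=
    ((homologyResolution D q).mem_cyc_tensorComplex _ _).1 ht₀
  obtain ⟨τ, hτ⟩ : ∃ τ : cyc C p ⊗[R] bnd D q, (cls C p).rTensor (bnd D q) τ = t₀ :=
    LinearMap.rTensor_surjective _ (cls_surjective p) _
  obtain ⟨a, rfl⟩ := LinearMap.lTensor_surjective _ (toBnd_surjective D q) τ
  obtain ⟨s, hs⟩ := rTensor_cls_eq_zero (C := C) (p := p)
    (t := (bnd D q).subtype.lTensor _ ((toBnd D q).lTensor _ a)) (by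
      rw [TensorProduct.rTensor_lTensor_apply, hτ, ht₁])
  let A := (cyc C p).subtype.rTensor _ a
  let S := (cyc D q).subtype.lTensor _ s
  have hAS : (D.d (q + 1) q).hom.lTensor _ A = (C.d (p + 1) p).hom.rTensor _ S := by
    have := congrArg (TensorProduct.map (cyc C p).subtype (cyc D q).subtype) hs
    rw [TensorProduct.map_rTensor_apply, TensorProduct.map_lTensor_apply,
      TensorProduct.map_lTensor_apply] at this
    rw [LinearMap.lTensor, TensorProduct.map_rTensor_apply, LinearMap.id_comp, LinearMap.rTensor,
      TensorProduct.map_lTensor_apply, LinearMap.id_comp]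
    exact this.symm
  have hA : ∀ k, k + 1 = p → (C.d p k).hom.rTensor _ A = 0 := fun k hk => by
    have : (C.d p k).hom ∘ₗ (cyc C p).subtype = 0 := LinearMap.ext fun z => mem_cyc.1 z.2 k hk
    rw [← LinearMap.rTensor_comp_apply, this, LinearMap.rTensor_zero, LinearMap.zero_apply]
  have hS : ∀ k, k + 1 = q → (D.d q k).hom.lTensor _ S = 0 := fun k hk => by
    have : (D.d q k).hom ∘ₗ (cyc D q).subtype = 0 := LinearMap.ext fun z => mem_cyc.1 z.2 k hk
    rw [← LinearMap.lTensor_comp_apply, this, LinearMap.lTensor_zero, LinearMap.zero_apply]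
  have hS' : p + 1 + q = n := by omega
  -- The vertical differential of `A` carries the sign `(-1) ^ p` in the total complex, while the
  -- horizontal differential of `S` carries none.
  have hz : tsingle h A - ((-1 : ℤ) ^ p) • tsingle hS' S ∈ cyc (T C D) n := by
    rw [mem_cyc]
    intro m hm
    rw [map_sub, map_zsmul, d_tsingle_right (by omega) h A hA, d_tsingle_left (by omega) hS' S hS,
      hAS, sub_self]
  have hz₁ : TensorProduct.map (clsExt C p) (toBnd D q)
      (tcomp h (tsingle h A - ((-1 : ℤ) ^ p) • tsingle hS' S)) =
      (cls C p).rTensor _ ((toBnd D q).lTensor _ a) := by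
    rw [map_sub, map_zsmul, tcomp_tsingle, tcomp_tsingle_of_ne _ _ _ (by omega), smul_zero,
      sub_zero, TensorProduct.map_rTensor_apply, clsExt_comp_subtype, LinearMap.rTensor,
      TensorProduct.map_lTensor_apply, LinearMap.id_comp]
  refine ⟨cls (T C D) n ⟨_, hz⟩, ?_, ?_⟩
  · rw [β_cls, preβ_eq]
    refine congrArg _ (Subtype.ext ?_)
    exact hz₁.trans hτ
  · intro p' q' h' hne
    rw [β_cls_eq_zero_iff, map_sub, map_zsmul, tcomp_tsingle_of_ne _ _ _ (by omega), zero_sub]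
    by_cases hq : q' + 1 = q
    · subst hq
      obtain rfl : p + 1 = p' := by omega
      rw [tcomp_tsingle, map_neg, map_zsmul, TensorProduct.map_lTensor_apply, toBnd_comp_subtype,
        TensorProduct.map_zero_right, LinearMap.zero_apply, smul_zero, neg_zero]
    · rw [tcomp_tsingle_of_ne _ _ _ hq, smul_zero, neg_zero, map_zero]

end Kunneth

/-! ### Naturality of the two maps -/

namespace ChainComplex

variable {R : Type} [CommRing R] {C C' : ChainComplex (ModuleCat.{0} R) ℕ}

/-- The map of cycles induced by a chain map. -/
noncomputable def cycMap (f : C ⟶ C') (n : ℕ) : cyc C n →ₗ[R] cyc C' n :=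
  (f.f n).hom.restrict fun _ => map_mem_cyc f

theorem cls_cycMap (f : C ⟶ C') (n : ℕ) (z : cyc C n) :
    cls C' n (cycMap f n z) = HomologicalComplex.homologyMap f n (cls C n z) :=
  (homologyMap_cls f z).symm

/-- The map of boundaries induced by a chain map. -/
noncomputable def bndMap (f : C ⟶ C') (n : ℕ) : bnd C n →ₗ[R] bnd C' n :=
  (cycMap f n).restrict fun z (hz : cls C n z = 0) => by
    change cls C' n _ = 0
    rw [cls_cycMap, hz, map_zero]

theorem toBnd_comp_f (f : C ⟶ C') (n : ℕ) :
    toBnd C' n ∘ₗ (f.f (n + 1)).hom = bndMap f n ∘ₗ toBnd C n :=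
  LinearMap.ext fun x => Subtype.ext (Subtype.ext (map_d_apply f (n + 1) n x).symm)

end ChainComplex

namespace Kunneth

open ChainComplex DoubleComplex
open scoped TensorProduct

variable {R : Type} [CommRing R] {C D : ChainComplex (ModuleCat.{0} R) ℕ}
  {C' D' : ChainComplex (ModuleCat.{0} R) ℕ} {n p q : ℕ}

/-- The functoriality of the tensor product of complexes. -/
noncomputable abbrev tMap (f : C ⟶ C') (g : D ⟶ D') : T C D ⟶ T C' D' := totMap (tensorDCMap f g)

theorem tcomp_tMap (f : C ⟶ C') (g : D ⟶ D') (h : p + q = n) (z : (T C D).X n) :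
    tcomp h ((tMap f g).f n z) = TensorProduct.map (f.f p).hom (g.f q).hom (tcomp h z) := rfl

theorem tMap_tsingle (f : C ⟶ C') (g : D ⟶ D') (h : p + q = n) (t : C.X p ⊗[R] D.X q) :
    (tMap f g).f n (tsingle h t) = tsingle h (TensorProduct.map (f.f p).hom (g.f q).hom t) := by
  refine t_ext fun a b hab => ?_
  rw [tcomp_tMap]
  by_cases hb : b = q
  · subst hb
    obtain rfl : p = a := by omega
    rw [tcomp_tsingle, tcomp_tsingle]
  · rw [tcomp_tsingle_of_ne _ _ _ hb, tcomp_tsingle_of_ne _ _ _ hb, map_zero]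

theorem tMap_cross (f : C ⟶ C') (g : D ⟶ D') (h : p + q = n) (t : cyc C p ⊗[R] cyc D q) :
    (tMap f g).f n (cross h t : (T C D).X n) =
      cross h (TensorProduct.map (cycMap f p) (cycMap g q) t) := by
  rw [cross_coe, tMap_tsingle, cross_coe, TensorProduct.map_map, TensorProduct.map_map]
  rfl

theorem homologyMap_α (f : C ⟶ C') (g : D ⟶ D') (h : p + q = n)
    (x : C.homology p ⊗[R] D.homology q) :
    HomologicalComplex.homologyMap (tMap f g) n (α h x) =
      α h (TensorProduct.map (HomologicalComplex.homologyMap f p).hom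
        (HomologicalComplex.homologyMap g q).hom x) := by
  obtain ⟨t, rfl⟩ := map_cls_surjective x
  have e : TensorProduct.map (HomologicalComplex.homologyMap f p).hom
        (HomologicalComplex.homologyMap g q).hom (TensorProduct.map (cls C p) (cls D q) t) =
      TensorProduct.map (cls C' p) (cls D' q)
        (TensorProduct.map (cycMap f p) (cycMap g q) t) := by
    rw [TensorProduct.map_map, TensorProduct.map_map]
    congr 2 <;> exact LinearMap.ext fun z => (cls_cycMap _ _ z).symm
  rw [e, α_map_cls, α_map_cls, homologyMap_cls]
  exact congrArg _ (Subtype.ext (tMap_cross f g h t))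

/-- The map `α` as a morphism. -/
noncomputable def αHom (C D : ChainComplex (ModuleCat.{0} R) ℕ) (p q : ℕ) (h : p + q = n) :
    C.homology p ⊗ D.homology q ⟶ (T C D).homology n := ModuleCat.ofHom (α h)

theorem αHom_naturality {C C' D D' : ChainComplex (ModuleCat.{0} R) ℕ} (f : C ⟶ C') (g : D ⟶ D')
    (p q : ℕ) (h : p + q = n) :
    (HomologicalComplex.homologyMap f p ⊗ₘ HomologicalComplex.homologyMap g q) ≫ αHom C' D' p q h =
      αHom C D p q h ≫ HomologicalComplex.homologyMap (tMap f g) n :=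
  ModuleCat.hom_ext (LinearMap.ext fun x => (homologyMap_α f g h x).symm)

variable [IsDomain R] [IsPrincipalIdealRing R] [∀ n, Module.Projective R (C.X n)]
  [∀ n, Module.Projective R (D.X n)]
  [∀ n, Module.Projective R (C'.X n)]

/-- The map `clsExt` commutes with chain maps only on cycles, so the element is first rewritten as
coming from `Z_p ⊗ B_q`. -/
theorem map_toBnd_tMap (f : C ⟶ C') (g : D ⟶ D') (h : p + (q + 1) = n) {z : (T C D).X n}
    (hz : z ∈ cyc (T C D) n) :
    TensorProduct.map (clsExt C' p) (toBnd D' q) (tcomp h ((tMap f g).f n z)) =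
      TensorProduct.map (HomologicalComplex.homologyMap f p).hom (bndMap g q)
        (TensorProduct.map (clsExt C p) (toBnd D q) (tcomp h z)) := by
  obtain ⟨u, hu⟩ := exists_rTensor_eq_toBnd hz h
  rw [tcomp_tMap, TensorProduct.map_map, TensorProduct.map_map, toBnd_comp_f, ← TensorProduct.map_lTensor_apply,
    ← TensorProduct.map_lTensor_apply, ← hu, TensorProduct.map_rTensor_apply,
    TensorProduct.map_rTensor_apply]
  congr 2
  refine LinearMap.ext fun z => ?_
  exact (clsExt_coe C' p (cycMap f p z)).trans
    ((cls_cycMap f p z).trans (congrArg _ (clsExt_coe C p z).symm))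

variable [∀ n, Module.Projective R (D'.X n)]

theorem β_homologyMap (f : C ⟶ C') (g : D ⟶ D') (h : p + (q + 1) = n) (x : (T C D).homology n) :
    β h (HomologicalComplex.homologyMap (tMap f g) n x) =
      ((Tor (ModuleCat.{0} R) 1).obj (C'.homology p)).map (HomologicalComplex.homologyMap g q)
        (((Tor (ModuleCat.{0} R) 1).map (HomologicalComplex.homologyMap f p)).app (D.homology q)
          (β h x)) := by
  obtain ⟨z, rfl⟩ := cls_surjective n x
  -- The chain map `g` acts on boundaries and cycles, and these actions form a morphism of the
  -- chosen resolutions over the map in homology.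
  have hnat := ShortResolution.torEquiv_naturality (S := homologyResolution D q)
    (S' := homologyResolution D' q) (b := ModuleCat.ofHom (bndMap g q))
    (z := ModuleCat.ofHom (cycMap g q)) rfl (HomologicalComplex.homologyMap f p)
    (HomologicalComplex.homologyMap g q)
    (ModuleCat.hom_ext (LinearMap.ext fun z => (cls_cycMap g q z).symm)) _ (preβ h z).2
  rw [homologyMap_cls, β_cls, β_cls]
  refine Eq.trans ?_ hnat.symm
  exact congrArg _ (Subtype.ext (map_toBnd_tMap f g h z.2))

variable (C D) in
/-- The map `ρ` as a morphism. -/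
noncomputable def ρHom (p q : ℕ) (h : p + q = n) :
    (T C D).homology n ⟶ C.homology p ⊗ D.homology q := ModuleCat.ofHom (ρ h)

variable (C D) in
/-- The map `β` as a morphism. -/
noncomputable def βHom (p q : ℕ) (h : p + (q + 1) = n) : (T C D).homology n ⟶
    ((Tor (ModuleCat.{0} R) 1).obj (C.homology p)).obj (D.homology q) := ModuleCat.ofHom (β h)

theorem βHom_naturality (f : C ⟶ C') (g : D ⟶ D') (p q : ℕ) (h : p + (q + 1) = n) :
    HomologicalComplex.homologyMap (tMap f g) n ≫ βHom C' D' p q h =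
      βHom C D p q h ≫
        ((Tor (ModuleCat.{0} R) 1).map (HomologicalComplex.homologyMap f p)).app (D.homology q) ≫
        ((Tor (ModuleCat.{0} R) 1).obj (C'.homology p)).map (HomologicalComplex.homologyMap g q) :=
  ModuleCat.hom_ext (LinearMap.ext fun x => β_homologyMap f g h x)

end Kunneth

theorem comp_comm_of_comm {𝒞 : Type*} [Category 𝒞] {A₁ A₂ B₁ B₂ C₁ C₂ D₁ D₂ : 𝒞} {a : A₁ ⟶ A₂}
    {b : B₁ ⟶ B₂} {c : C₁ ⟶ C₂} {d : D₁ ⟶ D₂} {i : A₁ ⟶ B₁} {i' : A₂ ⟶ B₂} {j : B₁ ⟶ C₁}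
    {j' : B₂ ⟶ C₂} {k : C₁ ⟶ D₁} {k' : C₂ ⟶ D₂} (h₁ : a ≫ i' = i ≫ b) (h₂ : b ≫ j' = j ≫ c)
    (h₃ : c ≫ k' = k ≫ d) : a ≫ i' ≫ j' ≫ k' = (i ≫ j ≫ k) ≫ d := by
  rw [reassoc_of% h₁, reassoc_of% h₂, h₃, Category.assoc, Category.assoc]

/-! ### Split exactness with finite direct sums at both ends -/

section Biproduct

variable {R : Type} [CommRing R] {J K : Type} [Finite J] [Finite K] {A : J → ModuleCat.{0} R}
  {B : K → ModuleCat.{0} R} {X X' : ModuleCat.{0} R}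

theorem biproduct_element_ext {u v : (⨁ B : ModuleCat.{0} R)}
    (h : ∀ k, biproduct.π B k u = biproduct.π B k v) : u = v := by
  cases nonempty_fintype K
  have key : ∀ w : (⨁ B : ModuleCat.{0} R), w = ∑ k, biproduct.ι B k (biproduct.π B k w) := by
    intro w
    have h := congrArg ModuleCat.Hom.hom (biproduct.total (f := B))
    rw [ModuleCat.hom_sum] at h
    exact ((LinearMap.sum_apply _ _ _).symm.trans (LinearMap.congr_fun h w)).symm
  rw [key u, key v]
  simp only [h]

theorem biproduct_map_comp_desc {A' : J → ModuleCat.{0} R} {m : ∀ j, A j ⟶ A' j}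
    {a : ∀ j, A j ⟶ X} {a' : ∀ j, A' j ⟶ X'} {f : X ⟶ X'} (h : ∀ j, m j ≫ a' j = a j ≫ f) :
    biproduct.map m ≫ biproduct.desc a' = biproduct.desc a ≫ f := by
  refine biproduct.hom_ext' _ _ fun j => ?_
  rw [biproduct.ι_map_assoc, biproduct.ι_desc, biproduct.ι_desc_assoc, h]

theorem biproduct_comp_lift {B' : K → ModuleCat.{0} R} {m : ∀ k, B k ⟶ B' k}
    {b : ∀ k, X ⟶ B k} {b' : ∀ k, X' ⟶ B' k} {f : X ⟶ X'} (h : ∀ k, f ≫ b' k = b k ≫ m k) :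
    f ≫ biproduct.lift b' = biproduct.lift b ≫ biproduct.map m := by
  refine biproduct.hom_ext _ _ fun k => ?_
  rw [Category.assoc, Category.assoc, biproduct.lift_π, biproduct.map_π, biproduct.lift_π_assoc, h]

/-- A criterion for a short sequence with finite direct sums at both ends to be split exact. -/
theorem shortExact_and_splitting_of_biproduct (a : ∀ j, A j ⟶ X) (r : ∀ j, X ⟶ A j)
    (b : ∀ k, X ⟶ B k) (e : X ≅ X') (har : ∀ j x, r j (a j x) = x)
    (har' : ∀ j j' x, j ≠ j' → r j' (a j x) = 0) (hab : ∀ j k x, b k (a j x) = 0)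
    (hexact : ∀ x, (∀ k, b k x = 0) → ∃ y, biproduct.desc a y = x)
    (hsurj : ∀ k t, ∃ x, b k x = t ∧ ∀ k', k' ≠ k → b k' x = 0) :
    ∃ w : (biproduct.desc a ≫ e.hom) ≫ e.inv ≫ biproduct.lift b = 0,
      (ShortComplex.mk (biproduct.desc a ≫ e.hom) (e.inv ≫ biproduct.lift b) w).ShortExact ∧
      Nonempty (ShortComplex.mk (biproduct.desc a ≫ e.hom) (e.inv ≫ biproduct.lift b)
        w).Splitting := by
  classical
  cases nonempty_fintype K
  have w₀ : biproduct.desc a ≫ biproduct.lift b = 0 := by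
    refine biproduct.hom_ext' _ _ fun j => biproduct.hom_ext _ _ fun k => ?_
    rw [biproduct.ι_desc_assoc, Category.assoc, biproduct.lift_π, comp_zero, zero_comp]
    exact ModuleCat.hom_ext (LinearMap.ext (hab j k))
  have hr : biproduct.desc a ≫ biproduct.lift r = 𝟙 _ := by
    refine biproduct.hom_ext' _ _ fun j => biproduct.hom_ext _ _ fun j' => ?_
    rw [biproduct.ι_desc_assoc, Category.assoc, biproduct.lift_π, Category.comp_id]
    by_cases hj : j = j'
    · subst hj
      rw [biproduct.ι_π_self]
      exact ModuleCat.hom_ext (LinearMap.ext (har j))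
    · rw [biproduct.ι_π_ne _ hj]
      exact ModuleCat.hom_ext (LinearMap.ext fun x => har' j j' x hj)
  have w : (biproduct.desc a ≫ e.hom) ≫ e.inv ≫ biproduct.lift b = 0 := by
    rw [Category.assoc, e.hom_inv_id_assoc, w₀]
  have hretr : (biproduct.desc a ≫ e.hom) ≫ e.inv ≫ biproduct.lift r = 𝟙 _ := by
    rw [Category.assoc, e.hom_inv_id_assoc, hr]
  have hmono : Mono (biproduct.desc a ≫ e.hom) := mono_of_mono_fac hretr
  have hepi₀ : Epi (biproduct.lift b) := by
    rw [ModuleCat.epi_iff_surjective]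
    intro t
    -- Each `x k` has the prescribed image in the summand `k` and zero image in the others, so the
    -- sum realises all components at once.
    choose x hx hx' using fun k => hsurj k (biproduct.π B k t)
    refine ⟨∑ k, x k, biproduct_element_ext fun k => ?_⟩
    rw [← ConcreteCategory.comp_apply, biproduct.lift_π, map_sum,
      Finset.sum_eq_single k (fun k' _ hk => hx' k' k (Ne.symm hk))
        (fun h => absurd (Finset.mem_univ k) h), hx]
  have hepi : Epi (e.inv ≫ biproduct.lift b) := epi_comp _ _
  have hex : (ShortComplex.mk (biproduct.desc a ≫ e.hom) (e.inv ≫ biproduct.lift b) w).Exact := by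
    rw [ShortComplex.moduleCat_exact_iff]
    intro x hx
    have hx' : biproduct.lift b (e.inv x) = 0 := hx
    obtain ⟨y, hy⟩ := hexact (e.inv x) fun k => by
      have := congrArg (biproduct.π B k) hx'
      rwa [← ConcreteCategory.comp_apply, biproduct.lift_π, map_zero] at this
    refine ⟨y, ?_⟩
    change e.hom (biproduct.desc a y) = x
    rw [hy, ← ConcreteCategory.comp_apply, e.inv_hom_id]
    rfl
  -- The maps `r` assemble to a retraction of the first map, which gives both its injectivity and
  -- the splitting.
  exact ⟨w, ⟨hex⟩, ⟨ShortComplex.Splitting.ofExactOfRetraction _ hex _ hretr hepi⟩⟩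

end Biproduct

/-! ### The homology of a product groupoid -/

namespace EtaleGroupoid

open AlgebraicTopology DoubleComplex Bisimplicial

/-- The complex `C_c(G⁽ⁿ⁾, ℤ)`. -/
noncomputable abbrev chains (G : EtaleGroupoid) : ChainComplex (ModuleCat.{0} ℤ) ℕ :=
  (alternatingFaceMapComplex (ModuleCat.{0} ℤ)).obj (simplicialModule G)

/-- The functoriality of `chains`. -/
noncomputable abbrev chainsMap {G H : EtaleGroupoid} (φ : G ⟶ H) : chains G ⟶ chains H :=
  (alternatingFaceMapComplex (ModuleCat.{0} ℤ)).map (simplicialModuleFunctor.map φ)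

instance (G : EtaleGroupoid) (n : ℕ) : Module.Projective ℤ ((chains G).X n) :=
  CompactlySupportedContinuousMap.projective (X := G.Nerve n)

/-- The homology of `G × H` is the homology of the tensor product of the complexes of `G` and
`H`. -/
noncomputable def homologyProdIso (G H : EtaleGroupoid) (n : ℕ) :
    (Kunneth.T (chains G) (chains H)).homology n ≅ (homology n).obj (prod G H) :=
  -- The three factors are the identification of the tensor double complex with that of a
  -- bisimplicial module, Eilenberg–Zilber, and the identification of its diagonal with the
  -- simplicial module of `G × H`.
  (HomologicalComplex.homologyFunctor _ _ n).mapIso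
      { hom := totMap (biAltOuterIso (simplicialModule G) (simplicialModule H)).inv
        inv := totMap (biAltOuterIso (simplicialModule G) (simplicialModule H)).hom
        hom_inv_id := by rw [← totMap_comp, Iso.inv_hom_id, totMap_id]
        inv_hom_id := by rw [← totMap_comp, Iso.hom_inv_id, totMap_id] } ≪≫
    (homologyTotEquivDiag (outer (simplicialModule G) (simplicialModule H)) n).toModuleIso ≪≫
    (HomologicalComplex.homologyFunctor _ _ n).mapIso
      ((alternatingFaceMapComplex _).mapIso (simplicialModuleProdIso G H))

/-- The map of products induced by two morphisms. -/
abbrev prodMap {G G' H H' : EtaleGroupoid} (φ : G ⟶ G') (ψ : H ⟶ H') : prod G H ⟶ prod G' H' :=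
  prodFunctor.map (X := (G, H)) (Y := (G', H')) (φ, ψ)

theorem homologyProdIso_naturality {G G' H H' : EtaleGroupoid} (φ : G ⟶ G') (ψ : H ⟶ H') (n : ℕ) :
    HomologicalComplex.homologyMap (Kunneth.tMap (chainsMap φ) (chainsMap ψ)) n ≫
        (homologyProdIso G' H' n).hom =
      (homologyProdIso G H n).hom ≫
        (homology n).map (prodMap φ ψ) := by
  let Φ : outer (simplicialModule G) (simplicialModule H) ⟶
      outer (simplicialModule G') (simplicialModule H') :=
    Functor.whiskerRight (NatTrans.prod (simplicialModuleFunctor.map φ)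
      (simplicialModuleFunctor.map ψ)) (tensor (ModuleCat.{0} ℤ))
  have h1 : Kunneth.tMap (chainsMap φ) (chainsMap ψ) ≫
      totMap (biAltOuterIso (simplicialModule G') (simplicialModule H')).inv =
      totMap (biAltOuterIso (simplicialModule G) (simplicialModule H)).inv ≫
        totMap (biAlt.map (curriedMap Φ)) := by
    rw [← totMap_comp, ← totMap_comp]
    refine congrArg totMap ?_
    rw [Iso.comp_inv_eq, Category.assoc]
    refine ((Iso.inv_comp_eq _).2 ?_).symm
    exact biAltOuterIso_naturality (simplicialModuleFunctor.map φ) (simplicialModuleFunctor.map ψ)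
  have h2 : HomologicalComplex.homologyMap (totMap (biAlt.map (curriedMap Φ))) n ≫
      (homologyTotEquivDiag (outer (simplicialModule G') (simplicialModule H')) n).toModuleIso.hom =
      (homologyTotEquivDiag (outer (simplicialModule G) (simplicialModule H)) n).toModuleIso.hom ≫
        HomologicalComplex.homologyMap ((alternatingFaceMapComplex _).map (diagMap Φ)) n :=
    ModuleCat.hom_ext (LinearMap.ext (homologyTotEquivDiag_naturality Φ n))
  have h3 : (alternatingFaceMapComplex _).map (diagMap Φ) ≫
      (alternatingFaceMapComplex _).map (simplicialModuleProdIso G' H').hom =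
      (alternatingFaceMapComplex _).map (simplicialModuleProdIso G H).hom ≫
        (alternatingFaceMapComplex _).map (simplicialModuleFunctor.map (prodMap φ ψ)) :=
    (CategoryTheory.Functor.map_comp _ _ _).symm.trans
      ((congrArg (alternatingFaceMapComplex _).map (simplicialModuleProdIso_naturality φ ψ)).trans
        (CategoryTheory.Functor.map_comp _ _ _))
  have h1' := (HomologicalComplex.homologyMap_comp _ _ n).symm.trans
    ((congrArg (fun f => HomologicalComplex.homologyMap f n) h1).trans
      (HomologicalComplex.homologyMap_comp _ _ n))
  have h3' := (HomologicalComplex.homologyMap_comp _ _ n).symm.trans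
    ((congrArg (fun f => HomologicalComplex.homologyMap f n) h3).trans
      (HomologicalComplex.homologyMap_comp _ _ n))
  exact comp_comm_of_comm h1' h2 h3'

end EtaleGroupoid

/-! ### The algebraic Künneth theorem -/

namespace Kunneth

variable {R : Type} [CommRing R] [IsDomain R] [IsPrincipalIdealRing R]

/-- The algebraic Künneth theorem: the homology of a tensor product of complexes of projective
modules over a principal ideal domain. -/
theorem shortExact_and_splitting (C D : ChainComplex (ModuleCat.{0} R) ℕ)
    [∀ n, Module.Projective R (C.X n)] [∀ n, Module.Projective R (D.X n)] (n : ℕ)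
    {X : ModuleCat.{0} R} (e : (T C D).homology n ≅ X)
    [Finite {p : ℕ × ℕ // p.1 + p.2 + 0 = n}] [Finite {p : ℕ × ℕ // p.1 + p.2 + 1 = n}] :
    let a := biproduct.desc (fun j : {p : ℕ × ℕ // p.1 + p.2 + 0 = n} =>
      αHom C D j.1.1 j.1.2 j.2) ≫ e.hom
    let b := e.inv ≫ biproduct.lift (fun k : {p : ℕ × ℕ // p.1 + p.2 + 1 = n} =>
      βHom C D k.1.1 k.1.2 k.2)
    ∃ w : a ≫ b = 0, (ShortComplex.mk a b w).ShortExact ∧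
      Nonempty (ShortComplex.mk a b w).Splitting := by
  refine shortExact_and_splitting_of_biproduct
    (fun j : {p : ℕ × ℕ // p.1 + p.2 + 0 = n} => αHom C D j.1.1 j.1.2 j.2)
    (fun j : {p : ℕ × ℕ // p.1 + p.2 + 0 = n} => ρHom C D j.1.1 j.1.2 j.2)
    (fun k : {p : ℕ × ℕ // p.1 + p.2 + 1 = n} => βHom C D k.1.1 k.1.2 k.2)
    e ?_ ?_ ?_ ?_ ?_
  · exact fun j x => ρ_α (p := j.1.1) (q := j.1.2) j.2 x
  · rintro ⟨⟨p, q⟩, h⟩ ⟨⟨p', q'⟩, h'⟩ x hne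
    refine ρ_α_of_ne (p := p) (q := q) (p' := p') (q' := q') h h' (fun hq => hne ?_) x
    subst hq
    obtain rfl : p = p' := by dsimp only at h h'; omega
    rfl
  · exact fun j k x => β_α (p := j.1.1) (q := j.1.2) (p' := k.1.1) (q' := k.1.2) j.2 k.2 x
  · intro x hx
    obtain ⟨y, rfl⟩ := exists_eq_sum_α x fun p q h => hx ⟨(p, q), h⟩
    refine ⟨∑ x, biproduct.ι (fun j : {p : ℕ × ℕ // p.1 + p.2 + 0 = n} =>
      (C.homology j.1.1 ⊗ D.homology j.1.2 : ModuleCat.{0} R))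
      ⟨x.1, Finset.HasAntidiagonal.mem_antidiagonal.1 x.2⟩ (y x), ?_⟩
    rw [map_sum]
    refine Finset.sum_congr rfl fun x _ => ?_
    rw [← ConcreteCategory.comp_apply, biproduct.ι_desc]
    rfl
  · rintro ⟨⟨p, q⟩, h⟩ t
    obtain ⟨x, hx, hx'⟩ := exists_β_eq (p := p) (q := q) h t
    refine ⟨x, hx, ?_⟩
    rintro ⟨⟨p', q'⟩, h'⟩ hne
    refine hx' p' q' h' fun hq => hne ?_
    subst hq
    obtain rfl : p = p' := by dsimp only at h h'; omega
    rfl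

end Kunneth

/-! ### The natural Künneth sequence of groupoids -/

namespace EtaleGroupoid

/-- The cross product `Hᵢ(G) ⊗ Hⱼ(H) → Hₙ(G × H)`, before the identification of the homology of
`G × H`. -/
noncomputable def crossHom (G H : EtaleGroupoid) (i j : ℕ) {n : ℕ} (h : i + j = n) :
    (homology i).obj G ⊗ (homology j).obj H ⟶
      (Kunneth.T (chains G) (chains H)).homology n :=
  Kunneth.αHom (chains G) (chains H) i j h

theorem crossHom_naturality {G G' H H' : EtaleGroupoid} (φ : G ⟶ G') (ψ : H ⟶ H') (i j : ℕ) {n : ℕ}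
    (h : i + j = n) :
    ((homology i).map φ ⊗ₘ (homology j).map ψ) ≫ crossHom G' H' i j h =
      crossHom G H i j h ≫
        HomologicalComplex.homologyMap (Kunneth.tMap (chainsMap φ) (chainsMap ψ)) n :=
  Kunneth.αHom_naturality (chainsMap φ) (chainsMap ψ) i j h

/-- The map from homology to `Tor(Hᵢ(G), Hⱼ(H))`, before the identification of the homology of
`G × H`. -/
noncomputable def torHom (G H : EtaleGroupoid) (i j : ℕ) {n : ℕ} (h : i + (j + 1) = n) :
    (Kunneth.T (chains G) (chains H)).homology n ⟶
      ((Tor (ModuleCat.{0} ℤ) 1).obj ((homology i).obj G)).obj ((homology j).obj H) :=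
  Kunneth.βHom (chains G) (chains H) i j h

theorem torHom_naturality {G G' H H' : EtaleGroupoid} (φ : G ⟶ G') (ψ : H ⟶ H') (i j : ℕ) {n : ℕ}
    (h : i + (j + 1) = n) :
    HomologicalComplex.homologyMap (Kunneth.tMap (chainsMap φ) (chainsMap ψ)) n ≫
        torHom G' H' i j h =
      torHom G H i j h ≫
        ((Tor (ModuleCat.{0} ℤ) 1).map ((homology i).map φ)).app ((homology j).obj H) ≫
        ((Tor (ModuleCat.{0} ℤ) 1).obj ((homology i).obj G')).map ((homology j).map ψ) :=
  Kunneth.βHom_naturality (chainsMap φ) (chainsMap ψ) i j h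

/-- The first map of the Künneth sequence. -/
noncomputable def kunnethα (n : ℕ) : tensorSum n ⟶ prodFunctor ⋙ homology n where
  app P := biproduct.desc (fun j : {p : ℕ × ℕ // p.1 + p.2 + 0 = n} =>
    crossHom P.1 P.2 j.1.1 j.1.2 j.2) ≫ (homologyProdIso P.1 P.2 n).hom
  naturality P Q φ := by
    have h := biproduct_map_comp_desc fun j : {p : ℕ × ℕ // p.1 + p.2 + 0 = n} =>
      crossHom_naturality φ.1 φ.2 j.1.1 j.1.2 j.2
    exact ((reassoc_of% h) _).trans ((congrArg (_ ≫ ·)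
      (homologyProdIso_naturality φ.1 φ.2 n)).trans (Category.assoc _ _ _).symm)

/-- The second map of the Künneth sequence. -/
noncomputable def kunnethβ (n : ℕ) : prodFunctor ⋙ homology n ⟶ torSum n where
  app P := (homologyProdIso P.1 P.2 n).inv ≫
    biproduct.lift (fun j : {p : ℕ × ℕ // p.1 + p.2 + 1 = n} =>
      torHom P.1 P.2 j.1.1 j.1.2 j.2)
  naturality P Q φ := by
    have h := biproduct_comp_lift fun j : {p : ℕ × ℕ // p.1 + p.2 + 1 = n} =>
      torHom_naturality φ.1 φ.2 j.1.1 j.1.2 j.2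
    have h' : (homology n).map (prodMap φ.1 φ.2) ≫ (homologyProdIso Q.1 Q.2 n).inv =
        (homologyProdIso P.1 P.2 n).inv ≫
          HomologicalComplex.homologyMap (Kunneth.tMap (chainsMap φ.1) (chainsMap φ.2)) n := by
      rw [Iso.comp_inv_eq, Category.assoc, homologyProdIso_naturality, Iso.inv_hom_id_assoc]
    exact ((reassoc_of% h') _).trans ((congrArg (_ ≫ ·) h).trans (Category.assoc _ _ _).symm)

end EtaleGroupoid

theorem mainTheorem12 (n : ℕ) :
    ∃ (α : EtaleGroupoid.tensorSum n ⟶ EtaleGroupoid.prodFunctor ⋙ EtaleGroupoid.homology n)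
      (β : EtaleGroupoid.prodFunctor ⋙ EtaleGroupoid.homology n ⟶ EtaleGroupoid.torSum n),
      ∀ G H : EtaleGroupoid, ∃ w : α.app (G, H) ≫ β.app (G, H) = 0,
        (ShortComplex.mk (α.app (G, H)) (β.app (G, H)) w).ShortExact ∧
        Nonempty (ShortComplex.mk (α.app (G, H)) (β.app (G, H)) w).Splitting := by
  -- At each pair the two transformations are by definition the maps of the algebraic theorem for
  -- the complexes of `G` and `H`, transported along `homologyProdIso`; the index conditions `p + q
  -- + 0 = n` and `p + q + 1 = n` reduce to those of `α` and `β`.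
  exact ⟨EtaleGroupoid.kunnethα n, EtaleGroupoid.kunnethβ n, fun G H =>
    Kunneth.shortExact_and_splitting G.chains H.chains n (EtaleGroupoid.homologyProdIso G H n)⟩
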